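/- Write $\log x=\lceil\log_2\max(x,2)\rceil$ and $[\alpha]=\{0,\dots,\alpha-1\}$. **One-way set reconciliation.** A sender holds a string $s\in[\sigma]^u$ with exactly $n$ non-zero characters, and a receiver holds a string $t\in[\sigma]^u$ whose Hamming distance from $s$ is at most $k$. Each string is given in compressed form, as a list, in arbitrary order, of the pairs $(p,s[p])$ with $s[p]\neq 0$ (respectively $(p,t[p])$ with $t[p]\ne0$). The sender sends one message to the receiver, who has to output $s$ in compressed form. Both players know the parameters $u,\sigma,n,k,\log u,\log\sigma,\log n$ and compute on a word RAM whose word size is at least a sufficiently large constant times $\log u+\log\sigma$, with unit-cost addition, subtraction, multiplication, shifts, bitwise operations and comparisons (but no division); the sender can also draw uniformly random words. **Codes.** A systematic code for strings of length $n$ over an alphabet $[q]$ that corrects $k$ errors maps a string $x$ to $x$ followed by redundant symbols, in such a way that $x$ can be decoded from every string that differs from its codeword in at most $k$ positions. Let $r(n,k,q)$ be the size of the redundancy in bits (the number of redundant symbols times $\log q$), and let $t_e(n,k,q)$ and $t_d(n,k,q)$ be the running times of the encoder and of the decoder, which the sender and the receiver respectively use as subroutines. **Theorem.** The one-way set reconciliation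 problem can be solved, for every such code, by a one-way protocol that always recovers $s$ correctly, that transmits $$O\bigl(\log u+r(n,k,2^{\Theta(\log\sigma+\log u)})\bigr)$$ bits in every run, and that runs in expected time $O\bigl(n+t_e(n,k,2^{\Theta(\log\sigma+\log u)})\bigr)$ on the sender side and in deterministic worst-case time $O\bigl(n+t_d(n,k,2^{\Theta(\log\sigma+\log u)})\bigr)$ on the receiver side. (If $t_d$ only bounds the expected running time of a decoder whose running time is random, then the receiver's time bound holds in expectation.) The constants in $O$ and $\Theta$ are absolute, and the two programs do not depend on the parameters or on the code. (For $n=0$ the time bounds are to be read as $O(1+t_e)$ and $O(1+t_d)$.) -/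

import Mathlib

open MeasureTheory
open scoped ENNReal

namespace SetRec

/-- The logarithm convention `log x = ⌈log₂ (max x 2)⌉`. -/
def lg (x : ℕ) : ℕ := Nat.clog 2 (max x 2)

/-! ### Systematic error correcting codes -/

/-- A systematic code for words of length `n` over the alphabet `[q]`, with `ρ` redundant symbols,
that corrects `k` errors: the codeword of `x` is `x` followed by `enc x`, and `x` is recovered from
every word that differs from the codeword in at most `k` positions. -/
structure SystematicCode (n k q ρ : ℕ) where
  enc : (Fin n → Fin q) → (Fin ρ → Fin q)
  dec : (Fin n → Fin q) → (Fin ρ → Fin q) → (Fin n → Fin q)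
  corrects : ∀ (x y : Fin n → Fin q) (z : Fin ρ → Fin q),
    hammingDist x y + hammingDist (enc x) z ≤ k → dec y z = x

/-! ### Bit strings -/

/-- The `b` low-order bits of `x`, least significant bit first. -/
def natToBits (b x : ℕ) : List Bool := (List.range b).map fun i => x.testBit i

/-- The number whose binary representation, least significant bit first, is the given list. -/
def bitsToNat : List Bool → ℕ
  | [] => 0
  | b :: l => b.toNat + 2 * bitsToNat l

/-! ### The word RAM

Words have `w` bits, and there are `2 ^ w` memory cells of one word each.  A program is a finite
structured program over a fixed finite set of registers.  Every instruction, and every test of an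
`if` or a `while`, takes one step.  Multiplication is available, division is not. -/

/-- Operations on words. All arithmetic is modulo `2 ^ w`; comparisons return `0` or `1`. -/
inductive BinOp
  | add | sub | mul | and | or | xor | shl | shr | lt | eq

def BinOp.eval {w : ℕ} : BinOp → BitVec w → BitVec w → BitVec w
  | .add, x, y => x + y
  | .sub, x, y => x - y
  | .mul, x, y => x * y
  | .and, x, y => x &&& y
  | .or, x, y => x ||| y
  | .xor, x, y => x ^^^ y
  | .shl, x, y => x <<< y.toNat
  | .shr, x, y => x >>> y.toNat
  | .lt, x, y => if x.toNat < y.toNat then BitVec.ofNat w 1 else 0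
  | .eq, x, y => if x = y then BitVec.ofNat w 1 else 0

/-- Instructions; the arguments are names of registers (except the literal of `const`). -/
inductive Instr
  /-- `const d v`: put the literal `v` into register `d` -/
  | const (d v : ℕ)
  /-- `op o d a b`: put `a o b` into register `d` -/
  | op (o : BinOp) (d a b : ℕ)
  /-- `load d a`: put the memory cell whose address is in register `a` into register `d` -/
  | load (d a : ℕ)
  /-- `store a b`: put register `b` into the memory cell whose address is in register `a` -/
  | store (a b : ℕ)
  /-- `rand d`: put a uniformly random word into register `d` -/
  | rand (d : ℕ)
  /-- `send a b`: append low-order bits of register `a`, as many as register `b` says (at most `w`),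
  to the outgoing message -/
  | send (a b : ℕ)
  /-- `recv d b`: take the next bits, as many as register `b` says (at most `w`), from the incoming
  message and put them into register `d` -/
  | recv (d b : ℕ)
  /-- `encode a`: run the encoder of the code on the word stored in the cells that begin at the
  address in register `a`, one symbol per cell, and append its redundancy to the outgoing message -/
  | encode (a : ℕ)
  /-- `decode a`: take a redundancy from the incoming message, run the decoder of the code on it and
  on the word stored in the cells that begin at the address in register `a`, and overwrite these
  cells with the result -/
  | decode (a : ℕ)

/-- Structured programs. -/
inductive Prog
  | instr (i : Instr)
  | seq (p q : Prog)
  /-- `ite a p q`: run `p` if register `a` is not zero, and `q` otherwise -/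
  | ite (a : ℕ) (p q : Prog)
  /-- `while a p`: run `p` as long as register `a` is not zero -/
  | while (a : ℕ) (p : Prog)

/-- The program draws no random words. -/
def Prog.IsDeterministic : Prog → Prop
  | .instr (.rand _) => False
  | .instr _ => True
  | .seq p q => p.IsDeterministic ∧ q.IsDeterministic
  | .ite _ p q => p.IsDeterministic ∧ q.IsDeterministic
  | .while _ p => p.IsDeterministic

/-- Configurations of the machine: registers, memory, unread part of the incoming message,
outgoing message, number of random words drawn, number of steps made, and numbers of calls of the
encoder and of the decoder. -/
structure State (w : ℕ) where
  reg : ℕ → BitVec w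
  mem : BitVec w → BitVec w
  inMsg : List Bool
  outMsg : List Bool
  drawn : ℕ
  steps : ℕ
  encCalls : ℕ
  decCalls : ℕ

/-- Total running time if a call of the encoder takes time `te` and one of the decoder `td`. -/
def State.time {w : ℕ} (S : State w) (te td : ℕ) : ℕ :=
  S.steps + S.encCalls * te + S.decCalls * td

def State.setReg {w : ℕ} (S : State w) (d : ℕ) (x : BitVec w) : State w :=
  { S with reg := Function.update S.reg d x }

def State.tick {w : ℕ} (S : State w) : State w := { S with steps := S.steps + 1 }

section Semantics

variable {w n k ℓ ρ : ℕ}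

/-- The word of `n` symbols from `[2 ^ ℓ]` stored in memory from address `a` on. -/
def State.symbolsAt (S : State w) (n ℓ : ℕ) (a : BitVec w) : Fin n → Fin (2 ^ ℓ) := fun i =>
  Fin.ofNat (2 ^ ℓ) (S.mem (a + BitVec.ofNat w i)).toNat

/-- Memory after the word `x` has been written to it from address `a` on. -/
def State.writeSymbols (S : State w) (a : BitVec w) (x : Fin n → Fin (2 ^ ℓ)) : State w :=
  { S with mem := fun b =>
      if h : (b - a).toNat < n then BitVec.ofNat w (x ⟨(b - a).toNat, h⟩) else S.mem b }

/-- A redundancy as a string of `ρ * ℓ` bits. -/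
def redundancyBits (z : Fin ρ → Fin (2 ^ ℓ)) : List Bool :=
  (List.ofFn z).flatMap fun a => natToBits ℓ a

/-- The redundancy that the first `ρ * ℓ` bits of a message spell out. -/
def parseRedundancy (ρ ℓ : ℕ) (m : List Bool) : Fin ρ → Fin (2 ^ ℓ) := fun j =>
  Fin.ofNat (2 ^ ℓ) (bitsToNat ((m.drop (j * ℓ)).take ℓ))

/-- The effect of one instruction, given the code and the sequence of random words. -/
def Instr.exec (code : SystematicCode n k (2 ^ ℓ) ρ) (tape : ℕ → Fin (2 ^ w))
    (S : State w) : Instr → State w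
  | .const d v => S.setReg d (BitVec.ofNat w v)
  | .op o d a b => S.setReg d (o.eval (S.reg a) (S.reg b))
  | .load d a => S.setReg d (S.mem (S.reg a))
  | .store a b => { S with mem := Function.update S.mem (S.reg a) (S.reg b) }
  | .rand d => { S.setReg d (BitVec.ofFin (tape S.drawn)) with drawn := S.drawn + 1 }
  | .send a b =>
      { S with outMsg := S.outMsg ++ natToBits (min (S.reg b).toNat w) (S.reg a).toNat }
  | .recv d b =>
      { S.setReg d (BitVec.ofNat w (bitsToNat (S.inMsg.take (min (S.reg b).toNat w)))) with
        inMsg := S.inMsg.drop (min (S.reg b).toNat w) }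
  | .encode a =>
      { S with
        outMsg := S.outMsg ++ redundancyBits (code.enc (S.symbolsAt n ℓ (S.reg a)))
        encCalls := S.encCalls + 1 }
  | .decode a =>
      { S.writeSymbols (S.reg a)
          (code.dec (S.symbolsAt n ℓ (S.reg a)) (parseRedundancy ρ ℓ S.inMsg)) with
        inMsg := S.inMsg.drop (ρ * ℓ)
        decCalls := S.decCalls + 1 }

/-- `Exec code tape p S T`: the program `p`, started in `S`, halts in `T`. -/
inductive Exec (code : SystematicCode n k (2 ^ ℓ) ρ) (tape : ℕ → Fin (2 ^ w)) :
    Prog → State w → State w → Prop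
  | instr (i : Instr) (S : State w) : Exec code tape (.instr i) S (i.exec code tape S).tick
  | seq {p q : Prog} {S T U : State w} :
      Exec code tape p S T → Exec code tape q T U → Exec code tape (.seq p q) S U
  | iteTrue {a : ℕ} {p q : Prog} {S T : State w} :
      S.reg a ≠ 0 → Exec code tape p S.tick T → Exec code tape (.ite a p q) S T
  | iteFalse {a : ℕ} {p q : Prog} {S T : State w} :
      S.reg a = 0 → Exec code tape q S.tick T → Exec code tape (.ite a p q) S T
  | whileTrue {a : ℕ} {p : Prog} {S T U : State w} :
      S.reg a ≠ 0 → Exec code tape p S.tick T → Exec code tape (.while a p) T U →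
        Exec code tape (.while a p) S U
  | whileFalse {a : ℕ} {p : Prog} {S : State w} :
      S.reg a = 0 → Exec code tape (.while a p) S S.tick

/-- The running time of `p` on `S`, and `∞` if `p` does not halt. -/
noncomputable def runTime (code : SystematicCode n k (2 ^ ℓ) ρ) (te td : ℕ) (p : Prog)
    (S : State w) (tape : ℕ → Fin (2 ^ w)) : ℝ≥0∞ :=
  ⨅ (T : State w) (_ : Exec code tape p S T), (T.time te td : ℝ≥0∞)

end Semantics

/-- The law of a sequence of independent uniformly random `w`-bit words. -/
noncomputable def tapeLaw (w : ℕ) : Measure (ℕ → Fin (2 ^ w)) :=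
  Measure.infinitePi fun _ => (PMF.uniformOfFintype (Fin (2 ^ w))).toMeasure

/-! ### Set reconciliation -/

section Strings

variable {u σ : ℕ}

/-- The number of non-zero characters of a string. -/
def nonzeros (s : Fin u → Fin σ) : ℕ := (Finset.univ.filter fun p => (s p : ℕ) ≠ 0).card

/-- `L` is a compressed form of the string `s`: it lists the pairs `(p, s p)` with `s p ≠ 0`,
each of them once, in any order. -/
def Lists (L : List (Fin u × Fin σ)) (s : Fin u → Fin σ) : Prop :=
  L.Nodup ∧ ∀ p c, (p, c) ∈ L ↔ s p = c ∧ (c : ℕ) ≠ 0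

/-- A memory that holds the pairs of `L` in the first `2 * L.length` cells, and is zero
elsewhere. -/
def loadList (w : ℕ) (L : List (Fin u × Fin σ)) : BitVec w → BitVec w := fun a =>
  if h : a.toNat / 2 < L.length then
    if a.toNat % 2 = 0 then BitVec.ofNat w (L[a.toNat / 2]).1 else BitVec.ofNat w (L[a.toNat / 2]).2
  else 0

/-- The memory `mem` holds the pairs of `L` from address `a` on. -/
def StoredAt {w : ℕ} (mem : BitVec w → BitVec w) (a : BitVec w)
    (L : List (Fin u × Fin σ)) : Prop :=
  ∀ (i : ℕ) (h : i < L.length),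
    mem (a + BitVec.ofNat w (2 * i)) = BitVec.ofNat w (L[i]).1 ∧
    mem (a + BitVec.ofNat w (2 * i + 1)) = BitVec.ofNat w (L[i]).2

/-- Initial configuration of a player who knows the parameters and the list `L` and has received
the message `m`. -/
def start (w n k : ℕ) (L : List (Fin u × Fin σ)) (m : List Bool) : State w where
  reg := fun r => BitVec.ofNat w
    (match r with
      | 0 => L.length
      | 1 => n
      | 2 => k
      | 3 => u
      | 4 => σ
      | 5 => lg n
      | 6 => lg u
      | 7 => lg σ
      | _ => 0)
  mem := loadList w L
  inMsg := m
  outMsg := []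
  drawn := 0
  steps := 0
  encCalls := 0
  decCalls := 0

end Strings

end SetRec

/-!
The players distribute the `n` keys, which are pairs of a position and a character packed into one
number, over `2 ^ m` buckets, where `2 ^ m ≤ n ≤ 2 * 2 ^ m`. The hash function consists of the top
bits of a polynomial of degree `7` modulo a power of two. Its coefficients are the sender's random
word, the seed, so that any `8` positions collide with the probability that full independence would
give (`card_const_le`). Hence the expected sum of the eighth powers of the bucket sizes is `O(n)`,
and a random seed is good, which means that this sum is at most `seedBound * n`, with probability at
least `1 / 2` (`two_mul_card_badSeeds_le`). The sender draws seeds until one is good. This takes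
linear time in expectation (`lintegral_le_of_rounds`), and from then on everything is deterministic,
and every bucket can be treated in time polynomial in its size.

For a good seed the sender describes its set of keys by words that the code then protects. There are
three words with one symbol per bucket: the size `b`, a mask of at most `b ^ 2` bits that contains
the lowest difference of any two keys of the bucket, and the least modulus `p` for which the masked
bits of the keys remain distinct modulo `p`. The product of the differences of the
masked keys is small, while a number that all of `1, …, 2 * N` divide is a multiple of the central
binomial coefficient of `N`. Hence the modulus is `O(b ^ 4)` (`exists_modulus`); it can be found
without division and without randomness. The moduli sum to at most `2 ^ 27 * n`, so that all keys fit without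
collision into a table of that length (`keysOf_tabRow`), which is sent as `2 ^ 27` further words. The
message consists of `64 * L` bits of the seed, with `L = lg u`, and of the redundancies of these
words.

All rows are functions of the set of keys, bucket by bucket. Therefore the rows that the receiver
computes from its own keys differ from those of the sender in at most as many places as the strings
do, and the decoder turns them into the sender's rows one after the other. Two points need care. The
receiver cannot afford to treat large buckets, and it only treats those whose size agrees with the
decoded one. When it fills the table by means of the decoded masks and moduli, it leaves out the
buckets with more than twice the expected number of keys; in such a bucket the strings differ in at
least as many positions as the sender has keys there, so that the table still has at most `k` wrong
entries (`exists_table_diffs`). Similarly, a list of more than `2 * n` pairs is replaced by the empty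
list (`card_diffs_trim_le`).

The programs are verified in a small logic of total correctness with time bounds, `Sat`, on
configurations that hold natural numbers instead of words. In these, the memory is a matrix with
rows of length `2 ^ LN`. Row `0` is the input, the rows `1`, `3` and `4` are the three words with one
symbol per bucket, row `2` holds the sizes of the player's own buckets, row `5` is the table, row `6`
the output, and the rows from `8` on contain the buckets.
-/

namespace SetRec

/-! ### Reasoning about programs on natural numbers -/

/-- The part of a configuration that concerns communication, randomness and calls of the code. -/
structure Chan where
  inMsg : List Bool
  outMsg : List Bool
  drawn : ℕ
  encCalls : ℕ
  decCalls : ℕ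

/-- A configuration with registers and memory cells that hold natural numbers. The memory is a
matrix: `mem q r` is the cell in column `r` of row `q`. -/
structure Abs where
  reg : ℕ → ℕ
  mem : ℕ → ℕ → ℕ
  ch : Chan

/-- Everything that stays fixed while a program runs: the word size, the code, the random words,
the logarithm `LN` of the length of a row of the memory, and the number `K` of calls of the code that
transmit the table of the keys. -/
structure Mach where
  w : ℕ
  n : ℕ
  k : ℕ
  ℓ : ℕ
  ρ : ℕ
  LN : ℕ
  K : ℕ
  code : SystematicCode n k (2 ^ ℓ) ρ
  tape : ℕ → Fin (2 ^ w)

/-- The program `p`, started in `S`, halts in `T`. -/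
abbrev Mach.Exec (X : Mach) (p : Prog) (S T : State X.w) : Prop :=
  SetRec.Exec X.code X.tape p S T

/-- `S` represents `A` modulo `2 ^ w`. Register `9` is a scratch register for addresses, and the cell
in row `q` and column `r` has the address `q * 2 ^ LN + r`. -/
structure Rep (X : Mach) (S : State X.w) (A : Abs) : Prop where
  reg : ∀ r, r ≠ 9 → S.reg r = BitVec.ofNat X.w (A.reg r)
  mem : ∀ q r, q < 2 ^ (X.w - X.LN) → r < 2 ^ X.LN →
    S.mem (BitVec.ofNat X.w (q * 2 ^ X.LN + r)) = BitVec.ofNat X.w (A.mem q r)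
  inMsg : S.inMsg = A.ch.inMsg
  outMsg : S.outMsg = A.ch.outMsg
  drawn : S.drawn = A.ch.drawn
  encCalls : S.encCalls = A.ch.encCalls
  decCalls : S.decCalls = A.ch.decCalls
  le : X.LN ≤ X.w

/-- Total correctness with a bound on the number of steps: from every configuration that represents
`A`, the program `p` halts after at most `c` steps in one that represents some `B` with `Q B`. -/
def Sat (X : Mach) (p : Prog) (A : Abs) (c : ℕ) (Q : Abs → Prop) : Prop :=
  ∀ S, Rep X S A → ∃ T B, X.Exec p S T ∧ T.steps ≤ S.steps + c ∧ Rep X T B ∧ Q B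

lemma Rep.tick {X : Mach} {S : State X.w} {A : Abs} (h : Rep X S A) : Rep X S.tick A :=
  ⟨h.reg, h.mem, h.inMsg, h.outMsg, h.drawn, h.encCalls, h.decCalls, h.le⟩

lemma addr_lt {w LN q r : ℕ} (hw : LN ≤ w) (hq : q < 2 ^ (w - LN)) (hr : r < 2 ^ LN) :
    q * 2 ^ LN + r < 2 ^ w := by
  have h1 : (q + 1) * 2 ^ LN ≤ 2 ^ (w - LN) * 2 ^ LN := Nat.mul_le_mul_right _ hq
  rw [← pow_add, Nat.sub_add_cancel hw] at h1
  rw [add_mul] at h1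
  omega

lemma addr_inj {N q r q' r' : ℕ} (hr : r < N) (hr' : r' < N)
    (h : q * N + r = q' * N + r') : q = q' ∧ r = r' := by
  have hN : 0 < N := by omega
  have h1 : (q * N + r) / N = q := by
    rw [add_comm, Nat.add_mul_div_right _ _ hN, Nat.div_eq_of_lt hr, zero_add]
  have h2 : (q' * N + r') / N = q' := by
    rw [add_comm, Nat.add_mul_div_right _ _ hN, Nat.div_eq_of_lt hr', zero_add]
  have : q = q' := by rw [← h1, h, h2]
  subst this
  exact ⟨rfl, by omega⟩

lemma ofNat_inj_of_lt {w a b : ℕ} (ha : a < 2 ^ w) (hb : b < 2 ^ w)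
    (h : BitVec.ofNat w a = BitVec.ofNat w b) : a = b := by
  have := congrArg BitVec.toNat h
  simpa [Nat.mod_eq_of_lt ha, Nat.mod_eq_of_lt hb] using this

lemma ofNat_sub_eq {w x y : ℕ} (h : y ≤ x) :
    BitVec.ofNat w (x - y) = BitVec.ofNat w x - BitVec.ofNat w y := by
  obtain ⟨z, rfl⟩ := Nat.exists_eq_add_of_le h
  rw [Nat.add_sub_cancel_left, BitVec.ofNat_add, BitVec.add_comm, BitVec.add_sub_cancel]

lemma ofNat_shl_eq {w x y : ℕ} (h : y < 2 ^ w) :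
    BitVec.ofNat w (x * 2 ^ y) = BitVec.ofNat w x <<< (BitVec.ofNat w y).toNat := by
  apply BitVec.eq_of_toNat_eq
  simp [Nat.mod_eq_of_lt h, Nat.shiftLeft_eq]

lemma ofNat_shr_eq {w x y : ℕ} (hx : x < 2 ^ w) (h : y < 2 ^ w) :
    BitVec.ofNat w (x / 2 ^ y) = BitVec.ofNat w x >>> (BitVec.ofNat w y).toNat := by
  apply BitVec.eq_of_toNat_eq
  have : x / 2 ^ y < 2 ^ w := lt_of_le_of_lt (Nat.div_le_self _ _) hx
  simp [Nat.mod_eq_of_lt h, Nat.mod_eq_of_lt hx, Nat.shiftRight_eq_div_pow, Nat.mod_eq_of_lt this]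

/-- Operations on natural numbers. -/
def BinOp.nat : BinOp → ℕ → ℕ → ℕ
  | .add, x, y => x + y
  | .sub, x, y => x - y
  | .mul, x, y => x * y
  | .and, x, y => x &&& y
  | .or, x, y => x ||| y
  | .xor, x, y => x ^^^ y
  | .shl, x, y => x * 2 ^ y
  | .shr, x, y => x / 2 ^ y
  | .lt, x, y => if x < y then 1 else 0
  | .eq, x, y => if x = y then 1 else 0

/-- The condition under which the operation on words agrees with the one on natural numbers
modulo `2 ^ w`. -/
def BinOp.ok (w : ℕ) : BinOp → ℕ → ℕ → Prop
  | .sub, x, y => y ≤ x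
  | .shl, _, y => y < 2 ^ w
  | .shr, x, y => x < 2 ^ w ∧ y < 2 ^ w
  | .lt, x, y => x < 2 ^ w ∧ y < 2 ^ w
  | .eq, x, y => x < 2 ^ w ∧ y < 2 ^ w
  | _, _, _ => True

lemma BinOp.eval_ofNat {w : ℕ} {o : BinOp} {x y : ℕ} (h : o.ok w x y) :
    o.eval (BitVec.ofNat w x) (BitVec.ofNat w y) = BitVec.ofNat w (o.nat x y) := by
  cases o <;> simp only [BinOp.eval, BinOp.nat, BinOp.ok] at *
  · rw [BitVec.ofNat_add]
  · rw [ofNat_sub_eq h]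
  · rw [BitVec.ofNat_mul]
  · rw [BitVec.ofNat_and]
  · rw [BitVec.ofNat_or]
  · rw [BitVec.ofNat_xor]
  · rw [ofNat_shl_eq h]
  · rw [ofNat_shr_eq h.1 h.2]
  · simp only [BitVec.toNat_ofNat, Nat.mod_eq_of_lt h.1, Nat.mod_eq_of_lt h.2]
    split_ifs <;> rfl
  · by_cases hxy : x = y
    · simp [hxy]
    · rw [if_neg hxy, if_neg (fun h' => hxy (ofNat_inj_of_lt h.1 h.2 h'))]
      rfl

/-- Straight-line commands: constants, operations, and reading and writing of the cell in the row
and the column given by two registers. -/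
inductive Cmd
  | const (d v : ℕ)
  | op (o : BinOp) (d a b : ℕ)
  | get (d q r : ℕ)
  | put (q r v : ℕ)

/-- Put the address of the cell in row `reg q` and column `reg r` into the scratch register. -/
def addrProg (q r : ℕ) : Prog :=
  .seq (.instr (.op .shl 9 q 10)) (.instr (.op .add 9 9 r))

/-- The program that carries out a command. -/
def Cmd.prog : Cmd → Prog
  | .const d v => .instr (.const d v)
  | .op o d a b => .instr (.op o d a b)
  | .get d q r => .seq (addrProg q r) (.instr (.load d 9))
  | .put q r v => .seq (addrProg q r) (.instr (.store 9 v))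

/-- Put `x` into register `d`. -/
def Abs.set (A : Abs) (d x : ℕ) : Abs := { A with reg := Function.update A.reg d x }

/-- Put `x` into the cell in row `q` and column `r`. -/
def Abs.put (A : Abs) (q r x : ℕ) : Abs :=
  { A with mem := Function.update A.mem q (Function.update (A.mem q) r x) }

@[simp] lemma Abs.set_reg (A : Abs) (d x r : ℕ) :
    (A.set d x).reg r = if r = d then x else A.reg r := by
  simp only [Abs.set, Function.update_apply]

@[simp] lemma Abs.set_mem (A : Abs) (d x : ℕ) : (A.set d x).mem = A.mem := rfl

@[simp] lemma Abs.set_ch (A : Abs) (d x : ℕ) : (A.set d x).ch = A.ch := rfl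

@[simp] lemma Abs.put_reg (A : Abs) (q r x : ℕ) : (A.put q r x).reg = A.reg := rfl

@[simp] lemma Abs.put_mem (A : Abs) (q r x q' r' : ℕ) :
    (A.put q r x).mem q' r' = if q' = q ∧ r' = r then x else A.mem q' r' := by
  simp only [Abs.put, Function.update_apply]
  split_ifs <;> simp_all

@[simp] lemma Abs.put_ch (A : Abs) (q r x : ℕ) : (A.put q r x).ch = A.ch := rfl

/-- The effect of a command on natural numbers. -/
def Cmd.eval : Cmd → Abs → Abs
  | .const d v, A => A.set d v
  | .op o d a b, A => A.set d (o.nat (A.reg a) (A.reg b))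
  | .get d q r, A => A.set d (A.mem (A.reg q) (A.reg r))
  | .put q r v, A => A.put (A.reg q) (A.reg r) (A.reg v)

/-- Row `reg q` and column `reg r` exist. -/
def Abs.cell (X : Mach) (A : Abs) (q r : ℕ) : Prop :=
  q ≠ 9 ∧ r ≠ 9 ∧ A.reg 10 = X.LN ∧ A.reg q < 2 ^ (X.w - X.LN) ∧ A.reg r < 2 ^ X.LN

/-- The condition under which the effect of a command on words is the one on natural numbers. Only
results of subtractions, shifts and comparisons depend on more than residues modulo `2 ^ w`. -/
def Cmd.ok (X : Mach) : Cmd → Abs → Prop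
  | .const _ _, _ => True
  | .op o _ a b, A => a ≠ 9 ∧ b ≠ 9 ∧ o.ok X.w (A.reg a) (A.reg b)
  | .get _ q r, A => A.cell X q r
  | .put q r v, A => v ≠ 9 ∧ A.cell X q r

lemma Rep.setReg {X : Mach} {S : State X.w} {A : Abs} (h : Rep X S A) (d x : ℕ) :
    Rep X (S.setReg d (BitVec.ofNat X.w x)) (A.set d x) := by
  refine ⟨fun r hr => ?_, h.mem, h.inMsg, h.outMsg, h.drawn, h.encCalls, h.decCalls, h.le⟩
  simp only [State.setReg, Abs.set, Function.update_apply]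
  split_ifs
  · rfl
  · exact h.reg r hr

lemma Rep.setScratch {X : Mach} {S : State X.w} {A : Abs} (h : Rep X S A) (x : BitVec X.w) :
    Rep X (S.setReg 9 x) A := by
  refine ⟨fun r hr => ?_, h.mem, h.inMsg, h.outMsg, h.drawn, h.encCalls, h.decCalls, h.le⟩
  simp only [State.setReg, Function.update_apply, if_neg hr]
  exact h.reg r hr

lemma addrProg_exec {X : Mach} {S : State X.w} {A : Abs} {q r : ℕ} (h : Rep X S A)
    (hc : A.cell X q r) :
    ∃ T, X.Exec (addrProg q r) S T ∧ T.steps = S.steps + 2 ∧ Rep X T A ∧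
      T.reg 9 = BitVec.ofNat X.w (A.reg q * 2 ^ X.LN + A.reg r) := by
  obtain ⟨hq, hr, h10, hq', hr'⟩ := hc
  refine ⟨_, .seq (.instr _ _) (.instr _ _), rfl, ?_, ?_⟩
  · exact ((h.setScratch _).tick.setScratch _).tick
  · have e1 : S.reg 10 = BitVec.ofNat X.w X.LN := by rw [← h10]; exact h.reg 10 (by norm_num)
    have hLN : X.LN < 2 ^ X.w := lt_of_le_of_lt h.le Nat.lt_two_pow_self
    simp only [Instr.exec, State.setReg, State.tick, Function.update_apply, BinOp.eval, if_true, hr,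
      if_false, h.reg q hq, h.reg r hr, e1]
    rw [← ofNat_shl_eq hLN, ← BitVec.ofNat_add]

lemma Rep.store {X : Mach} {S : State X.w} {A : Abs} {q r : ℕ} (h : Rep X S A)
    (hq : q < 2 ^ (X.w - X.LN)) (hr : r < 2 ^ X.LN) (x : ℕ) :
    Rep X
      { S with
        mem := Function.update S.mem (BitVec.ofNat X.w (q * 2 ^ X.LN + r)) (BitVec.ofNat X.w x) }
      (A.put q r x) := by
  refine ⟨h.reg, fun q' r' hq' hr' => ?_, h.inMsg, h.outMsg, h.drawn, h.encCalls, h.decCalls, h.le⟩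
  simp only [Abs.put, Function.update_apply]
  by_cases hqr : q' = q ∧ r' = r
  · obtain ⟨rfl, rfl⟩ := hqr
    simp
  · rw [if_neg]
    · rw [h.mem q' r' hq' hr']
      by_cases h1 : q' = q
      · subst h1
        have h2 : r' ≠ r := fun h2 => hqr ⟨rfl, h2⟩
        simp [h2]
      · simp [h1]
    · intro hh
      exact hqr (addr_inj hr' hr
        (ofNat_inj_of_lt (addr_lt h.le hq' hr') (addr_lt h.le hq hr) hh))

lemma Cmd.sat {X : Mach} {c : Cmd} {A : Abs} {Q : Abs → Prop} (hok : c.ok X A)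
    (hQ : Q (c.eval A)) : Sat X c.prog A 3 Q := by
  intro S h
  cases c with
  | const d v => exact ⟨_, _, .instr _ _, by simp [State.tick, Instr.exec, State.setReg],
      (h.setReg d v).tick, hQ⟩
  | op o d a b =>
    refine ⟨_, _, .instr _ _, by simp [State.tick, Instr.exec, State.setReg], ?_, hQ⟩
    simp only [Instr.exec, h.reg a hok.1, h.reg b hok.2.1, BinOp.eval_ofNat hok.2.2]
    exact (h.setReg _ _).tick
  | get d q r =>
    obtain ⟨T, hT, hs, hR, h9⟩ := addrProg_exec h hok
    refine ⟨_, _, .seq hT (.instr _ _), by simp [State.tick, Instr.exec, State.setReg, hs], ?_, hQ⟩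
    simp only [Instr.exec, h9, hR.mem _ _ hok.2.2.2.1 hok.2.2.2.2]
    exact (hR.setReg _ _).tick
  | put q r v =>
    obtain ⟨T, hT, hs, hR, h9⟩ := addrProg_exec h hok.2
    refine ⟨_, _, .seq hT (.instr _ _), by simp [State.tick, Instr.exec, hs], ?_, hQ⟩
    simp only [Instr.exec, h9, hR.reg v hok.1]
    exact (hR.store hok.2.2.2.2.1 hok.2.2.2.2.2 _).tick

/-- A sequence of straight-line commands. -/
def block : List Cmd → Prog
  | [] => .instr (.const 9 0)
  | c :: l => .seq c.prog (block l)

/-- The effect of a sequence of commands. -/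
def evalL : List Cmd → Abs → Abs
  | [], A => A
  | c :: l, A => evalL l (c.eval A)

/-- All commands of a sequence act on words as they do on natural numbers. -/
def okL (X : Mach) : List Cmd → Abs → Prop
  | [], _ => True
  | c :: l, A => c.ok X A ∧ okL X l (c.eval A)

attribute [simp] okL evalL Cmd.ok Cmd.eval BinOp.ok BinOp.nat Abs.cell

section Rules

variable {X : Mach} {A : Abs} {Q : Abs → Prop}

lemma Sat.mono {p : Prog} {c c' : ℕ} {Q' : Abs → Prop} (h : Sat X p A c Q) (hc : c ≤ c')
    (hQ : ∀ B, Q B → Q' B) : Sat X p A c' Q' := fun S hS =>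
  let ⟨T, B, h1, h2, h3, h4⟩ := h S hS
  ⟨T, B, h1, by omega, h3, hQ B h4⟩

lemma Sat.seq {p q : Prog} {c c' : ℕ} {R : Abs → Prop} (hp : Sat X p A c R)
    (hq : ∀ B, R B → Sat X q B c' Q) : Sat X (.seq p q) A (c + c') Q := fun S hS =>
  let ⟨T, B, h1, h2, h3, h4⟩ := hp S hS
  let ⟨T', B', h1', h2', h3', h4'⟩ := hq B h4 T h3
  ⟨T', B', .seq h1 h1', by omega, h3', h4'⟩

lemma Sat.skip (hQ : Q A) : Sat X (.instr (.const 9 0)) A 1 Q := fun _ hS =>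
  ⟨_, A, .instr _ _, by simp [State.tick, Instr.exec, State.setReg], (hS.setScratch _).tick, hQ⟩

lemma Sat.blk {l : List Cmd} (hok : okL X l A) (hQ : Q (evalL l A)) :
    Sat X (block l) A (3 * l.length + 1) Q := by
  induction l generalizing A with
  | nil => exact Sat.skip hQ
  | cons c l ih =>
    exact ((Cmd.sat (Q := fun B => B = c.eval A) hok.1 rfl).seq
      (fun B hB => hB ▸ ih hok.2 hQ)).mono (by simp only [List.length_cons]; omega) fun _ h => h

lemma Rep.reg_eq_zero {S : State X.w} (h : Rep X S A) {a : ℕ} (ha : a ≠ 9)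
    (hlt : A.reg a < 2 ^ X.w) : S.reg a = 0 ↔ A.reg a = 0 := by
  rw [h.reg a ha]
  constructor
  · intro h'
    exact ofNat_inj_of_lt hlt (Nat.two_pow_pos _) h'
  · intro h'
    rw [h']
    rfl

lemma Sat.ite {a : ℕ} {p q : Prog} {c : ℕ} (ha : a ≠ 9) (hlt : A.reg a < 2 ^ X.w)
    (hp : A.reg a ≠ 0 → Sat X p A c Q) (hq : A.reg a = 0 → Sat X q A c Q) :
    Sat X (.ite a p q) A (c + 1) Q := by
  intro S hS
  by_cases h0 : A.reg a = 0
  · obtain ⟨T, B, h1, h2, h3, h4⟩ := hq h0 S.tick hS.tick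
    exact ⟨T, B, .iteFalse ((hS.reg_eq_zero ha hlt).2 h0) h1, by simp [State.tick] at h2; omega,
      h3, h4⟩
  · obtain ⟨T, B, h1, h2, h3, h4⟩ := hp h0 S.tick hS.tick
    exact ⟨T, B, .iteTrue (mt (hS.reg_eq_zero ha hlt).1 h0) h1, by simp [State.tick] at h2; omega,
      h3, h4⟩

/-- A loop whose invariant counts the remaining rounds; the round that begins with `j + 1` rounds
remaining takes `f j` steps. -/
lemma Sat.while {a : ℕ} {p : Prog} (ha : a ≠ 9) (f : ℕ → ℕ) (I : ℕ → Abs → Prop)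
    (hlt : ∀ j B, I j B → B.reg a < 2 ^ X.w) (h0 : ∀ B, I 0 B → B.reg a = 0)
    (hs : ∀ j B, I (j + 1) B → B.reg a ≠ 0 ∧ Sat X p B (f j) (I j)) (j : ℕ) (hI : I j A) :
    Sat X (.while a p) A (∑ i ∈ Finset.range j, (f i + 1) + 1) (I 0) := by
  induction j generalizing A with
  | zero =>
    intro S hS
    exact ⟨_, A, .whileFalse ((hS.reg_eq_zero ha (hlt _ _ hI)).2 (h0 _ hI)), by simp [State.tick],
      hS.tick, hI⟩
  | succ j ih =>
    intro S hS
    obtain ⟨hne, hb⟩ := hs j A hI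
    obtain ⟨T, B, h1, h2, h3, h4⟩ := hb S.tick hS.tick
    obtain ⟨T', B', h1', h2', h3', h4'⟩ := ih h4 T h3
    refine ⟨T', B', .whileTrue (mt (hS.reg_eq_zero ha (hlt _ _ hI)).1 hne) h1 h1', ?_, h3', h4'⟩
    rw [Finset.sum_range_succ]
    simp only [State.tick] at h2
    omega

end Rules

/-- `for i in 0, …, reg b - 1 do p`. The loop uses register `i + 1` for its test, and expects `1`
in register `12`. -/
def forP (i b : ℕ) (p : Prog) : Prog :=
  .seq (block [.const i 0, .op .lt (i + 1) i b])
    (.while (i + 1) (.seq p (block [.op .add i i 12, .op .lt (i + 1) i b])))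

lemma Sat.loop {X : Mach} {A : Abs} {i b cnt : ℕ} {p : Prog} (I : ℕ → Abs → Prop) (f : ℕ → ℕ)
    (hi : 12 < i) (hb : b ≠ 9) (hbi : b < i) (hcnt : cnt < 2 ^ X.w)
    (hstab : ∀ j B B', I j B → (∀ r, r ≠ i → r ≠ i + 1 → B'.reg r = B.reg r) → B'.mem = B.mem →
      B'.ch = B.ch → I j B')
    (hfr : ∀ j B, I j B → B.reg b = cnt ∧ B.reg 12 = 1)
    (h0 : I 0 A)
    (hbody : ∀ j, j < cnt → ∀ B, I j B → B.reg i = j →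
      Sat X p B (f j) (fun B' => I (j + 1) B' ∧ B'.reg i = j)) :
    Sat X (forP i b p) A (∑ j ∈ Finset.range cnt, (f j + 8) + 8) (I cnt) := by
  have hi9 : i ≠ 9 := by omega
  -- `j` rounds remain when the counter is at `cnt - j`
  have hw := Sat.while (X := X) (A := evalL [.const i 0, .op .lt (i + 1) i b] A)
    (a := i + 1) (p := .seq p (block [.op .add i i 12, .op .lt (i + 1) i b])) (by omega)
    (fun j => f (cnt - 1 - j) + 7)
    (fun j B => j ≤ cnt ∧ I (cnt - j) B ∧ B.reg i = cnt - j ∧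
      B.reg (i + 1) = if cnt - j < cnt then 1 else 0)
    (by
      rintro j B ⟨-, -, -, h⟩
      rw [h]
      split_ifs with hc
      · omega
      · exact Nat.two_pow_pos _)
    (by rintro B ⟨-, -, -, h⟩; simpa using h)
    (by
      rintro j B ⟨hj, hI, hri, hrt⟩
      refine ⟨by rw [hrt, if_pos (by omega)]; norm_num, ?_⟩
      refine ((hbody (cnt - (j + 1)) (by omega) B hI hri).seq (c' := 7) fun B' hB' => ?_).mono
        (by rw [show cnt - 1 - j = cnt - (j + 1) by omega]) fun _ h => h
      obtain ⟨hB', hri'⟩ := hB'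
      obtain ⟨hb', h12⟩ := hfr _ _ hB'
      refine Sat.blk ?_ ?_
      · have : cnt - (j + 1) + 1 < 2 ^ X.w := by omega
        simp [hb', hri', h12, hcnt, this, hb, hi9, hbi.ne]
      · have e : cnt - j = cnt - (j + 1) + 1 := by omega
        refine ⟨by omega, ?_, ?_, ?_⟩
        · rw [e]
          refine hstab _ B' _ hB' (fun r h1 h2 => ?_) rfl rfl
          simp [h1, h2]
        · simp [hri', h12, e]
        · simp [hri', h12, e, hbi.ne, hb'])
    cnt
    (by
      obtain ⟨hb', h12⟩ := hfr _ _ h0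
      refine ⟨le_rfl, ?_, ?_, ?_⟩
      · rw [Nat.sub_self]
        refine hstab _ A _ h0 (fun r h1 h2 => ?_) rfl rfl
        simp [h1, h2]
      · simp
      · simp [hbi.ne, hb'])
  refine ((Sat.blk (Q := fun B => B = evalL [.const i 0, .op .lt (i + 1) i b] A) ?_ rfl).seq
    fun B hB => hB ▸ hw).mono ?_ ?_
  · obtain ⟨hb', -⟩ := hfr _ _ h0
    simp [hb, hbi.ne, hb', hcnt, hi9]
  · have := Finset.sum_range_reflect (fun j => f j + 8) cnt
    simp only [List.length_cons, List.length_nil]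
    rw [← this]
    have h2 : ∀ j ∈ Finset.range cnt, f (cnt - 1 - j) + 7 + 1 = f (cnt - 1 - j) + 8 :=
      fun _ _ => rfl
    rw [Finset.sum_congr rfl h2]
    omega
  · rintro B ⟨-, h, -, -⟩
    simpa using h

/-! ### Determinism -/

lemma Mach.Exec.unique {X : Mach} {p : Prog} {S T : State X.w} (h : X.Exec p S T) :
    ∀ {T'}, X.Exec p S T' → T = T' := by
  induction h with
  | instr i S => intro T' h'; cases h'; rfl
  | seq _ _ ih1 ih2 =>
    intro T' h'
    cases h' with
    | seq h1 h2 =>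
      cases ih1 h1
      exact ih2 h2
  | iteTrue h _ ih =>
    intro T' h'
    cases h' with
    | iteTrue _ h2 => exact ih h2
    | iteFalse h1 _ => exact absurd h1 h
  | iteFalse h _ ih =>
    intro T' h'
    cases h' with
    | iteTrue h1 _ => exact absurd h h1
    | iteFalse _ h2 => exact ih h2
  | whileTrue h _ _ ih1 ih2 =>
    intro T' h'
    cases h' with
    | whileTrue _ h2 h3 =>
      cases ih1 h2
      exact ih2 h3
    | whileFalse h1 => exact absurd h1 h
  | whileFalse h =>
    intro T' h'
    cases h' with
    | whileTrue h1 _ _ => exact absurd h h1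
    | whileFalse _ => rfl

/-- A loop does not halt if some invariant keeps its test true. -/
lemma not_exec_while {X : Mach} {a : ℕ} {p : Prog} (I : State X.w → Prop)
    (hI : ∀ S, I S → S.reg a ≠ 0 ∧ ∃ T, X.Exec p S.tick T ∧ I T) {S T : State X.w} (hS : I S) :
    ¬ X.Exec (.while a p) S T := by
  intro h
  generalize hq : Prog.while a p = q at h
  induction h with
  | instr => cases hq
  | seq => cases hq
  | iteTrue => cases hq
  | iteFalse => cases hq
  | whileTrue h1 h2 _ _ ih =>
    cases hq
    obtain ⟨-, T', hT', hIT⟩ := hI _ hS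
    cases hT'.unique h2
    exact ih hIT rfl
  | whileFalse h =>
    cases hq
    exact (hI _ hS).1 h

/-! ### Distinguishing bits -/

/-- `M` without its lowest bit. -/
def clr (M : ℕ) : ℕ := M &&& (M - 1)

/-- The lowest bit of `M`, as a power of two; `0` if `M = 0`. -/
def low (M : ℕ) : ℕ := M ^^^ clr M

lemma clr_lt {M : ℕ} (h : M ≠ 0) : clr M < M :=
  lt_of_le_of_lt Nat.and_le_right (by omega)

lemma exists_lowest_bit {M : ℕ} (h : M ≠ 0) :
    ∃ v, M.testBit v = true ∧ (∀ i < v, M.testBit i = false) ∧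
      ∀ i, (clr M).testBit i = (M.testBit i && decide (i ≠ v)) := by
  induction M using Nat.strong_induction_on with
  | _ M ih =>
    rcases Nat.even_or_odd' M with ⟨y, rfl | rfl⟩
    · obtain ⟨v, h1, h2, h3⟩ := ih y (by omega) (by omega)
      refine ⟨v + 1, by simpa [Nat.testBit_succ] using h1, ?_, ?_⟩
      · rintro (_ | i) hi
        · simp
        · simpa [Nat.testBit_succ] using h2 i (by omega)
      · rintro (_ | i)
        · simp [clr]
        · have e : (2 * y - 1) / 2 = y - 1 := by omega
          have h4 := h3 i
          rw [clr, Nat.testBit_and] at h4 ⊢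
          rw [Nat.testBit_succ, Nat.testBit_succ, e,
            Nat.mul_div_cancel_left y (by norm_num : 0 < 2), h4]
          simp
    · refine ⟨0, by simp, by simp, ?_⟩
      rintro (_ | i)
      · simp [clr]
      · have e : (2 * y + 1) / 2 = y := by omega
        rw [clr, Nat.testBit_and, Nat.testBit_succ, Nat.testBit_succ, Nat.add_sub_cancel, e,
          Nat.mul_div_cancel_left y (by norm_num : 0 < 2)]
        simp

lemma testBit_low {M v : ℕ} (h1 : M.testBit v = true)
    (h3 : ∀ i, (clr M).testBit i = (M.testBit i && decide (i ≠ v))) (i : ℕ) :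
    (low M).testBit i = decide (i = v) := by
  rw [low, Nat.testBit_xor, h3]
  by_cases h : i = v
  · subst h; simp [h1]
  · simp [h]

lemma low_zero : low 0 = 0 := by simp [low, clr]

lemma and_low_ne_zero {M v : ℕ} (h1 : M.testBit v = true)
    (h3 : ∀ i, (clr M).testBit i = (M.testBit i && decide (i ≠ v))) (z : ℕ) :
    z &&& low M ≠ 0 ↔ z.testBit v = true := by
  constructor
  · intro h
    obtain ⟨i, hi, -⟩ := Nat.exists_most_significant_bit h
    rw [Nat.testBit_and, testBit_low h1 h3, Bool.and_eq_true, decide_eq_true_iff] at hi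
    rw [← hi.2]
    exact hi.1
  · intro h h0
    have := congrArg (fun x => x.testBit v) h0
    simp [testBit_low h1 h3, h] at this

/-- The number of bits of `M`. -/
def pop (M : ℕ) : ℕ := if h : M = 0 then 0 else pop (clr M) + 1
termination_by M
decreasing_by exact clr_lt h

/-- The bits of `z` at the places of the bits of `M`, moved together. -/
def compress (M z : ℕ) : ℕ :=
  if h : M = 0 then 0 else (if z &&& low M ≠ 0 then 1 else 0) + 2 * compress (clr M) z
termination_by M
decreasing_by exact clr_lt h

lemma pop_zero : pop 0 = 0 := by rw [pop]; simp

lemma pop_of_ne {M : ℕ} (h : M ≠ 0) : pop M = pop (clr M) + 1 := by rw [pop]; simp [h]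

lemma compress_zero (z : ℕ) : compress 0 z = 0 := by rw [compress]; simp

lemma compress_of_ne {M : ℕ} (h : M ≠ 0) (z : ℕ) :
    compress M z = (if z &&& low M ≠ 0 then 1 else 0) + 2 * compress (clr M) z := by
  rw [compress]; simp [h]

lemma compress_lt (M z : ℕ) : compress M z < 2 ^ pop M := by
  induction M using Nat.strong_induction_on with
  | _ M ih =>
    by_cases h : M = 0
    · subst h; simp [compress_zero, pop_zero]
    · rw [compress_of_ne h, pop_of_ne h, pow_succ]
      have := ih _ (clr_lt h)
      split_ifs <;> omega

lemma compress_ne {M z z' i : ℕ} (hi : M.testBit i = true) (hz : z.testBit i ≠ z'.testBit i) :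
    compress M z ≠ compress M z' := by
  induction M using Nat.strong_induction_on with
  | _ M ih =>
    have h : M ≠ 0 := by rintro rfl; simp at hi
    obtain ⟨v, h1, h2, h3⟩ := exists_lowest_bit h
    rw [compress_of_ne h, compress_of_ne h]
    simp only [and_low_ne_zero h1 h3]
    by_cases hiv : i = v
    · subst hiv
      intro he
      apply hz
      cases ha : z.testBit i <;> cases hb : z'.testBit i <;> simp [ha, hb] at he ⊢ <;> omega
    · have := ih _ (clr_lt h) (by rw [h3]; simp [hi, hiv])
      split_ifs <;> omega

lemma pop_le_card {M : ℕ} (F : Finset ℕ) (hF : ∀ i, M.testBit i = true → i ∈ F) :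
    pop M ≤ F.card := by
  induction M using Nat.strong_induction_on generalizing F with
  | _ M ih =>
    by_cases h : M = 0
    · subst h; simp [pop_zero]
    · obtain ⟨v, h1, h2, h3⟩ := exists_lowest_bit h
      have := ih _ (clr_lt h) (F.erase v) (by
        intro i hi
        rw [h3] at hi
        simp only [Bool.and_eq_true, decide_eq_true_iff] at hi
        exact Finset.mem_erase.2 ⟨hi.2, hF i hi.1⟩)
      rw [Finset.card_erase_of_mem (hF v h1)] at this
      have := Finset.card_pos.2 ⟨v, hF v h1⟩
      rw [pop_of_ne h]
      omega

/-- The lowest bits in which entry `a` of `l` differs from the entries before place `c`. -/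
def rowMask (l : List ℕ) (a : ℕ) : ℕ → ℕ
  | 0 => 0
  | c + 1 => rowMask l a c ||| low (l.getD a 0 ^^^ l.getD c 0)

/-- The lowest bits in which two of the first `a` entries of `l` differ. -/
def maskTo (l : List ℕ) : ℕ → ℕ
  | 0 => 0
  | a + 1 => maskTo l a ||| rowMask l a a

/-- The set of all lowest bits in which two entries of `l` differ, as a bit mask. -/
def mask (l : List ℕ) : ℕ := maskTo l l.length

lemma testBit_rowMask {l : List ℕ} {a c i : ℕ} : (rowMask l a c).testBit i = true ↔
    ∃ c' < c, (low (l.getD a 0 ^^^ l.getD c' 0)).testBit i = true := by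
  induction c with
  | zero => simp [rowMask]
  | succ c ih =>
    rw [rowMask, Nat.testBit_or, Bool.or_eq_true, ih]
    constructor
    · rintro (⟨c', h, h'⟩ | h)
      · exact ⟨c', by omega, h'⟩
      · exact ⟨c, by omega, h⟩
    · rintro ⟨c', h, h'⟩
      rcases Nat.lt_succ_iff_lt_or_eq.1 h with h | rfl
      · exact .inl ⟨c', h, h'⟩
      · exact .inr h'

lemma testBit_maskTo {l : List ℕ} {a i : ℕ} : (maskTo l a).testBit i = true ↔
    ∃ a' < a, ∃ c' < a', (low (l.getD a' 0 ^^^ l.getD c' 0)).testBit i = true := by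
  induction a with
  | zero => simp [maskTo]
  | succ a ih =>
    rw [maskTo, Nat.testBit_or, Bool.or_eq_true, ih, testBit_rowMask]
    constructor
    · rintro (⟨a', h, h'⟩ | h)
      · exact ⟨a', by omega, h'⟩
      · exact ⟨a, by omega, h⟩
    · rintro ⟨a', h, h'⟩
      rcases Nat.lt_succ_iff_lt_or_eq.1 h with h | rfl
      · exact .inl ⟨a', h, h'⟩
      · exact .inr h'

lemma testBit_mask {l : List ℕ} {i : ℕ} : (mask l).testBit i = true ↔
    ∃ x ∈ l, ∃ y ∈ l, (low (x ^^^ y)).testBit i = true := by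
  rw [mask, testBit_maskTo]
  constructor
  · rintro ⟨a, ha, c, hc, h⟩
    rw [List.getD_eq_getElem _ _ ha, List.getD_eq_getElem _ _ (hc.trans ha)] at h
    exact ⟨_, List.getElem_mem _, _, List.getElem_mem _, h⟩
  · rintro ⟨x, hx, y, hy, h⟩
    obtain ⟨a, ha, rfl⟩ := List.getElem_of_mem hx
    obtain ⟨c, hc, rfl⟩ := List.getElem_of_mem hy
    rcases lt_trichotomy a c with hac | rfl | hac
    · refine ⟨c, hc, a, hac, ?_⟩
      rwa [List.getD_eq_getElem _ _ ha, List.getD_eq_getElem _ _ hc, Nat.xor_comm]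
    · simp [low_zero] at h
    · refine ⟨a, ha, c, hac, ?_⟩
      rwa [List.getD_eq_getElem _ _ ha, List.getD_eq_getElem _ _ hc]

lemma mask_congr {l l' : List ℕ} (h : ∀ z, z ∈ l ↔ z ∈ l') : mask l = mask l' := by
  refine Nat.eq_of_testBit_eq fun i => ?_
  rw [Bool.eq_iff_iff, testBit_mask, testBit_mask]
  simp only [h]

lemma exists_lowest_diff {x y : ℕ} (h : x ≠ y) : ∃ v, x.testBit v ≠ y.testBit v ∧
    (∀ i < v, x.testBit i = y.testBit i) ∧ ∀ i, (low (x ^^^ y)).testBit i = decide (i = v) := by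
  have h0 : x ^^^ y ≠ 0 := by rwa [Ne, Nat.xor_eq_zero_iff]
  obtain ⟨v, h1, h2, h3⟩ := exists_lowest_bit h0
  refine ⟨v, by simpa using h1, fun i hi => by simpa using h2 i hi, testBit_low h1 h3⟩

lemma compress_mask_injOn {l : List ℕ} {x y : ℕ} (hx : x ∈ l) (hy : y ∈ l)
    (h : compress (mask l) x = compress (mask l) y) : x = y := by
  by_contra hne
  obtain ⟨v, h1, -, h3⟩ := exists_lowest_diff hne
  exact compress_ne (testBit_mask.2 ⟨x, hx, y, hy, by rw [h3]; simp⟩) h1 h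

lemma mask_lt {l : List ℕ} {L : ℕ} (hl : ∀ x ∈ l, ∀ y ∈ l, x % 2 ^ L = y % 2 ^ L → x = y) :
    mask l < 2 ^ L := by
  refine Nat.lt_pow_two_of_testBit _ fun i hi => ?_
  by_contra hb
  rw [Bool.not_eq_false, testBit_mask] at hb
  obtain ⟨x, hx, y, hy, hb⟩ := hb
  have hne : x ≠ y := by rintro rfl; simp [low_zero] at hb
  obtain ⟨v, h1, h2, h3⟩ := exists_lowest_diff hne
  rw [h3, decide_eq_true_iff] at hb
  subst hb
  refine hne (hl x hx y hy (Nat.eq_of_testBit_eq fun j => ?_))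
  rw [Nat.testBit_mod_two_pow, Nat.testBit_mod_two_pow]
  by_cases hj : j < L
  · rw [h2 j (by omega)]
  · simp [hj]

lemma pop_mask_le (l : List ℕ) : pop (mask l) ≤ l.length ^ 2 := by
  have hc : l.toFinset.card ≤ l.length := List.toFinset_card_le l
  refine (pop_le_card
    ((l.toFinset ×ˢ l.toFinset).image fun x => Nat.log 2 (low (x.1 ^^^ x.2))) ?_).trans ?_
  · intro i hi
    obtain ⟨x, hx, y, hy, h⟩ := testBit_mask.1 hi
    have hne : x ≠ y := by rintro rfl; simp [low_zero] at h
    obtain ⟨v, h1, h2, h3⟩ := exists_lowest_diff hne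
    have hiv : i = v := by simpa [h3] using h
    subst hiv
    have e : low (x ^^^ y) = 2 ^ i := Nat.eq_of_testBit_eq fun j => by
      rw [h3, Nat.testBit_two_pow]
      simp [eq_comm]
    refine Finset.mem_image.2 ⟨(x, y), by simp [hx, hy], ?_⟩
    simp [e]
  · refine Finset.card_image_le.trans ?_
    rw [Finset.card_product, sq]
    exact Nat.mul_le_mul hc hc

/-! ### A small modulus that separates -/

/-- Pairwise distinct numbers are still distinct modulo some small number: otherwise every number up
to `2 * N`, and with these the central binomial coefficient of `N`, would divide the product of
their differences, which is too small. -/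
lemma exists_modulus (B : Finset ℕ) (Y : ℕ → ℕ) (e N : ℕ) (hY : ∀ x ∈ B, Y x < 2 ^ e)
    (hinj : ∀ x ∈ B, ∀ y ∈ B, Y x = Y y → x = y) (hN : e * B.card ^ 2 ≤ N) (hN4 : 4 ≤ N) :
    ∃ p, 2 ≤ p ∧ p ≤ 2 * N ∧ ∀ x ∈ B, ∀ y ∈ B, Y x % p = Y y % p → x = y := by
  by_contra! hcon
  set D : ℕ := ∏ x ∈ B.offDiag, ((Y x.1 - Y x.2) + (Y x.2 - Y x.1)) with hD
  have hpos : ∀ x ∈ B.offDiag, 0 < (Y x.1 - Y x.2) + (Y x.2 - Y x.1) := by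
    intro x hx
    rw [Finset.mem_offDiag] at hx
    have : Y x.1 ≠ Y x.2 := fun h => hx.2.2 (hinj _ hx.1 _ hx.2.1 h)
    omega
  have hD0 : 0 < D := Finset.prod_pos hpos
  have hdvd : ∀ p, 2 ≤ p → p ≤ 2 * N → p ∣ D := by
    intro p h2 hp
    obtain ⟨x, hx, y, hy, hm, hne⟩ := hcon p h2 hp
    refine Dvd.dvd.trans ?_ (Finset.dvd_prod_of_mem _
      (Finset.mem_offDiag.2 ⟨hx, hy, hne⟩ : (x, y) ∈ B.offDiag))
    rcases le_total (Y x) (Y y) with hle | hle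
    · rw [Nat.sub_eq_zero_of_le hle, zero_add]
      exact (Nat.modEq_iff_dvd' hle).1 hm
    · rw [Nat.sub_eq_zero_of_le hle, add_zero]
      exact (Nat.modEq_iff_dvd' hle).1 hm.symm
  have hC : Nat.centralBinom N ∣ D := by
    rw [Nat.dvd_iff_prime_pow_dvd_dvd]
    intro p j hp hj
    rcases Nat.eq_zero_or_pos j with rfl | hj0
    · simp
    have hne : Nat.choose (2 * N) N ≠ 0 := Nat.centralBinom_ne_zero N
    have h1 : j ≤ (Nat.choose (2 * N) N).factorization p :=
      (hp.pow_dvd_iff_le_factorization hne).1 hj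
    have h2 : p ^ j ≤ 2 * N := (Nat.pow_le_pow_right hp.pos h1).trans
      (Nat.pow_factorization_choose_le (by omega))
    refine hdvd _ ?_ h2
    calc 2 ≤ p := hp.two_le
      _ = p ^ 1 := (pow_one p).symm
      _ ≤ p ^ j := Nat.pow_le_pow_right hp.pos hj0
  have hDle : D ≤ 2 ^ N := by
    calc D ≤ ∏ x ∈ B.offDiag, 2 ^ e := Finset.prod_le_prod' fun x hx => by
          rw [Finset.mem_offDiag] at hx
          have := hY _ hx.1
          have := hY _ hx.2.1
          omega
      _ = 2 ^ (e * B.offDiag.card) := by rw [Finset.prod_const, pow_mul]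
      _ ≤ 2 ^ N := by
          refine Nat.pow_le_pow_right (by norm_num) (le_trans (Nat.mul_le_mul_left _ ?_) hN)
          rw [Finset.offDiag_card, sq]
          exact Nat.sub_le _ _
  have h4 := Nat.four_pow_lt_mul_centralBinom N hN4
  have h5 : 4 ^ N < N * 2 ^ N := h4.trans_le
    (Nat.mul_le_mul_left _ ((Nat.le_of_dvd hD0 hC).trans hDle))
  rw [show (4 : ℕ) = 2 * 2 from rfl, mul_pow] at h5
  exact absurd (Nat.lt_of_mul_lt_mul_right h5) (not_lt.2 Nat.lt_two_pow_self.le)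

/-- The value of a key `z` under the hash function given by a bit mask and a modulus. -/
def slot (M p z : ℕ) : ℕ := compress M z % p

/-- The modulus `p` makes `slot (mask l) p` injective on `l`. -/
def Separates (l : List ℕ) (p : ℕ) : Prop :=
  2 ≤ p ∧ ∀ x ∈ l, ∀ y ∈ l, slot (mask l) p x = slot (mask l) p y → x = y

/-- The least modulus that separates the entries of `l`. -/
noncomputable def modulus (l : List ℕ) : ℕ := sInf {p | Separates l p}

lemma exists_separates (l : List ℕ) : ∃ p ≤ 2 * l.length ^ 4 + 8, Separates l p := by
  have hc : l.toFinset.card ≤ l.length := List.toFinset_card_le l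
  obtain ⟨p, h1, h2, h3⟩ := exists_modulus l.toFinset (compress (mask l)) (l.length ^ 2)
    (l.length ^ 4 + 4)
    (fun x _ => (compress_lt _ _).trans_le (Nat.pow_le_pow_right (by norm_num) (pop_mask_le l)))
    (fun x hx y hy => compress_mask_injOn (List.mem_toFinset.1 hx) (List.mem_toFinset.1 hy))
    (by
      calc l.length ^ 2 * l.toFinset.card ^ 2 ≤ l.length ^ 2 * l.length ^ 2 :=
            Nat.mul_le_mul_left _ (Nat.pow_le_pow_left hc 2)
        _ = l.length ^ 4 := by ring
        _ ≤ l.length ^ 4 + 4 := by omega)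
    (by omega)
  exact ⟨p, by omega, h1, fun x hx y hy =>
    h3 x (List.mem_toFinset.2 hx) y (List.mem_toFinset.2 hy)⟩

lemma separates_modulus (l : List ℕ) : Separates l (modulus l) := by
  obtain ⟨p, -, hp⟩ := exists_separates l
  exact Nat.sInf_mem (s := {p | Separates l p}) ⟨p, hp⟩

lemma modulus_le (l : List ℕ) : modulus l ≤ 2 * l.length ^ 4 + 8 := by
  obtain ⟨p, hle, hp⟩ := exists_separates l
  exact (Nat.sInf_le (s := {p | Separates l p}) hp).trans hle

lemma not_separates {l : List ℕ} {p : ℕ} (h : p < modulus l) : ¬ Separates l p :=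
  Nat.notMem_of_lt_sInf h

lemma modulus_congr {l l' : List ℕ} (h : ∀ z, z ∈ l ↔ z ∈ l') : modulus l = modulus l' := by
  simp only [modulus, Separates, mask_congr h, h]

/-! ### Hashing the keys of one bucket -/

/-- The command leaves all registers below `b` alone. -/
def Cmd.Above (b : ℕ) : Cmd → Prop
  | .const d _ => b ≤ d
  | .op _ d _ _ => b ≤ d
  | .get d _ _ => b ≤ d
  | .put _ _ _ => True

lemma evalL_reg {l : List Cmd} {b r : ℕ} (A : Abs) (h : ∀ c ∈ l, c.Above b) (hr : r < b) :
    (evalL l A).reg r = A.reg r := by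
  induction l generalizing A with
  | nil => rfl
  | cons c l ih =>
    rw [evalL, ih _ fun c' hc' => h c' (List.mem_cons_of_mem _ hc')]
    have hc := h c List.mem_cons_self
    cases c <;> simp only [Cmd.Above] at hc <;> simp [Cmd.eval] <;> omega

@[simp] lemma evalL_ch (l : List Cmd) (A : Abs) : (evalL l A).ch = A.ch := by
  induction l generalizing A with
  | nil => rfl
  | cons c l ih => rw [evalL, ih]; cases c <;> rfl

/-- `B` agrees with `A` except for the registers from `b` on and the memory. -/
structure Frame (b : ℕ) (A B : Abs) : Prop where
  reg : ∀ r < b, B.reg r = A.reg r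
  ch : B.ch = A.ch

lemma Frame.rfl {b : ℕ} {A : Abs} : Frame b A A := ⟨fun _ _ => Eq.refl _, Eq.refl _⟩

lemma Frame.trans {b : ℕ} {A B C : Abs} (h : Frame b A B) (h' : Frame b B C) : Frame b A C :=
  ⟨fun r hr => (h'.reg r hr).trans (h.reg r hr), h'.ch.trans h.ch⟩

lemma Frame.mono {b b' : ℕ} {A B : Abs} (h : Frame b A B) (hb : b' ≤ b) : Frame b' A B :=
  ⟨fun r hr => h.reg r (by omega), h.ch⟩

lemma Frame.evalL {b : ℕ} {A : Abs} {l : List Cmd} (h : ∀ c ∈ l, c.Above b) :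
    Frame b A (evalL l A) := ⟨fun _ => evalL_reg A h, evalL_ch l A⟩

attribute [simp] Cmd.Above

/-- Put `slot (reg 46) (reg 47) (reg 80)` into register `81`. The loop takes the lowest bit `85` off
the mask `82` in each round. It adds the weight `83` of this bit to the result if the key contains
it, and doubles the weight. Reduction modulo `reg 47` is a conditional subtraction, since both the
result and the weight stay below twice the modulus. -/
def slotP : Prog :=
  .seq (block [.op .add 82 46 11, .const 83 1, .const 81 0])
    (.while 82 (block [.op .sub 84 82 12, .op .and 84 82 84, .op .xor 85 82 84, .op .and 85 80 85,
      .op .add 82 84 11, .op .lt 85 11 85, .op .mul 85 85 83, .op .add 81 81 85, .op .lt 85 81 47,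
      .op .sub 85 12 85, .op .mul 85 85 47, .op .sub 81 81 85, .op .add 83 83 83, .op .lt 85 83 47,
      .op .sub 85 12 85, .op .mul 85 85 47, .op .sub 83 83 85]))

lemma slotP_sat {X : Mach} {A : Abs} {M p z : ℕ} (h11 : A.reg 11 = 0) (h12 : A.reg 12 = 1)
    (hM : A.reg 46 = M) (hp : A.reg 47 = p) (hz : A.reg 80 = z) (hMw : M < 2 ^ X.w)
    (hzw : z < 2 ^ X.w) (hp2 : 2 ≤ p) (hpw : 2 * p < 2 ^ X.w) :
    Sat X slotP A (53 * pop M + 11)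
      (fun B => Frame 81 A B ∧ B.mem = A.mem ∧ B.reg 81 = slot M p z) := by
  have hw1 : 1 < 2 ^ X.w := by omega
  have hwhile := fun B => Sat.while (X := X) (A := B) (a := 82)
    (p := block [.op .sub 84 82 12, .op .and 84 82 84, .op .xor 85 82 84, .op .and 85 80 85,
      .op .add 82 84 11, .op .lt 85 11 85, .op .mul 85 85 83, .op .add 81 81 85, .op .lt 85 81 47,
      .op .sub 85 12 85, .op .mul 85 85 47, .op .sub 81 81 85, .op .add 83 83 83, .op .lt 85 83 47,
      .op .sub 85 12 85, .op .mul 85 85 47, .op .sub 83 83 85]) (by norm_num) (fun _ => 52)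
    (fun j B => Frame 81 A B ∧ B.mem = A.mem ∧ pop (B.reg 82) = j ∧ B.reg 82 < 2 ^ X.w ∧
      B.reg 83 < p ∧ B.reg 81 < p ∧ (B.reg 81 + B.reg 83 * compress (B.reg 82) z) % p = slot M p z)
    (fun j B h => h.2.2.2.1)
    (by
      rintro B ⟨-, -, h, -⟩
      by_contra h0
      rw [pop_of_ne h0] at h
      omega)
    (by
      rintro j B ⟨hfr, hm, hpop, hlt, hwg, hacc, hinv⟩
      have h0 : B.reg 82 ≠ 0 := by
        intro h0
        rw [h0, pop_zero] at hpop
        omega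
      refine ⟨h0, ?_⟩
      have e11 : B.reg 11 = 0 := by rw [hfr.reg 11 (by norm_num), h11]
      have e12 : B.reg 12 = 1 := by rw [hfr.reg 12 (by norm_num), h12]
      have e47 : B.reg 47 = p := by rw [hfr.reg 47 (by norm_num), hp]
      have e80 : B.reg 80 = z := by rw [hfr.reg 80 (by norm_num), hz]
      set N := B.reg 82 with hN
      set wg := B.reg 83 with hwgd
      set ac := B.reg 81 with hacd
      have hc : N &&& (N - 1) = clr N := rfl
      have hl : N ^^^ clr N = low N := rfl
      have hzl : z &&& low N < 2 ^ X.w := lt_of_le_of_lt Nat.and_le_left hzw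
      set bw := if 0 < z &&& low N then wg else 0 with hbw
      have hb1 : bw ≤ wg := by rw [hbw]; split_ifs <;> omega
      have hcm : wg * compress N z = bw + 2 * wg * compress (clr N) z := by
        rw [compress_of_ne h0, hbw]
        simp only [← Nat.pos_iff_ne_zero]
        split_ifs <;> ring
      have hsub : ∀ a, a < 2 * p → (1 - if a < p then 1 else 0) * p ≤ a ∧
          a - (1 - if a < p then 1 else 0) * p < p ∧
          (a - (1 - if a < p then 1 else 0) * p) % p = a % p := by
        intro a ha
        split_ifs with h
        · simp [h]
        · have hpa : p ≤ a := not_lt.1 h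
          refine ⟨by simpa using hpa, by simp; omega, ?_⟩
          simp only [Nat.sub_zero, one_mul]
          exact (Nat.mod_eq_sub_mod hpa).symm
      obtain ⟨s1, s2, s3⟩ := hsub (ac + bw) (by omega)
      obtain ⟨t1, t2, t3⟩ := hsub (wg + wg) (by omega)
      have hifle : ∀ a : ℕ, (if a < p then 1 else 0) ≤ 1 := fun a => by split_ifs <;> omega
      refine Sat.blk ?_ ⟨?_, ?_, ?_⟩
      · simp [← hN, ← hwgd, ← hacd, e11, e12, e47, e80, hc, hl, ← hbw, hzl, s1, t1, hifle]
        omega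
      · exact hfr.trans (Frame.evalL (by simp))
      · simp [evalL, hm]
      · simp only [evalL, Cmd.eval, Abs.set_reg, BinOp.nat, ← hN, ← hwgd, ← hacd, e11, e12, e47, e80]
        norm_num
        simp only [hc, hl, ← hbw]
        refine ⟨?_, (clr_lt h0).trans hlt, t2, s2, ?_⟩
        · rw [pop_of_ne h0] at hpop
          omega
        · rw [← hinv, hcm, Nat.add_mod, s3, Nat.mul_mod, t3, ← Nat.mul_mod, ← Nat.add_mod]
          congr 1
          ring)
  refine ((Sat.blk (Q := fun B => Frame 81 A B ∧ B.mem = A.mem ∧ B.reg 82 = M ∧ B.reg 83 = 1 ∧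
    B.reg 81 = 0) ?_ ⟨Frame.evalL (by simp), ?_⟩).seq fun B hB => hwhile B (pop M) ?_).mono ?_ ?_
  · simp
  · simp [evalL, hM, h11]
  · obtain ⟨hfr, hm, h1, h2, h3⟩ := hB
    refine ⟨hfr, hm, by rw [h1], by rwa [h1], by omega, by omega, ?_⟩
    rw [h1, h2, h3, zero_add, one_mul, slot]
  · simp
    omega
  · rintro B ⟨hfr, hm, hpop, -, -, hlt, hinv⟩
    refine ⟨hfr, hm, ?_⟩
    have h0 : B.reg 82 = 0 := by
      by_contra h0
      rw [pop_of_ne h0] at hpop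
      omega
    rwa [h0, compress_zero, mul_zero, add_zero, Nat.mod_eq_of_lt hlt] at hinv

/-! ### Masks and moduli of buckets -/

lemma Frame.congr {b : ℕ} {A B B' : Abs} (h : Frame b A B) (hr : ∀ r < b, B'.reg r = B.reg r)
    (hc : B'.ch = B.ch) : Frame b A B' := h.trans ⟨hr, hc⟩

/-- Registers `42` and `44` hold the length of `l` and the row of the memory that stores `l`. -/
structure Bucket (X : Mach) (A : Abs) (l : List ℕ) : Prop where
  r10 : A.reg 10 = X.LN
  r11 : A.reg 11 = 0
  r12 : A.reg 12 = 1
  r42 : A.reg 42 = l.length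
  r44 : A.reg 44 < 2 ^ (X.w - X.LN)
  le : l.length ≤ 2 ^ X.LN
  lt : l.length < 2 ^ X.w
  mem : ∀ j < l.length, A.mem (A.reg 44) j = l.getD j 0

lemma Bucket.congr {X : Mach} {A B : Abs} {l : List ℕ} (h : Bucket X A l) (hf : Frame 46 A B)
    (hm : B.mem = A.mem) : Bucket X B l := by
  have e10 := hf.reg 10 (by norm_num)
  have e11 := hf.reg 11 (by norm_num)
  have e12 := hf.reg 12 (by norm_num)
  have e42 := hf.reg 42 (by norm_num)
  have e44 := hf.reg 44 (by norm_num)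
  exact ⟨e10.trans h.r10, e11.trans h.r11, e12.trans h.r12, e42.trans h.r42, e44 ▸ h.r44, h.le, h.lt,
    fun j hj => by rw [hm, e44]; exact h.mem j hj⟩

/-- Put the mask of the bucket into register `46`. The lowest bit of `x` is `x` exclusive or
`x` and `x - 1`. -/
def maskP : Prog :=
  .seq (block [.const 46 0]) (forP 50 42 (.seq (block [.get 52 44 50])
    (forP 53 50 (block [.get 55 44 53, .op .xor 55 52 55, .op .sub 56 55 12, .op .and 56 55 56,
      .op .xor 55 55 56, .op .or 46 46 55]))))

lemma getD_mem {l : List ℕ} {j : ℕ} (h : j < l.length) : l.getD j 0 ∈ l := by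
  rw [List.getD_eq_getElem _ _ h]
  exact List.getElem_mem _

lemma getD_inj {l : List ℕ} (hl : l.Nodup) {i j : ℕ} (hi : i < l.length) (hj : j < l.length)
    (h : l.getD i 0 = l.getD j 0) : i = j := by
  rw [List.getD_eq_getElem _ _ hi, List.getD_eq_getElem _ _ hj] at h
  exact (hl.getElem_inj_iff).1 h

lemma maskP_sat {X : Mach} {A : Abs} {l : List ℕ} (hA : Bucket X A l) (hnd : l.Nodup) :
    Sat X maskP A (27 * l.length ^ 2 + 20 * l.length + 12)
      (fun B => Frame 46 A B ∧ B.mem = A.mem ∧ B.reg 46 = mask l) := by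
  refine ((Sat.blk (Q := fun B => Frame 46 A B ∧ B.mem = A.mem ∧ B.reg 46 = 0) (by simp)
    ⟨Frame.evalL (by simp), by simp [evalL]⟩).seq fun B hB => Sat.loop (cnt := l.length)
    (fun j B => Frame 46 A B ∧ B.mem = A.mem ∧ B.reg 46 = maskTo l j)
    (fun _ => 27 * l.length + 12) (by norm_num) (by norm_num) (by norm_num) hA.lt ?_ ?_ ?_ ?_).mono
    ?_ ?_
  · rintro j B B' ⟨h1, h2, h3⟩ hr hm hc
    exact ⟨h1.congr (fun r hr' => hr r (by omega) (by omega)) hc, hm.trans h2,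
      (hr 46 (by norm_num) (by norm_num)).trans h3⟩
  · rintro j B ⟨h1, h2, -⟩
    exact ⟨(hA.congr h1 h2).r42, (hA.congr h1 h2).r12⟩
  · exact hB
  · intro a ha B ⟨h1, h2, h3⟩ h50
    have hb := hA.congr h1 h2
    refine ((Sat.blk (Q := fun B' => Frame 50 B B' ∧ B'.mem = A.mem ∧ B'.reg 50 = a ∧
      B'.reg 52 = l.getD a 0) ?_ ⟨Frame.evalL (by simp), ?_⟩).seq fun B' hB' =>
      Sat.loop (cnt := a)
        (fun c C => Frame 46 A C ∧ C.mem = A.mem ∧ C.reg 46 = maskTo l a ||| rowMask l a c ∧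
          C.reg 50 = a ∧ C.reg 52 = l.getD a 0)
        (fun _ => 19) (by norm_num) (by norm_num) (by norm_num) (ha.trans hA.lt) ?_ ?_ ?_ ?_).mono
        ?_ ?_
    · simp [h50, hb.r10, hb.r44]
      exact lt_of_lt_of_le ha hA.le
    · have := hb.mem a ha
      rw [h2] at this
      simp [evalL, h50, h2, this, -List.getD_eq_getElem?_getD]
    · rintro c C C' ⟨i1, i2, i3, i4, i5⟩ hr hm hc
      exact ⟨i1.congr (fun r hr' => hr r (by omega) (by omega)) hc, hm.trans i2,
        (hr 46 (by norm_num) (by norm_num)).trans i3, (hr 50 (by norm_num) (by norm_num)).trans i4,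
        (hr 52 (by norm_num) (by norm_num)).trans i5⟩
    · rintro c C ⟨i1, i2, i3, i4, i5⟩
      exact ⟨i4, (hA.congr i1 i2).r12⟩
    · obtain ⟨i1, i2, i3, i4⟩ := hB'
      refine ⟨h1.trans (i1.mono (by norm_num)), i2, ?_, i3, i4⟩
      rw [i1.reg 46 (by norm_num), h3]
      simp [rowMask]
    · intro c hc C ⟨i1, i2, i3, i4, i5⟩ h53
      have hb' := hA.congr i1 i2
      have hcl : c < l.length := hc.trans ha
      have hne : 1 ≤ l.getD a 0 ^^^ l.getD c 0 := by
        rw [Nat.one_le_iff_ne_zero, Ne, Nat.xor_eq_zero_iff]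
        exact fun h => hc.ne' (getD_inj hnd ha hcl h)
      have hm := hb'.mem c hcl
      refine Sat.blk ?_ ⟨⟨i1.trans (Frame.evalL (by simp)), ?_, ?_, ?_, ?_⟩, ?_⟩
      · simp only [okL, Cmd.ok, Abs.cell, Cmd.eval, Abs.set_reg, BinOp.nat, BinOp.ok, h53, hm, i5]
        simp [hb'.r10, hb'.r44, hb'.r12, -List.getD_eq_getElem?_getD, hne]
        exact lt_of_lt_of_le hcl hA.le
      · simp [evalL, i2]
      · simp only [evalL, Cmd.eval, Abs.set_reg, BinOp.nat, h53, i5, hm, i3]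
        simp only [if_true, (by norm_num : (46 : ℕ) ≠ 55), (by norm_num : (55 : ℕ) ≠ 56),
          (by norm_num : (46 : ℕ) ≠ 56), (by norm_num : (52 : ℕ) ≠ 55),
          (by norm_num : (12 : ℕ) ≠ 55), if_false, hb'.r12, rowMask, low, clr, Nat.or_assoc]
      · simp [evalL, i4]
      · simp [evalL, i5]
      · simp [evalL, h53]
    · simp
      nlinarith
    · rintro C ⟨i1, i2, i3, i4, i5⟩
      exact ⟨⟨i1, i2, i3⟩, i4⟩
  · simp
    nlinarith
  · rintro B h
    exact h

/-- The number of pairs of entries of `l` with the same hash value. -/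
def ties (l : List ℕ) (p : ℕ) : ℕ :=
  ∑ a ∈ Finset.range l.length, ∑ c ∈ Finset.range l.length,
    if slot (mask l) p (l.getD a 0) = slot (mask l) p (l.getD c 0) then 1 else 0

/-- Every entry has the same hash value as itself, so that a modulus separates if and only if there
are no more ties than entries. -/
lemma ties_eq_iff {l : List ℕ} (hl : l.Nodup) {p : ℕ} (hp : 2 ≤ p) :
    ties l p = l.length ↔ Separates l p := by
  set f : ℕ → ℕ → ℕ := fun a c =>
    if slot (mask l) p (l.getD a 0) = slot (mask l) p (l.getD c 0) then 1 else 0 with hf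
  have hle : ∀ a ∈ Finset.range l.length, 1 ≤ ∑ c ∈ Finset.range l.length, f a c := by
    intro a ha
    refine le_trans ?_ (Finset.single_le_sum (f := fun c => f a c) (fun _ _ => Nat.zero_le _) ha)
    simp [f]
  have e1 : l.length = ∑ a ∈ Finset.range l.length, 1 := by simp
  have e2 : ties l p = ∑ a ∈ Finset.range l.length, ∑ c ∈ Finset.range l.length, f a c := rfl
  rw [e2]
  constructor
  · intro h
    refine ⟨hp, fun x hx y hy hxy => ?_⟩
    obtain ⟨a, ha, rfl⟩ := List.getElem_of_mem hx
    obtain ⟨c, hc, rfl⟩ := List.getElem_of_mem hy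
    by_contra hne
    have hac : a ≠ c := by rintro rfl; exact hne rfl
    have h1 := (Finset.sum_eq_sum_iff_of_le hle).1 (e1.symm.trans h.symm) a (Finset.mem_range.2 ha)
    have h2 : ∑ i ∈ ({a, c} : Finset ℕ), f a i ≤ ∑ i ∈ Finset.range l.length, f a i :=
      Finset.sum_le_sum_of_subset (by
        intro i hi
        rw [Finset.mem_insert, Finset.mem_singleton] at hi
        rcases hi with rfl | rfl <;> simpa)
    rw [Finset.sum_pair hac] at h2
    simp only [f, List.getD_eq_getElem _ _ ha, List.getD_eq_getElem _ _ hc, hxy, if_true] at h1 h2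
    omega
  · rintro ⟨-, h⟩
    conv_rhs => rw [e1]
    refine Finset.sum_congr rfl fun a ha => ?_
    rw [Finset.sum_eq_single a]
    · simp [f]
    · intro c hc hca
      rw [Finset.mem_range] at ha hc
      refine if_neg fun hac => hca ?_
      exact (getD_inj hl ha hc (h _ (getD_mem ha) _ (getD_mem hc) hac)).symm
    · exact fun h => absurd ha h

/-- Put the least separating modulus of the bucket, whose mask is in register `46`, into
register `47`. -/
def modulusP : Prog :=
  .seq (block [.const 47 2, .const 48 1]) (.while 48 (.seq (block [.const 49 0])
    (.seq (forP 50 42 (.seq (block [.get 80 44 50]) (.seq slotP (.seq (block [.op .add 52 81 11])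
      (forP 53 42 (.seq (block [.get 80 44 53]) (.seq slotP
        (block [.op .eq 81 52 81, .op .add 49 49 81]))))))))
    (block [.op .eq 48 49 42, .op .sub 48 12 48, .op .add 47 47 48]))))

/-- A bound for the time in which one modulus is tried on a bucket of size `b`. -/
def tryCost (b : ℕ) : ℕ := b * (b * (53 * b ^ 2 + 36) + 53 * b ^ 2 + 47) + 30

lemma slot_lt {M p z : ℕ} (hp : 2 ≤ p) : slot M p z < p := Nat.mod_lt _ (by omega)

lemma tryP_sat {X : Mach} {A : Abs} {l : List ℕ} {p : ℕ} (hA : Bucket X A l)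
    (hz : ∀ z ∈ l, z < 2 ^ X.w) (h46 : A.reg 46 = mask l) (h47 : A.reg 47 = p) (hp : 2 ≤ p)
    (hpw : 2 * p < 2 ^ X.w) :
    Sat X (.seq (block [.const 49 0])
      (forP 50 42 (.seq (block [.get 80 44 50]) (.seq slotP (.seq (block [.op .add 52 81 11])
      (forP 53 42 (.seq (block [.get 80 44 53]) (.seq slotP
        (block [.op .eq 81 52 81, .op .add 49 49 81])))))))))
      A (tryCost l.length - 18)
      (fun B => Frame 48 A B ∧ B.mem = A.mem ∧ B.reg 49 = ties l p) := by
  have hM : mask l < 2 ^ X.w := mask_lt fun x hx y hy h => by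
    rwa [Nat.mod_eq_of_lt (hz x hx), Nat.mod_eq_of_lt (hz y hy)] at h
  have hpop := pop_mask_le l
  set f : ℕ → ℕ → ℕ := fun a c =>
    if slot (mask l) p (l.getD a 0) = slot (mask l) p (l.getD c 0) then 1 else 0 with hf
  refine ((Sat.blk (Q := fun B => Frame 48 A B ∧ B.mem = A.mem ∧ B.reg 49 = 0) (by simp)
    ⟨Frame.evalL (by simp), by simp [evalL]⟩).seq fun B hB => Sat.loop (cnt := l.length)
    (fun j B => Frame 48 A B ∧ B.mem = A.mem ∧
      B.reg 49 = ∑ a ∈ Finset.range j, ∑ c ∈ Finset.range l.length, f a c)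
    (fun _ => l.length * (53 * l.length ^ 2 + 36) + 53 * l.length ^ 2 + 39)
    (by norm_num) (by norm_num) (by norm_num) hA.lt ?_ ?_ ?_ ?_).mono ?_ ?_
  · rintro j B B' ⟨h1, h2, h3⟩ hr hm hc
    exact ⟨h1.congr (fun r hr' => hr r (by omega) (by omega)) hc, hm.trans h2,
      (hr 49 (by norm_num) (by norm_num)).trans h3⟩
  · rintro j B ⟨h1, h2, -⟩
    exact ⟨(hA.congr (h1.mono (by norm_num)) h2).r42, (hA.congr (h1.mono (by norm_num)) h2).r12⟩
  · simpa using hB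
  · intro a ha B ⟨h1, h2, h3⟩ h50
    have hb := hA.congr (h1.mono (by norm_num)) h2
    have hma := hb.mem a ha
    rw [h2] at hma
    refine (((Sat.blk (Q := fun B' => Frame 51 B B' ∧ B'.mem = A.mem ∧
      B'.reg 80 = l.getD a 0) ?_ ⟨Frame.evalL (by simp), ?_⟩).seq fun B' hB' =>
      (slotP_sat (M := mask l) (p := p) (z := l.getD a 0) ?_ ?_ ?_ ?_ ?_ hM
        (hz _ (getD_mem ha)) hp hpw).seq fun C hC =>
      (Sat.blk (Q := fun D => Frame 51 B D ∧ D.mem = A.mem ∧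
        D.reg 52 = slot (mask l) p (l.getD a 0)) ?_ ?_).seq fun D hD =>
      Sat.loop (cnt := l.length)
        (fun c C => Frame 48 A C ∧ C.mem = A.mem ∧
          C.reg 49 = (∑ a ∈ Finset.range a, ∑ c ∈ Finset.range l.length, f a c) +
            ∑ c ∈ Finset.range c, f a c ∧
          C.reg 50 = a ∧ C.reg 52 = slot (mask l) p (l.getD a 0))
        (fun _ => 53 * l.length ^ 2 + 28) (by norm_num) (by norm_num) (by norm_num) hA.lt
        ?_ ?_ ?_ ?_)).mono ?_ ?_
    · simp [h50, hb.r10, hb.r44]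
      exact lt_of_lt_of_le ha hA.le
    · simp [evalL, h50, h2, hma, -List.getD_eq_getElem?_getD]
    · rw [hB'.1.reg 11 (by norm_num), hb.r11]
    · rw [hB'.1.reg 12 (by norm_num), hb.r12]
    · rw [hB'.1.reg 46 (by norm_num), h1.reg 46 (by norm_num), h46]
    · rw [hB'.1.reg 47 (by norm_num), h1.reg 47 (by norm_num), h47]
    · exact hB'.2.2
    · simp
    · obtain ⟨i1, i2, i3⟩ := hC
      refine ⟨hB'.1.trans ((i1.mono (by norm_num)).trans (Frame.evalL (by simp))), ?_, ?_⟩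
      · simp [evalL, i2, hB'.2.1]
      · simp [evalL, i3, i1.reg 11 (by norm_num), hB'.1.reg 11 (by norm_num), hb.r11]
    · rintro c C C' ⟨i1, i2, i3, i4, i5⟩ hr hm hc
      exact ⟨i1.congr (fun r hr' => hr r (by omega) (by omega)) hc, hm.trans i2,
        (hr 49 (by norm_num) (by norm_num)).trans i3, (hr 50 (by norm_num) (by norm_num)).trans i4,
        (hr 52 (by norm_num) (by norm_num)).trans i5⟩
    · rintro c C ⟨i1, i2, -⟩
      exact ⟨(hA.congr (i1.mono (by norm_num)) i2).r42, (hA.congr (i1.mono (by norm_num)) i2).r12⟩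
    · obtain ⟨i1, i2, i3⟩ := hD
      refine ⟨h1.trans (i1.mono (by norm_num)), i2, ?_, ?_, i3⟩
      · rw [i1.reg 49 (by norm_num), h3]
        simp
      · rw [i1.reg 50 (by norm_num), h50]
    · intro c hc C ⟨i1, i2, i3, i4, i5⟩ h53
      have hb' := hA.congr (i1.mono (by norm_num)) i2
      have hmc := hb'.mem c hc
      rw [i2] at hmc
      refine (((Sat.blk (Q := fun B' => Frame 54 C B' ∧ B'.mem = A.mem ∧
        B'.reg 80 = l.getD c 0) ?_ ⟨Frame.evalL (by simp), ?_⟩).seq fun B' hB' =>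
        (slotP_sat (M := mask l) (p := p) (z := l.getD c 0) ?_ ?_ ?_ ?_ ?_ hM
          (hz _ (getD_mem hc)) hp hpw).seq fun D hD => Sat.blk ?_ ?_)).mono ?_ fun _ h => h
      · simp [h53, hb'.r10, hb'.r44]
        exact lt_of_lt_of_le hc hA.le
      · simp [evalL, h53, i2, hmc, -List.getD_eq_getElem?_getD]
      · rw [hB'.1.reg 11 (by norm_num), hb'.r11]
      · rw [hB'.1.reg 12 (by norm_num), hb'.r12]
      · rw [hB'.1.reg 46 (by norm_num), i1.reg 46 (by norm_num), h46]
      · rw [hB'.1.reg 47 (by norm_num), i1.reg 47 (by norm_num), h47]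
      · exact hB'.2.2
      · have e52 : D.reg 52 = slot (mask l) p (l.getD a 0) := by
          rw [hD.1.reg 52 (by norm_num), hB'.1.reg 52 (by norm_num), i5]
        have := fun z => slot_lt (M := mask l) (z := z) hp
        simp [e52, hD.2.2, -List.getD_eq_getElem?_getD]
        have h1 := this (l.getD a 0)
        have h2 := this (l.getD c 0)
        omega
      · have hfr : Frame 54 C D := hB'.1.trans (hD.1.mono (by norm_num))
        have e52 : D.reg 52 = slot (mask l) p (l.getD a 0) := by
          rw [hfr.reg 52 (by norm_num), i5]
        have hfr' : Frame 48 A D := i1.trans (hfr.mono (by norm_num))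
        refine ⟨⟨hfr'.trans (Frame.evalL (by simp)), ?_, ?_, ?_, ?_⟩, ?_⟩
        · simp [evalL, hD.2.1, hB'.2.1]
        · rw [Finset.sum_range_succ, ← add_assoc, ← i3, ← hfr.reg 49 (by norm_num)]
          simp [evalL, e52, hD.2.2, f, -List.getD_eq_getElem?_getD]
        · simp [evalL, hfr.reg 50 (by norm_num), i4]
        · simp [evalL, e52]
        · simp [evalL, hfr.reg 53 (by norm_num), h53]
      · simp
        omega
    · simp
      nlinarith
    · rintro C ⟨i1, i2, i3, i4, i5⟩
      refine ⟨⟨i1, i2, ?_⟩, i4⟩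
      rw [i3, Finset.sum_range_succ]
  · simp [tryCost]
    nlinarith
  · rintro B h
    exact h

lemma modulusP_sat {X : Mach} {A : Abs} {l : List ℕ} (hA : Bucket X A l) (hnd : l.Nodup)
    (hz : ∀ z ∈ l, z < 2 ^ X.w) (h46 : A.reg 46 = mask l)
    (hw : 4 * l.length ^ 4 + 16 < 2 ^ X.w) :
    Sat X modulusP A ((2 * l.length ^ 4 + 8) * tryCost l.length + 10)
      (fun B => Frame 47 A B ∧ B.mem = A.mem ∧ B.reg 47 = modulus l) := by
  have hm2 : 2 ≤ modulus l := (separates_modulus l).1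
  have hmle := modulus_le l
  have hcost : 30 ≤ tryCost l.length := by simp [tryCost]
  have hty : ∀ p, ties l p ≤ l.length ^ 2 := by
    intro p
    calc ties l p ≤ ∑ a ∈ Finset.range l.length, ∑ c ∈ Finset.range l.length, 1 :=
          Finset.sum_le_sum fun a _ => Finset.sum_le_sum fun c _ => by split_ifs <;> omega
      _ = l.length ^ 2 := by simp [sq]
  have hsq : l.length ^ 2 < 2 ^ X.w := by nlinarith [sq_nonneg (l.length ^ 2 : ℤ)]
  refine ((Sat.blk (Q := fun B => Frame 47 A B ∧ B.mem = A.mem ∧ B.reg 47 = 2 ∧ B.reg 48 = 1)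
    (by simp) ⟨Frame.evalL (by simp), by simp [evalL]⟩).seq fun B hB => Sat.while (X := X) (A := B)
    (by norm_num) (fun _ => tryCost l.length - 1)
    (fun j B => Frame 47 A B ∧ B.mem = A.mem ∧ (j = 0 → B.reg 48 = 0 ∧ B.reg 47 = modulus l) ∧
      (0 < j → B.reg 48 = 1 ∧ B.reg 47 + j = modulus l + 1 ∧ 2 ≤ B.reg 47)) ?_ ?_ ?_
      (modulus l - 1) ?_).mono ?_ ?_
  · rintro j B ⟨-, -, h0, h1⟩
    rcases Nat.eq_zero_or_pos j with hj | hj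
    · rw [(h0 hj).1]; omega
    · rw [(h1 hj).1]; omega
  · rintro B ⟨-, -, h0, -⟩
    exact (h0 rfl).1
  · rintro j B ⟨h1, h2, -, h3⟩
    obtain ⟨h48, h47, hp⟩ := h3 (by omega)
    refine ⟨by omega, ?_⟩
    have hb := hA.congr (h1.mono (by norm_num)) h2
    set p := B.reg 47 with hpd
    have ht := tryP_sat (p := p) hb hz (by rw [h1.reg 46 (by norm_num), h46]) rfl hp (by omega)
    have hlast : ∀ C, Frame 48 B C ∧ C.mem = B.mem ∧ C.reg 49 = ties l p →
        Sat X (block [.op .eq 48 49 42, .op .sub 48 12 48, .op .add 47 47 48]) C 10 (fun B =>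
        Frame 47 A B ∧ B.mem = A.mem ∧ (j = 0 → B.reg 48 = 0 ∧ B.reg 47 = modulus l) ∧
        (0 < j → B.reg 48 = 1 ∧ B.reg 47 + j = modulus l + 1 ∧ 2 ≤ B.reg 47)) := by
      rintro C ⟨i1, i2, i3⟩
      have e42 : C.reg 42 = l.length := (i1.reg 42 (by norm_num)).trans hb.r42
      have e12 : C.reg 12 = 1 := (i1.reg 12 (by norm_num)).trans hb.r12
      have e47 : C.reg 47 = p := i1.reg 47 (by norm_num)
      refine Sat.blk ?_ ⟨(h1.trans (i1.mono (by norm_num))).trans (Frame.evalL (by simp)), ?_, ?_⟩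
      · simp [i3, e42, e12, (hty p).trans_lt hsq, hA.lt]
        split_ifs <;> omega
      · simp [evalL, i2, h2]
      · rcases Nat.eq_zero_or_pos j with rfl | hj
        · have hs : ties l p = l.length := by
            rw [ties_eq_iff hnd hp, show p = modulus l by omega]
            exact separates_modulus l
          simp [evalL, i3, e42, e12, e47, hs]
          omega
        · have hs : ties l p ≠ l.length := by
            rw [Ne, ties_eq_iff hnd hp]
            exact not_separates (by omega)
          simp [evalL, i3, e42, e12, e47, hs]
          omega
    intro S hS
    obtain ⟨T, C, hT, hs, hR, hC⟩ := ht S hS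
    obtain ⟨T', D, hT', hs', hR', hD⟩ := hlast C hC T hR
    cases hT with
    | seq e1 e2 => exact ⟨T', D, .seq e1 (.seq e2 hT'), by omega, hR', hD⟩
  · obtain ⟨h1, h2, h3, h4⟩ := hB
    exact ⟨h1, h2, fun h => by omega, fun h => ⟨h4, by omega, by omega⟩⟩
  · simp
    have : (modulus l - 1) * (tryCost l.length - 1 + 1) ≤ (2 * l.length ^ 4 + 8) * tryCost l.length :=
      Nat.mul_le_mul (by omega) (by omega)
    omega
  · rintro B ⟨h1, h2, h3, -⟩
    exact ⟨h1, h2, (h3 rfl).2⟩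

/-! ### Distributing the keys over buckets -/

/-- The polynomial whose coefficients are read off from the seed `s`. The coefficients may be left
unreduced, since only the value modulo `2 ^ (8 * L)` matters. -/
def polyVal (L s x : ℕ) : ℕ := ∑ j ∈ Finset.range 8, s / 2 ^ (8 * L * j) * x ^ j

/-- The hash function with seed `s`: the `m` top bits of a polynomial modulo `2 ^ (8 * L)`. -/
def hsh (L m s x : ℕ) : ℕ := polyVal L s x % 2 ^ (8 * L) / 2 ^ (8 * L - m)

/-- The keys of `Z` that fall into bucket `i`. The `L` low-order bits of a key are a position, and
the other bits the character at this position. Only the position is hashed. -/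
def bucket (L m s : ℕ) (Z : List ℕ) (i : ℕ) : List ℕ :=
  Z.filter fun z => decide (hsh L m s (z % 2 ^ L) = i)

/-- A seed is good if the eighth powers of the bucket sizes sum to at most this number times `n`. -/
def seedBound : ℕ := 3 * 8 ^ 8

lemma hsh_lt {L m s x : ℕ} (hm : m ≤ L) : hsh L m s x < 2 ^ m := by
  rw [hsh, Nat.div_lt_iff_lt_mul (Nat.two_pow_pos _), ← pow_add, show m + (8 * L - m) = 8 * L by omega]
  exact Nat.mod_lt _ (Nat.two_pow_pos _)

/-- The relations between the parameters: there are `2 ^ m` buckets, about as many as the number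
`X.n` of keys, and positions have `L` bits. -/
structure Size (X : Mach) (L m : ℕ) : Prop where
  one_le : 1 ≤ X.n
  n_le : X.n ≤ 2 ^ L
  m_le : m ≤ L
  pow_le : 2 ^ m ≤ X.n
  le_pow : X.n ≤ 2 * 2 ^ m
  LN : X.LN = L + 28
  K : X.K = 2 ^ 27
  w : 128 * L + 128 ≤ X.w

/-- The contents of the registers that stay fixed once they have been set up. -/
structure Env (X : Mach) (L m s len : ℕ) (A : Abs) : Prop where
  r0 : A.reg 0 = len
  r1 : A.reg 1 = X.n
  r6 : A.reg 6 = L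
  r10 : A.reg 10 = X.LN
  r11 : A.reg 11 = 0
  r12 : A.reg 12 = 1
  r13 : A.reg 13 = 2
  r14 : A.reg 14 = 3
  r15 : A.reg 15 = 4
  r16 : A.reg 16 = 5
  r17 : A.reg 17 = 6
  r18 : A.reg 18 = 8
  r20 : A.reg 20 = 2 ^ m
  r21 : A.reg 21 = s
  r22 : A.reg 22 = 8 * L
  r23 : A.reg 23 = 8 * L - m
  r24 : A.reg 24 = 2 ^ (8 * L) - 1
  r25 : A.reg 25 = seedBound * X.n

/-- The fixed registers survive a change of the length of the list, of the seed, and of the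
registers from `27` on. -/
lemma Env.update {X : Mach} {L m s s' len len' : ℕ} {A B : Abs} (h : Env X L m s len A)
    (h0 : B.reg 0 = len') (h21 : B.reg 21 = s')
    (e : ∀ r < 27, r ≠ 0 → r ≠ 21 → B.reg r = A.reg r) : Env X L m s' len' B := by
  constructor
  · exact h0
  · rw [e _ (by norm_num) (by norm_num) (by norm_num), h.r1]
  · rw [e _ (by norm_num) (by norm_num) (by norm_num), h.r6]
  · rw [e _ (by norm_num) (by norm_num) (by norm_num), h.r10]
  · rw [e _ (by norm_num) (by norm_num) (by norm_num), h.r11]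
  · rw [e _ (by norm_num) (by norm_num) (by norm_num), h.r12]
  · rw [e _ (by norm_num) (by norm_num) (by norm_num), h.r13]
  · rw [e _ (by norm_num) (by norm_num) (by norm_num), h.r14]
  · rw [e _ (by norm_num) (by norm_num) (by norm_num), h.r15]
  · rw [e _ (by norm_num) (by norm_num) (by norm_num), h.r16]
  · rw [e _ (by norm_num) (by norm_num) (by norm_num), h.r17]
  · rw [e _ (by norm_num) (by norm_num) (by norm_num), h.r18]
  · rw [e _ (by norm_num) (by norm_num) (by norm_num), h.r20]
  · exact h21
  · rw [e _ (by norm_num) (by norm_num) (by norm_num), h.r22]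
  · rw [e _ (by norm_num) (by norm_num) (by norm_num), h.r23]
  · rw [e _ (by norm_num) (by norm_num) (by norm_num), h.r24]
  · rw [e _ (by norm_num) (by norm_num) (by norm_num), h.r25]

lemma Env.of_reg {X : Mach} {L m s len : ℕ} {A B : Abs} (h : Env X L m s len A)
    (e : ∀ r < 27, B.reg r = A.reg r) : Env X L m s len B :=
  h.update ((e 0 (by norm_num)).trans h.r0) ((e 21 (by norm_num)).trans h.r21) fun r hr _ _ => e r hr

lemma Env.congr {X : Mach} {L m s len : ℕ} {A B : Abs} (h : Env X L m s len A)
    (hf : Frame 30 A B) : Env X L m s len B :=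
  h.of_reg fun r hr => hf.reg r (by omega)

section

variable {X : Mach} {L m s len : ℕ} {A : Abs}

lemma Size.lt_pow (h : Size X L m) {e : ℕ} (he : e ≤ 128 * L + 128) : 2 ^ e ≤ 2 ^ X.w :=
  Nat.pow_le_pow_right (by norm_num) (he.trans h.w)

lemma Size.row (h : Size X L m) {q : ℕ} (hq : q < 16 * 2 ^ L) : q < 2 ^ (X.w - X.LN) := by
  refine hq.trans_le ?_
  rw [show (16 : ℕ) = 2 ^ 4 from rfl, ← pow_add]
  exact Nat.pow_le_pow_right (by norm_num) (by have := h.w; have := h.LN; omega)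

lemma Size.row' (h : Size X L m) {q : ℕ} (hq : q < 16) : q < 2 ^ (X.w - X.LN) :=
  h.row (by have := Nat.two_pow_pos L; omega)

lemma Size.col (h : Size X L m) {r : ℕ} (hr : r < 2 ^ 28 * 2 ^ L) : r < 2 ^ X.LN := by
  rwa [h.LN, pow_add, mul_comm]

lemma Size.col' (h : Size X L m) {r : ℕ} (hr : r < 2 ^ m) : r < 2 ^ X.LN := by
  refine h.col ?_
  have := Nat.pow_le_pow_right (show 0 < 2 by norm_num) h.m_le
  omega

lemma Size.le_w (h : Size X L m) {a : ℕ} (ha : a ≤ 2 ^ 28 * 2 ^ L) : a < 2 ^ X.w := by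
  refine lt_of_le_of_lt ha ?_
  rw [← pow_add]
  exact Nat.pow_lt_pow_right (by norm_num) (by have := h.w; omega)

lemma Size.two_pow_m (h : Size X L m) : 2 ^ m ≤ 2 ^ L :=
  Nat.pow_le_pow_right (by norm_num) h.m_le

/-- Put the hash value of `reg 60` into register `61`. -/
def hashP : Prog :=
  .seq (block [.op .add 62 21 11, .const 63 1, .const 61 0])
    (.seq (forP 65 18 (block [.op .mul 64 62 63, .op .add 61 61 64, .op .mul 63 63 60,
      .op .shr 62 62 22])) (block [.op .and 61 61 24, .op .shr 61 61 23]))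

lemma hashP_sat (hX : Size X L m) (hA : Env X L m s len A) (hs : s < 2 ^ X.w) :
    Sat X hashP A 200 (fun B => Frame 61 A B ∧ B.mem = A.mem ∧
      B.reg 61 = hsh L m s (A.reg 60)) := by
  set x := A.reg 60 with hx
  have hLw : 8 * L < 2 ^ X.w := Nat.lt_two_pow_self.trans_le (hX.lt_pow (by omega))
  refine ((Sat.blk (Q := fun B => Frame 61 A B ∧ B.mem = A.mem ∧ B.reg 61 = 0 ∧ B.reg 62 = s ∧
    B.reg 63 = 1) (by simp) ⟨Frame.evalL (by simp), by simp [evalL, hA.r11, hA.r21]⟩).seq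
    fun B hB => (Sat.loop (cnt := 8) (fun j B => Frame 61 A B ∧ B.mem = A.mem ∧
      B.reg 61 = ∑ j ∈ Finset.range j, s / 2 ^ (8 * L * j) * x ^ j ∧
      B.reg 62 = s / 2 ^ (8 * L * j) ∧ B.reg 63 = x ^ j)
    (fun _ => 13) (by norm_num) (by norm_num) (by norm_num) ?_ ?_ ?_ ?_ ?_).seq
    (c' := 7) fun C hC => Sat.blk ?_ ?_).mono ?_ fun _ h => h
  · exact lt_of_lt_of_le (by norm_num : 8 < 2 ^ 4) (hX.lt_pow (by omega))
  · rintro j B B' ⟨h1, h2, h3, h4, h5⟩ hr hm hc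
    exact ⟨h1.congr (fun r hr' => hr r (by omega) (by omega)) hc, hm.trans h2,
      (hr 61 (by norm_num) (by norm_num)).trans h3, (hr 62 (by norm_num) (by norm_num)).trans h4,
      (hr 63 (by norm_num) (by norm_num)).trans h5⟩
  · rintro j B ⟨h1, -⟩
    exact ⟨(h1.reg _ (by norm_num)).trans hA.r18, (h1.reg _ (by norm_num)).trans hA.r12⟩
  · simpa using hB
  · rintro j hj B ⟨h1, h2, h3, h4, h5⟩ h65
    have e22 : B.reg 22 = 8 * L := (h1.reg _ (by norm_num)).trans hA.r22
    have e60 : B.reg 60 = x := h1.reg _ (by norm_num)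
    refine Sat.blk ?_ ⟨⟨h1.trans (Frame.evalL (by simp)), ?_, ?_, ?_, ?_⟩, ?_⟩
    · simp [e22, h4, hLw]
      exact (Nat.div_le_self _ _).trans_lt hs
    · simp [evalL, h2]
    · simp [evalL, h3, h4, h5, Finset.sum_range_succ]
    · simp [evalL, h4, e22]
      rw [Nat.div_div_eq_div_mul, ← pow_add, mul_add, mul_one]
    · simp [evalL, h5, e60, pow_succ]
    · simp [evalL, h65]
  · obtain ⟨h1, h2, h3, -⟩ := hC
    have e23 : C.reg 23 = 8 * L - m := (h1.reg _ (by norm_num)).trans hA.r23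
    have e24 : C.reg 24 = 2 ^ (8 * L) - 1 := (h1.reg _ (by norm_num)).trans hA.r24
    simp [e23, e24, Nat.and_two_pow_sub_one_eq_mod]
    exact ⟨(Nat.mod_lt _ (Nat.two_pow_pos _)).trans_le (hX.lt_pow (by omega)), by omega⟩
  · obtain ⟨h1, h2, h3, -⟩ := hC
    have e23 : C.reg 23 = 8 * L - m := (h1.reg _ (by norm_num)).trans hA.r23
    have e24 : C.reg 24 = 2 ^ (8 * L) - 1 := (h1.reg _ (by norm_num)).trans hA.r24
    refine ⟨h1.trans (Frame.evalL (by simp)), ?_, ?_⟩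
    · simp [evalL, h2]
    · simp [evalL, e23, e24, h3, Nat.and_two_pow_sub_one_eq_mod]
      rfl
  · simp

/-- Set the bucket sizes to zero. -/
def clearP : Prog := forP 30 20 (block [.put 12 30 11, .put 13 30 11])

lemma clearP_sat (hX : Size X L m) (hA : Env X L m s len A) :
    Sat X clearP A (15 * 2 ^ m + 8) (fun B => Frame 30 A B ∧
      ∀ q r, B.mem q r = if (q = 1 ∨ q = 2) ∧ r < 2 ^ m then 0 else A.mem q r) := by
  refine (Sat.loop (cnt := 2 ^ m) (fun j B => Frame 30 A B ∧
      ∀ q r, B.mem q r = if (q = 1 ∨ q = 2) ∧ r < j then 0 else A.mem q r)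
    (fun _ => 7) (by norm_num) (by norm_num) (by norm_num)
    (hX.le_w (by have := hX.two_pow_m; omega)) ?_ ?_ ?_ ?_).mono ?_ fun _ h => h
  · rintro j B B' ⟨h1, h2⟩ hr hm hc
    exact ⟨h1.congr (fun r hr' => hr r (by omega) (by omega)) hc, by rwa [hm]⟩
  · rintro j B ⟨h1, -⟩
    exact ⟨(hA.congr h1).r20, (hA.congr h1).r12⟩
  · exact ⟨Frame.rfl, by simp⟩
  · rintro j hj B ⟨h1, h2⟩ h30
    have hB := hA.congr h1
    refine Sat.blk ?_ ⟨⟨h1.trans (Frame.evalL (by simp)), ?_⟩, ?_⟩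
    · simp [hB.r10, hB.r12, hB.r13, h30, hX.row' (show 1 < 16 by norm_num),
        hX.row' (show 2 < 16 by norm_num), hX.col' hj]
    · intro q r
      simp only [evalL, Cmd.eval, Abs.put_mem, Abs.put_reg, hB.r13, hB.r12, hB.r11, h30, h2]
      split_ifs <;> first | rfl | omega
    · simp [evalL, h30]
  · simp
    omega

/-- Distribute the keys over the buckets, and count them in rows `1` and `2`. -/
def insertP : Prog :=
  forP 30 0 (.seq (block [.op .add 32 30 30, .get 60 11 32, .op .add 32 32 12, .get 33 11 32,
      .op .shl 33 33 6, .op .add 33 33 60])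
    (.seq hashP (block [.get 34 12 61, .op .add 35 61 18, .put 35 34 33, .op .add 34 34 12,
      .put 12 61 34, .put 13 61 34])))

/-- The positions and the characters of the keys of `Z` alternate in row `0`. -/
def Input (L : ℕ) (Z : List ℕ) (f : ℕ → ℕ) : Prop :=
  ∀ e < Z.length, f (2 * e) = Z.getD e 0 % 2 ^ L ∧ f (2 * e + 1) = Z.getD e 0 / 2 ^ L

/-- The buckets of `Z` are stored from row `8` on, and row `2` holds their sizes. -/
structure Stored (L m s : ℕ) (Z : List ℕ) (f : ℕ → ℕ → ℕ) : Prop where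
  size : ∀ i < 2 ^ m, f 2 i = (bucket L m s Z i).length
  keys : ∀ i < 2 ^ m, ∀ j < (bucket L m s Z i).length, f (8 + i) j = (bucket L m s Z i).getD j 0

lemma bucket_take_succ {Z : List ℕ} {e : ℕ} (he : e < Z.length) (i : ℕ) :
    bucket L m s (Z.take (e + 1)) i = bucket L m s (Z.take e) i ++
      if hsh L m s (Z.getD e 0 % 2 ^ L) = i then [Z.getD e 0] else [] := by
  rw [bucket, List.take_succ_eq_append_getElem he, List.filter_append, List.getD_eq_getElem _ _ he]
  by_cases h : hsh L m s (Z[e] % 2 ^ L) = i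
  · simp [bucket, h]
  · simp [bucket, h]

lemma bucket_length_le (Z : List ℕ) (i : ℕ) : (bucket L m s Z i).length ≤ Z.length :=
  List.length_filter_le _ _

lemma insertP_sat (hX : Size X L m) {Z : List ℕ} (hA : Env X L m s Z.length A)
    (hs : s < 2 ^ X.w) (hZ : Z.length ≤ 2 ^ L) (hin : Input L Z (A.mem 0))
    (h1 : ∀ i < 2 ^ m, A.mem 1 i = 0) (h2 : ∀ i < 2 ^ m, A.mem 2 i = 0) :
    Sat X insertP A (246 * Z.length + 8) (fun B => Frame 30 A B ∧ Stored L m s Z B.mem ∧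
      (∀ i < 2 ^ m, B.mem 1 i = (bucket L m s Z i).length) ∧
      ∀ q r, (q = 0 ∨ 2 < q ∧ q < 8 ∨ (q = 1 ∨ q = 2) ∧ 2 ^ m ≤ r) → B.mem q r = A.mem q r) := by
  have hmL := hX.two_pow_m
  refine (Sat.loop (cnt := Z.length) (fun j B => Frame 30 A B ∧ Stored L m s (Z.take j) B.mem ∧
      (∀ i < 2 ^ m, B.mem 1 i = (bucket L m s (Z.take j) i).length) ∧
      ∀ q r, (q = 0 ∨ 2 < q ∧ q < 8 ∨ (q = 1 ∨ q = 2) ∧ 2 ^ m ≤ r) → B.mem q r = A.mem q r)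
    (fun _ => 238) (by norm_num) (by norm_num) (by norm_num)
    (hX.le_w (by omega)) ?_ ?_ ?_ ?_).mono ?_ ?_
  · rintro j B B' ⟨h1, h2⟩ hr hm hc
    exact ⟨h1.congr (fun r hr' => hr r (by omega) (by omega)) hc, by rwa [hm]⟩
  · rintro j B ⟨h1, -⟩
    exact ⟨(hA.congr h1).r0, (hA.congr h1).r12⟩
  · refine ⟨Frame.rfl, ⟨?_, ?_⟩, ?_, ?_⟩
    · intro i hi
      simp [bucket, h2 i hi]
    · simp [bucket]
    · intro i hi
      simp [bucket, h1 i hi]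
    · simp
  · rintro e he B ⟨hf, hst, hr1, hrest⟩ h30
    have hB := hA.congr hf
    obtain ⟨hi1, hi2⟩ := hin e he
    rw [← hrest 0 _ (by simp)] at hi1 hi2
    set z := Z.getD e 0 with hz
    have hzz : z / 2 ^ L * 2 ^ L + z % 2 ^ L = z := by
      rw [mul_comm]
      exact Nat.div_add_mod _ _
    have hLw : L < 2 ^ X.w := Nat.lt_two_pow_self.trans_le (hX.lt_pow (by omega))
    refine ((Sat.blk (Q := fun C => Frame 30 B C ∧ C.mem = B.mem ∧ C.reg 30 = e ∧ C.reg 33 = z ∧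
      C.reg 60 = z % 2 ^ L) ?_ ⟨Frame.evalL (by simp), ?_⟩).seq fun C hC =>
      (hashP_sat hX (hB.congr hC.1) hs).seq fun D hD => Sat.blk ?_ ?_).mono ?_ fun _ h => h
    · simp [hB.r10, hB.r11, hB.r12, hB.r6, h30, hLw, hX.row' (show 0 < 16 by norm_num)]
      constructor <;> exact hX.col (by omega)
    · simp [evalL, hB.r11, hB.r12, hB.r6, h30, ← two_mul, hi1, hi2, hzz,
        -List.getD_eq_getElem?_getD]
    rotate_left 2
    · simp
    all_goals
      obtain ⟨c1, c2, c3, c4, c5⟩ := hC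
      obtain ⟨d1, d2, d3⟩ := hD
      have hfd : Frame 30 B D := c1.trans (d1.mono (by norm_num))
      have hD := hB.congr hfd
      rw [c5] at d3
      have hh := hsh_lt (s := s) (x := z % 2 ^ L) hX.m_le
      have d33 : D.reg 33 = z := (d1.reg 33 (by norm_num)).trans c4
      have d30 : D.reg 30 = e := (d1.reg 30 (by norm_num)).trans c3
      rw [c2] at d2
      set h := hsh L m s (z % 2 ^ L) with hhd
      have hcnt := hr1 h hh
      have hlen := bucket_length_le (L := L) (m := m) (s := s) (Z.take e) h
      rw [List.length_take] at hlen
    · simp [hD.r10, hD.r12, hD.r13, hD.r18, d3, d2, hcnt, hX.row' (show 1 < 16 by norm_num),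
        hX.row' (show 2 < 16 by norm_num), hX.col' hh]
      exact ⟨hX.row (by omega), hX.col (by omega)⟩
    · have key : ∀ q r, (evalL [.get 34 12 61, .op .add 35 61 18, .put 35 34 33, .op .add 34 34 12,
          .put 12 61 34, .put 13 61 34] D).mem q r =
          if (q = 1 ∨ q = 2) ∧ r = h then (bucket L m s (Z.take e) h).length + 1
          else if q = 8 + h ∧ r = (bucket L m s (Z.take e) h).length then z else B.mem q r := by
        intro q r
        simp only [evalL, Cmd.eval, Abs.put_mem, Abs.put_reg, Abs.set_reg, Abs.set_mem, BinOp.nat]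
        norm_num
        simp only [d3, d2, hD.r12, hD.r13, hD.r18, hcnt, d33, add_comm h 8]
        split_ifs <;> first | rfl | omega
      refine ⟨⟨(hf.trans hfd).trans (Frame.evalL (by simp)), ⟨?_, ?_⟩, ?_, ?_⟩, ?_⟩
      · intro i hi
        rw [key, bucket_take_succ he, ← hz, ← hhd, hst.size i hi, List.length_append]
        by_cases hih : h = i
        · subst hih; simp
        · simp [hih, Ne.symm hih]
          omega
      · intro i hi j hj
        rw [key, bucket_take_succ he, ← hz, ← hhd]
        rw [bucket_take_succ he, ← hz, ← hhd, List.length_append] at hj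
        rw [if_neg (by omega)]
        by_cases hih : h = i
        · subst hih
          rw [if_pos rfl] at hj ⊢
          by_cases hj' : j = (bucket L m s (Z.take e) h).length
          · simp [hj']
          · have hlt : j < (bucket L m s (Z.take e) h).length := by simp at hj; omega
            rw [if_neg (by omega), hst.keys _ hi j hlt, List.getD_append _ _ _ _ hlt]
        · rw [if_neg hih] at hj ⊢
          rw [if_neg (by omega), List.append_nil]
          exact hst.keys i hi j (by simpa using hj)
      · intro i hi
        rw [key, bucket_take_succ he, ← hz, ← hhd, hr1 i hi, List.length_append]
        by_cases hih : h = i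
        · subst hih; simp
        · simp [hih, Ne.symm hih]
          omega
      · intro q r hq
        rw [key, if_neg (by omega), if_neg (by omega), hrest q r hq]
      · simp [evalL, d30]
  · simp
    omega
  · rintro B ⟨b1, b2, b3, b4⟩
    rw [List.take_length] at b2
    simp only [List.take_length] at b3
    exact ⟨b1, b2, b3, b4⟩

/-- The sum of the eighth powers of the bucket sizes. -/
def load (L m s : ℕ) (Z : List ℕ) : ℕ := ∑ i ∈ Finset.range (2 ^ m), (bucket L m s Z i).length ^ 8

/-- Put `0` into register `27` if the seed is good, and `1` otherwise. -/
def checkP : Prog :=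
  .seq (block [.const 36 0]) (.seq (forP 38 20 (block [.get 32 12 38, .op .mul 33 32 32,
    .op .mul 33 33 33, .op .mul 33 33 33, .op .add 36 36 33])) (block [.op .lt 27 25 36]))

lemma checkP_sat (hX : Size X L m) {Z : List ℕ} (hA : Env X L m s len A)
    (hZ : Z.length ≤ 2 ^ L) (h1 : ∀ i < 2 ^ m, A.mem 1 i = (bucket L m s Z i).length) :
    Sat X checkP A (24 * 2 ^ m + 16) (fun B => Frame 27 A B ∧ B.mem = A.mem ∧
      (∀ r < 30, r ≠ 27 → B.reg r = A.reg r) ∧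
      B.reg 27 = if seedBound * X.n < load L m s Z then 1 else 0) := by
  have hload : load L m s Z < 2 ^ X.w := by
    calc load L m s Z ≤ ∑ i ∈ Finset.range (2 ^ m), (2 ^ L) ^ 8 :=
          Finset.sum_le_sum fun i _ => Nat.pow_le_pow_left ((bucket_length_le Z i).trans hZ) 8
      _ = 2 ^ (m + L * 8) := by simp [pow_add, pow_mul]
      _ < 2 ^ X.w := Nat.pow_lt_pow_right (by norm_num) (by
          have := hX.w; have := hX.m_le; omega)
  have hsb : seedBound * X.n < 2 ^ X.w := hX.le_w (Nat.mul_le_mul (by norm_num [seedBound]) hX.n_le)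
  refine ((Sat.blk (Q := fun B => Frame 30 A B ∧ B.mem = A.mem ∧ B.reg 36 = 0)
    (by simp) ⟨Frame.evalL (by simp), by simp [evalL]⟩).seq
    fun B hB => (Sat.loop (cnt := 2 ^ m) (fun j B => Frame 30 A B ∧ B.mem = A.mem ∧
      B.reg 36 = ∑ i ∈ Finset.range j, (bucket L m s Z i).length ^ 8)
    (fun _ => 16) (by norm_num) (by norm_num) (by norm_num)
    (hX.le_w (by have := hX.two_pow_m; omega)) ?_ ?_ ?_ ?_).seq
    (c' := 4) fun C hC => Sat.blk ?_ ?_).mono ?_ fun _ h => h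
  · rintro j B B' ⟨h1, h2, h3⟩ hr hm hc
    exact ⟨h1.congr (fun r hr' => hr r (by omega) (by omega)) hc, hm.trans h2,
      (hr 36 (by norm_num) (by norm_num)).trans h3⟩
  · rintro j B ⟨h1, -⟩
    exact ⟨(hA.congr h1).r20, (hA.congr h1).r12⟩
  · simpa using hB
  · rintro j hj B ⟨b1, b2, b3⟩ h38
    have hB := hA.congr b1
    have := h1 j hj
    refine Sat.blk ?_ ⟨⟨b1.trans (Frame.evalL (by simp)), ?_, ?_⟩, ?_⟩
    · simp [hB.r10, hB.r12, h38, hX.row' (show 1 < 16 by norm_num), hX.col' hj]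
    · simp [evalL, b2]
    · simp [evalL, b2, b3, hB.r12, h38, this, Finset.sum_range_succ]
      ring
    · simp [evalL, h38]
  · obtain ⟨b1, b2, b3⟩ := hC
    have hC := hA.congr b1
    simp [hC.r25, b3]
    exact ⟨hsb, hload⟩
  · obtain ⟨b1, b2, b3⟩ := hC
    have hC := hA.congr b1
    refine ⟨(b1.mono (by norm_num)).trans (Frame.evalL (by simp)), ?_, ?_, ?_⟩
    · simp [evalL, b2]
    · intro r hr hne
      rw [← b1.reg r hr]
      simp [evalL, hne]
    · simp [evalL, hC.r25, b3, load]
      congr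
  · simp
    omega

end

/-! ### Hash functions of the buckets, the table, and the output -/

section

variable {X : Mach} {L m s len : ℕ} {A : Abs}

/-- For every bucket whose size agrees with row `1`, put its mask and its modulus into the rows
`3` and `4`. -/
def measureP : Prog :=
  forP 30 20 (.seq (block [.get 42 12 30, .get 43 13 30, .op .add 44 30 18, .op .eq 45 42 43])
    (.ite 45 (.seq maskP (.seq modulusP (block [.put 14 30 46, .put 15 30 47]))) (block [])))

/-- A bound for the time that the mask and the modulus of a bucket of size `b` take. -/
def bucketCost (b : ℕ) : ℕ :=
  27 * b ^ 2 + 20 * b + 12 + ((2 * b ^ 4 + 8) * tryCost b + 10) + 21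

lemma measureP_sat (hX : Size X L m) {Z : List ℕ} (hA : Env X L m s len A)
    (hZ : Z.length ≤ 2 ^ L) (hnd : Z.Nodup) (hlt : ∀ z ∈ Z, z < 2 ^ X.w)
    (hst : Stored L m s Z A.mem) {b : ℕ → ℕ} (hb : ∀ i < 2 ^ m, A.mem 1 i = b i ∧ b i ≤ 2 ^ L) :
    Sat X measureP A (∑ i ∈ Finset.range (2 ^ m), (bucketCost (b i) + 8) + 8)
      (fun B => Frame 30 A B ∧ ∀ q r, B.mem q r =
        if (q = 3 ∨ q = 4) ∧ r < 2 ^ m ∧ b r = (bucket L m s Z r).length then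
          (if q = 3 then mask (bucket L m s Z r) else modulus (bucket L m s Z r))
        else A.mem q r) := by
  have hmL := hX.two_pow_m
  refine (Sat.loop (cnt := 2 ^ m) (fun j B => Frame 30 A B ∧ ∀ q r, B.mem q r =
        if (q = 3 ∨ q = 4) ∧ r < j ∧ b r = (bucket L m s Z r).length then
          (if q = 3 then mask (bucket L m s Z r) else modulus (bucket L m s Z r))
        else A.mem q r)
    (fun i => bucketCost (b i)) (by norm_num) (by norm_num) (by norm_num)
    (hX.le_w (by omega)) ?_ ?_ ?_ ?_).mono le_rfl fun _ h => h
  · rintro j B B' ⟨h1, h2⟩ hr hm hc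
    exact ⟨h1.congr (fun r hr' => hr r (by omega) (by omega)) hc, by rwa [hm]⟩
  · rintro j B ⟨h1, -⟩
    exact ⟨(hA.congr h1).r20, (hA.congr h1).r12⟩
  · exact ⟨Frame.rfl, by simp⟩
  · rintro i hi B ⟨h1, h2⟩ h30
    have hB := hA.congr h1
    obtain ⟨hb1, hb2⟩ := hb i hi
    set l := bucket L m s Z i with hl
    have hll : l.length ≤ Z.length := bucket_length_le Z i
    have e1 : B.mem 1 i = b i := by rw [h2, if_neg (by omega), hb1]
    have e2 : B.mem 2 i = l.length := by rw [h2, if_neg (by omega), hst.size i hi]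
    have e8 : B.mem (8 + i) = A.mem (8 + i) := by
      funext r
      rw [h2, if_neg (by omega)]
    refine ((Sat.blk (Q := fun C => Frame 42 B C ∧ C.mem = B.mem ∧ C.reg 42 = b i ∧
      C.reg 44 = 8 + i ∧ C.reg 45 = if b i = l.length then 1 else 0) ?_
      ⟨Frame.evalL (by simp), ?_⟩).seq fun C hC => Sat.ite (c := bucketCost (b i) - 14)
        (by norm_num) ?_ ?_ ?_).mono ?_ fun _ h => h
    · simp [hB.r10, hB.r12, hB.r13, h30, e1, e2, hX.row' (show 1 < 16 by norm_num),
        hX.row' (show 2 < 16 by norm_num), hX.col' hi]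
      exact ⟨hX.le_w (by omega), hX.le_w (by omega)⟩
    · simp [evalL, hB.r12, hB.r13, hB.r18, h30, e1, e2, add_comm]
    · rw [hC.2.2.2.2]
      have := hX.le_w (show 1 ≤ 2 ^ 28 * 2 ^ L by have := Nat.two_pow_pos L; omega)
      split_ifs <;> omega
    · intro h45
      obtain ⟨c1, c2, c3, c4, c5⟩ := hC
      have hbl : b i = l.length := by
        by_contra hne
        rw [c5, if_neg hne] at h45
        exact h45 rfl
      have hCe := hB.congr (c1.mono (by norm_num))
      have hbk : Bucket X C l := by
        refine ⟨hCe.r10, hCe.r11, hCe.r12, c3.trans hbl, ?_, ?_, hX.le_w (by omega), ?_⟩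
        · rw [c4]
          exact hX.row (by omega)
        · exact (hX.col (by omega)).le
        · intro j hj
          rw [c2, c4, e8]
          exact hst.keys i hi j hj
      have hlnd : l.Nodup := hnd.filter _
      have hlw : ∀ z ∈ l, z < 2 ^ X.w := fun z hz => hlt z (List.mem_filter.1 hz).1
      have h4 : 4 * l.length ^ 4 + 16 < 2 ^ X.w := by
        calc 4 * l.length ^ 4 + 16 ≤ 4 * (2 ^ L) ^ 4 + 16 * (2 ^ L) ^ 4 := by
              have := Nat.pow_le_pow_left (hll.trans hZ) 4
              have : 0 < (2 ^ L) ^ 4 := by positivity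
              omega
          _ ≤ 2 ^ (4 * L + 5) := by rw [pow_add, mul_comm 4 L, pow_mul]; omega
          _ < 2 ^ X.w := Nat.pow_lt_pow_right (by norm_num) (by have := hX.w; omega)
      refine ((maskP_sat hbk hlnd).seq fun D hD => (modulusP_sat (hbk.congr hD.1 hD.2.1) hlnd hlw
        hD.2.2 h4).seq (c' := 7) fun E hE => Sat.blk ?_ ?_).mono ?_ fun _ h => h
      rotate_left 2
      · rw [bucketCost, hbl]
        omega
      all_goals
        have f1 : Frame 42 B E := c1.trans ((hD.1.mono (by norm_num)).trans (hE.1.mono (by norm_num)))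
        have hEe := hB.congr (f1.mono (by norm_num))
        have e30 : E.reg 30 = i := (f1.reg 30 (by norm_num)).trans h30
        have e46 : E.reg 46 = mask l := (hE.1.reg 46 (by norm_num)).trans hD.2.2
        have e47 := hE.2.2
        have em : E.mem = B.mem := hE.2.1.trans (hD.2.1.trans c2)
      · simp [hEe.r10, hEe.r14, hEe.r15, e30, hX.row' (show 3 < 16 by norm_num),
          hX.row' (show 4 < 16 by norm_num), hX.col' hi]
      · refine ⟨⟨h1.trans ((f1.mono (by norm_num)).trans (Frame.evalL (by simp))), ?_⟩, ?_⟩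
        · intro q r
          simp only [evalL, Cmd.eval, Abs.put_mem, Abs.put_reg, hEe.r14, hEe.r15, e30, e46, e47, em,
            h2]
          by_cases hr : r = i
          · subst hr
            by_cases h3 : q = 3
            · simp [h3, hbl, ← hl]
            · by_cases h4 : q = 4
              · simp [h4, hbl, ← hl]
              · simp [h3, h4]
          · simp only [hr, and_false, if_false, Nat.lt_succ_iff_lt_or_eq, or_false]
        · simp [evalL, e30]
    · intro h45
      obtain ⟨c1, c2, c3, c4, c5⟩ := hC
      have hbl : b i ≠ l.length := by
        intro he
        rw [c5, if_pos he] at h45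
        exact one_ne_zero h45
      refine (Sat.blk (l := []) trivial ⟨⟨h1.trans (c1.mono (by norm_num)), ?_⟩,
        (c1.reg 30 (by norm_num)).trans h30⟩).mono (by simp [bucketCost]) fun _ h => h
      intro q r
      rw [evalL, c2, h2]
      by_cases hr : r = i
      · subst hr
        simp [hbl, ← hl]
      · simp only [hr, Nat.lt_succ_iff_lt_or_eq, or_false]
    · simp [bucketCost]
      omega

/-- Write the values of a list of pairs of an address and a value, one after the other. -/
def writeAll (f : ℕ → ℕ) (ws : List (ℕ × ℕ)) : ℕ → ℕ :=
  ws.foldl (fun f x => Function.update f x.1 x.2) f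

lemma writeAll_append (f : ℕ → ℕ) (ws ws' : List (ℕ × ℕ)) :
    writeAll f (ws ++ ws') = writeAll (writeAll f ws) ws' := List.foldl_append

/-- The place in the table from which on the keys of bucket `i` are stored, if `p` gives the
moduli. -/
def offset (p : ℕ → ℕ) (i : ℕ) : ℕ := ∑ j ∈ Finset.range i, p j

/-- The writes to the table for bucket `i`: none if there are more than twice as many keys as
expected, and otherwise one for each key. -/
def writes (L m s : ℕ) (Z : List ℕ) (b M p : ℕ → ℕ) (i : ℕ) : List (ℕ × ℕ) :=
  if 2 * b i < (bucket L m s Z i).length then []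
  else (bucket L m s Z i).map fun z => (offset p i + slot (M i) (p i) z, z)

/-- Write the keys to the table in row `5`. -/
def fillP : Prog :=
  .seq (block [.const 36 0]) (forP 30 20 (.seq (block [.get 42 12 30, .get 43 13 30, .get 46 14 30,
      .get 47 15 30, .op .add 44 30 18, .op .add 45 42 42, .op .lt 45 45 43])
    (.seq (.ite 45 (block []) (forP 50 43 (.seq (block [.get 80 44 50])
        (.seq slotP (block [.op .add 52 36 81, .put 16 52 80])))))
      (block [.op .add 36 36 47]))))

/-- A bound for the time in which the keys of a bucket of expected size `b` are written. -/
def fillCost (b : ℕ) : ℕ := 2 * b * (53 * b ^ 2 + 30) + 50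

lemma fillP_sat (hX : Size X L m) {Z : List ℕ} (hA : Env X L m s len A)
    (hZ : Z.length ≤ 2 ^ L) (hlt : ∀ z ∈ Z, z < 2 ^ X.w)
    (hst : Stored L m s Z A.mem) {b M p : ℕ → ℕ} (hb : ∀ i < 2 ^ m, A.mem 1 i = b i ∧ b i ≤ 2 ^ L)
    (hM : ∀ i < 2 ^ m, A.mem 3 i = M i ∧ M i < 2 ^ L ∧ pop (M i) ≤ b i ^ 2)
    (hp : ∀ i < 2 ^ m, A.mem 4 i = p i ∧ 2 ≤ p i)
    (hsum : offset p (2 ^ m) ≤ X.K * X.n) :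
    Sat X fillP A (∑ i ∈ Finset.range (2 ^ m), (fillCost (b i) + 8) + 12)
      (fun B => Frame 30 A B ∧ (∀ q ≠ 5, B.mem q = A.mem q) ∧ B.mem 5 = writeAll (A.mem 5)
        ((List.range (2 ^ m)).flatMap (writes L m s Z b M p))) := by
  have hmL := hX.two_pow_m
  have hNL : X.K * X.n ≤ 2 ^ 27 * 2 ^ L := Nat.mul_le_mul hX.K.le hX.n_le
  have hoff : ∀ i ≤ 2 ^ m, offset p i ≤ X.K * X.n := fun i hi =>
    (Finset.sum_le_sum_of_subset (by simpa using hi)).trans hsum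
  refine ((Sat.blk (Q := fun B => Frame 30 A B ∧ B.mem = A.mem ∧ B.reg 36 = 0)
    (by simp) ⟨Frame.evalL (by simp), by simp [evalL]⟩).seq
    fun B hB => Sat.loop (cnt := 2 ^ m) (fun j B => Frame 30 A B ∧ (∀ q ≠ 5, B.mem q = A.mem q) ∧
      B.mem 5 = writeAll (A.mem 5) ((List.range j).flatMap (writes L m s Z b M p)) ∧
      B.reg 36 = offset p j)
    (fun i => fillCost (b i)) (by norm_num) (by norm_num) (by norm_num)
    (hX.le_w (by omega)) ?_ ?_ ?_ ?_).mono ?_ ?_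
  · rintro j B B' ⟨h1, h2, h3, h4⟩ hr hm hc
    exact ⟨h1.congr (fun r hr' => hr r (by omega) (by omega)) hc, by rwa [hm], by rwa [hm],
      (hr 36 (by norm_num) (by norm_num)).trans h4⟩
  · rintro j B ⟨h1, -⟩
    exact ⟨(hA.congr h1).r20, (hA.congr h1).r12⟩
  · obtain ⟨h1, h2, h3⟩ := hB
    exact ⟨h1, fun q _ => by rw [h2], by rw [h2]; simp [writeAll], by rw [h3]; simp [offset]⟩
  · rintro i hi B ⟨h1, h2, h3, h4⟩ h30
    have hB := hA.congr h1
    obtain ⟨hb1, hb2⟩ := hb i hi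
    obtain ⟨hM1, hM2, hM3⟩ := hM i hi
    obtain ⟨hp1, hp2⟩ := hp i hi
    have hMw : M i < 2 ^ X.w := hX.le_w (by omega)
    have hoi : offset p i + p i ≤ X.K * X.n := by
      have := hoff (i + 1) hi
      rwa [offset, Finset.sum_range_succ] at this
    set l := bucket L m s Z i with hl
    have hll : l.length ≤ Z.length := bucket_length_le Z i
    rw [← h2 1 (by norm_num)] at hb1
    rw [← h2 3 (by norm_num)] at hM1
    rw [← h2 4 (by norm_num)] at hp1
    have e2 : B.mem 2 i = l.length := by rw [h2 2 (by norm_num), hst.size i hi]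
    have hlw : ∀ z ∈ l, z < 2 ^ X.w := fun z hz => hlt z (List.mem_filter.1 hz).1
    refine ((Sat.blk (Q := fun C => Frame 42 B C ∧ C.mem = B.mem ∧ C.reg 43 = l.length ∧
      C.reg 44 = 8 + i ∧ C.reg 45 = (if 2 * b i < l.length then 1 else 0) ∧ C.reg 46 = M i ∧
      C.reg 47 = p i) ?_ ⟨Frame.evalL (by simp), ?_⟩).seq fun C hC =>
      (Sat.ite (c := fillCost (b i) - 27) (Q := fun D => Frame 42 B D ∧
        (∀ q ≠ 5, D.mem q = A.mem q) ∧ D.reg 47 = p i ∧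
        D.mem 5 = writeAll (A.mem 5) ((List.range (i + 1)).flatMap (writes L m s Z b M p)))
        (by norm_num) ?_ ?_ ?_).seq (c' := 4) fun D hD => Sat.blk (by simp) ?_).mono ?_
        fun _ h => h
    · simp [hB.r10, hB.r12, hB.r13, hB.r14, hB.r15, h30, hb1, e2, hX.row' (show 1 < 16 by norm_num),
        hX.row' (show 2 < 16 by norm_num), hX.row' (show 3 < 16 by norm_num),
        hX.row' (show 4 < 16 by norm_num), hX.col' hi]
      exact ⟨hX.le_w (by omega), hX.le_w (by omega)⟩
    · simp [evalL, hB.r12, hB.r13, hB.r14, hB.r15, hB.r18, h30, hb1, e2, hM1, hp1, add_comm, two_mul]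
    · rw [hC.2.2.2.2.1]
      have := hX.le_w (show 1 ≤ 2 ^ 28 * 2 ^ L by have := Nat.two_pow_pos L; omega)
      split_ifs <;> omega
    · intro h45
      obtain ⟨c1, c2, c3, c4, c5, c6, c7⟩ := hC
      have hbl : 2 * b i < l.length := by
        by_contra hne
        rw [c5, if_neg hne] at h45
        exact h45 rfl
      refine (Sat.blk (l := []) trivial ⟨c1, ?_, c7, ?_⟩).mono (by simp [fillCost])
        fun _ h => h
      · rw [evalL, c2]
        exact h2
      · rw [evalL, c2, h3, List.range_succ, List.flatMap_append]
        simp [writes, ← hl, hbl]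
    · intro h45
      obtain ⟨c1, c2, c3, c4, c5, c6, c7⟩ := hC
      have hbl : ¬ 2 * b i < l.length := by
        intro he
        rw [c5, if_pos he] at h45
        exact one_ne_zero h45
      have hw : writes L m s Z b M p i = l.map fun z => (offset p i + slot (M i) (p i) z, z) := by
        rw [writes, if_neg hbl]
      refine (Sat.loop (cnt := l.length) (fun j D => Frame 48 C D ∧
        (∀ q ≠ 5, D.mem q = A.mem q) ∧ D.mem 5 = writeAll (B.mem 5)
          ((l.map fun z => (offset p i + slot (M i) (p i) z, z)).take j))
        (fun _ => 53 * b i ^ 2 + 22) (by norm_num) (by norm_num) (by norm_num) (hX.le_w (by omega))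
        ?_ ?_ ?_ ?_).mono ?_ ?_
      · rintro j B B' ⟨h1, h2, h3⟩ hr hm hc
        exact ⟨h1.congr (fun r hr' => hr r (by omega) (by omega)) hc, by rwa [hm], by rwa [hm]⟩
      · rintro j D ⟨d1, -⟩
        exact ⟨(d1.reg _ (by norm_num)).trans c3, (hB.congr ((c1.trans (d1.mono (by norm_num))).mono
          (by norm_num))).r12⟩
      · exact ⟨Frame.rfl, by rwa [c2], by rw [c2]; simp [writeAll]⟩
      · rintro j hj D ⟨d1, d2, d3⟩ h50
        have f1 : Frame 42 B D := c1.trans (d1.mono (by norm_num))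
        have hD := hB.congr (f1.mono (by norm_num))
        have d44 : D.reg 44 = 8 + i := (d1.reg _ (by norm_num)).trans c4
        have hmj : D.mem (8 + i) j = l.getD j 0 := by
          rw [d2 _ (by omega)]
          exact hst.keys i hi j hj
        have hzm := getD_mem hj
        refine ((Sat.blk (Q := fun E => Frame 51 D E ∧ E.mem = D.mem ∧
          E.reg 80 = l.getD j 0) ?_ ⟨Frame.evalL (by simp), ?_⟩).seq fun E hE =>
          (slotP_sat (M := M i) (p := p i) (z := l.getD j 0) ?_ ?_ ?_ ?_ ?_ hMw
            (hlw _ hzm) hp2 ?_).seq (c' := 7) fun F hF => Sat.blk ?_ ?_).mono ?_ fun _ h => h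
        · simp [hD.r10, d44, h50]
          exact ⟨hX.row (by omega), hX.col (by omega)⟩
        · simp [evalL, d44, h50, hmj, -List.getD_eq_getElem?_getD]
        · rw [hE.1.reg _ (by norm_num), hD.r11]
        · rw [hE.1.reg _ (by norm_num), hD.r12]
        · rw [hE.1.reg _ (by norm_num), d1.reg _ (by norm_num), c6]
        · rw [hE.1.reg _ (by norm_num), d1.reg _ (by norm_num), c7]
        · exact hE.2.2
        · exact hX.le_w (by omega)
        rotate_left 2
        · simp
          omega
        all_goals
          have f2 : Frame 51 D F := hE.1.trans (hF.1.mono (by norm_num))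
          have hFe := hD.congr (f2.mono (by norm_num))
          have e36 : F.reg 36 = offset p i := by
            rw [f2.reg _ (by norm_num), f1.reg _ (by norm_num), h4]
          have e80 : F.reg 80 = l.getD j 0 := (hF.1.reg _ (by norm_num)).trans hE.2.2
          have em : F.mem = D.mem := hF.2.1.trans hE.2.1
          have hsl := slot_lt (M := M i) (z := l.getD j 0) hp2
        · simp [hFe.r10, hFe.r16, e36, hF.2.2, hX.row' (show 5 < 16 by norm_num),
            -List.getD_eq_getElem?_getD]
          exact hX.col (by omega)
        · refine ⟨⟨d1.trans ((f2.mono (by norm_num)).trans (Frame.evalL (by simp))), ?_, ?_⟩, ?_⟩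
          · intro q hq
            funext r
            simp only [evalL, Cmd.eval, Abs.put_mem, Abs.set_reg, Abs.set_mem]
            simp [hFe.r16, hq, em, d2 q hq]
          · funext r
            rw [List.take_succ_eq_append_getElem (by simpa using hj), writeAll_append, ← d3]
            simp only [evalL, Cmd.eval, Abs.put_mem, Abs.set_reg, Abs.set_mem]
            rw [List.getD_eq_getElem _ _ hj] at hF e80
            simp [hFe.r16, em, e36, e80, hF.2.2, writeAll, Function.update_apply]
          · simp [evalL, f2.reg 50 (by norm_num), h50]
      · simp only [Finset.sum_const, Finset.card_range, smul_eq_mul, fillCost]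
        have : l.length * (53 * b i ^ 2 + 22 + 8) ≤ 2 * b i * (53 * b i ^ 2 + 30) :=
          Nat.mul_le_mul (by omega) (by omega)
        omega
      · rintro D ⟨d1, d2, d3⟩
        refine ⟨c1.trans (d1.mono (by norm_num)), d2, (d1.reg _ (by norm_num)).trans c7, ?_⟩
        rw [d3, h3, ← writeAll_append, List.range_succ, List.flatMap_append]
        have ht := List.take_length (l := l.map fun z => (offset p i + slot (M i) (p i) z, z))
        rw [List.length_map] at ht
        simp [hw, ht]
    · obtain ⟨d1, d2, d3, d4⟩ := hD
      refine ⟨⟨h1.trans ((d1.mono (by norm_num)).trans (Frame.evalL (by simp))), ?_, ?_, ?_⟩, ?_⟩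
      · simpa [evalL] using d2
      · simpa [evalL] using d4
      · simp [evalL, d1.reg 36 (by norm_num), d3, h4, offset, Finset.sum_range_succ]
      · simp [evalL, d1.reg 30 (by norm_num), h30]
    · simp [fillCost]
      omega
  · simp
    omega
  · rintro B ⟨h1, h2, h3, -⟩
    exact ⟨h1, h2, h3⟩

/-- Unpack the keys in the table to row `6`, and put the address of this row into register `0`. -/
def outP (K : ℕ) : Prog :=
  .seq (block [.const 36 0, .const 38 K, .op .mul 38 38 1])
    (.seq (forP 40 38 (.seq (block [.get 60 16 40])
      (.ite 60 (block [.op .shr 33 60 6, .op .shl 34 33 6, .op .sub 34 60 34, .put 17 36 34,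
        .op .add 36 36 12, .put 17 36 33, .op .add 36 36 12]) (block []))))
    (block [.op .shl 0 17 10]))

/-- The keys among the first `N` entries of a table. -/
def keysOf (T : ℕ → ℕ) (N : ℕ) : List ℕ := ((List.range N).map T).filter fun z => decide (z ≠ 0)

lemma keysOf_succ (T : ℕ → ℕ) (N : ℕ) :
    keysOf T (N + 1) = keysOf T N ++ if T N ≠ 0 then [T N] else [] := by
  rw [keysOf, List.range_succ, List.map_append, List.filter_append]
  by_cases h : T N = 0 <;> simp [keysOf, h]

lemma keysOf_length_le (T : ℕ → ℕ) (N : ℕ) : (keysOf T N).length ≤ N :=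
  (List.length_filter_le _ _).trans (by simp)

lemma outP_sat (hX : Size X L m) (hA : Env X L m s len A)
    (hT : ∀ j < X.K * X.n, A.mem 5 j < 2 ^ X.w) :
    Sat X (outP X.K) A (X.K * X.n * 37 + 22) (fun B =>
      Input L (keysOf (A.mem 5) (X.K * X.n)) (B.mem 6) ∧ B.reg 0 = 6 * 2 ^ X.LN ∧
        B.ch = A.ch) := by
  have hNL : X.K * X.n ≤ 2 ^ 27 * 2 ^ L := Nat.mul_le_mul hX.K.le hX.n_le
  have hLw : L < 2 ^ X.w := Nat.lt_two_pow_self.trans_le (hX.lt_pow (by omega))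
  set N := X.K * X.n with hN
  refine ((Sat.blk (Q := fun B => Frame 30 A B ∧ B.mem = A.mem ∧ B.reg 36 = 0 ∧ B.reg 38 = N)
    (by simp) ⟨Frame.evalL (by simp), by simp [evalL, hA.r1, hN]⟩).seq
    fun B hB => (Sat.loop (cnt := N) (fun j B => Frame 30 A B ∧ (∀ q ≠ 6, B.mem q = A.mem q) ∧
      Input L (keysOf (A.mem 5) j) (B.mem 6) ∧ B.reg 36 = 2 * (keysOf (A.mem 5) j).length ∧
      B.reg 38 = N)
    (fun _ => 29) (by norm_num) (by norm_num) (by norm_num)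
    (hX.le_w (by omega)) ?_ ?_ ?_ ?_).seq (c' := 4) fun C hC => Sat.blk ?_ ?_).mono ?_ fun _ h => h
  · rintro j B B' ⟨h1, h2, h3, h4, h5⟩ hr hm hc
    exact ⟨h1.congr (fun r hr' => hr r (by omega) (by omega)) hc, by rwa [hm], by rwa [hm],
      (hr 36 (by norm_num) (by norm_num)).trans h4, (hr 38 (by norm_num) (by norm_num)).trans h5⟩
  · rintro j B ⟨h1, -, -, -, h5⟩
    exact ⟨h5, (hA.congr h1).r12⟩
  · obtain ⟨h1, h2, h3, h4⟩ := hB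
    exact ⟨h1, fun q _ => by rw [h2], by simp [Input, keysOf], by simp [h3, keysOf], h4⟩
  · rintro j hj B ⟨h1, h2, h3, h4, h5⟩ h40
    have hB := hA.congr h1
    have hlen := keysOf_length_le (A.mem 5) j
    set z := A.mem 5 j with hz
    have hzw : z < 2 ^ X.w := hT j hj
    refine ((Sat.blk (Q := fun C => Frame 60 B C ∧ C.mem = B.mem ∧ C.reg 60 = z) ?_
      ⟨Frame.evalL (by simp), ?_⟩).seq fun C hC => Sat.ite (c := 22) (by norm_num) ?_ ?_ ?_).mono
        ?_ fun _ h => h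
    · simp [hB.r10, hB.r16, h40, hX.row' (show 5 < 16 by norm_num)]
      exact hX.col (by omega)
    · simp [evalL, hB.r16, h40, h2 5]
      rfl
    · rw [hC.2.2]
      exact hzw
    · intro h60
      obtain ⟨c1, c2, c3⟩ := hC
      rw [c3] at h60
      have hCe := hB.congr (c1.mono (by norm_num))
      have c36 := (c1.reg 36 (by norm_num)).trans h4
      have hdiv : z / 2 ^ L * 2 ^ L ≤ z := Nat.div_mul_le_self _ _
      have hmod : z - z / 2 ^ L * 2 ^ L = z % 2 ^ L := by
        have := Nat.div_add_mod z (2 ^ L)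
        rw [mul_comm] at this
        omega
      refine Sat.blk ?_ ⟨⟨h1.trans ((c1.mono (by norm_num)).trans (Frame.evalL (by simp))), ?_, ?_,
        ?_, ?_⟩, ?_⟩
      · simp [hCe.r10, hCe.r6, hCe.r12, hCe.r17, c3, c36, hLw, hzw, hdiv,
          hX.row' (show 6 < 16 by norm_num)]
        exact ⟨hX.col (by omega), hX.col (by omega)⟩
      · intro q hq
        funext r
        simp only [evalL, Cmd.eval, Abs.put_mem, Abs.put_reg, Abs.set_reg, Abs.set_mem]
        simp [hCe.r17, hq, c2, h2 q hq]
      · rw [keysOf_succ, if_pos h60]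
        intro e he
        rw [List.length_append, List.length_singleton] at he
        simp only [evalL, Cmd.eval, Abs.put_mem, Abs.put_reg, Abs.set_reg, Abs.set_mem, BinOp.nat]
        simp only [hCe.r17, hCe.r12, hCe.r6, c36, c3, c2]
        norm_num
        simp only [hmod]
        by_cases hel : e = (keysOf (A.mem 5) j).length
        · subst hel
          simp
          exact ⟨rfl, rfl⟩
        · have hlt : e < (keysOf (A.mem 5) j).length := by omega
          obtain ⟨i1, i2⟩ := h3 e hlt
          rw [if_neg (by omega), if_neg (by omega), if_neg (by omega), if_neg (by omega), i1, i2]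
          rw [List.getElem?_append_left hlt]
          simp
      · rw [keysOf_succ, if_pos h60]
        simp [evalL, hCe.r12, c36]
        omega
      · simp [evalL, c1.reg 38 (by norm_num), h5]
      · simp [evalL, c1.reg 40 (by norm_num), h40]
    · intro h60
      obtain ⟨c1, c2, c3⟩ := hC
      rw [c3] at h60
      refine (Sat.blk (l := []) trivial ⟨⟨h1.trans (c1.mono (by norm_num)), ?_, ?_, ?_, ?_⟩,
        (c1.reg 40 (by norm_num)).trans h40⟩).mono (by simp) fun _ h => h
      · rw [evalL, c2]
        exact h2
      · rw [keysOf_succ, ← hz, h60, evalL, c2]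
        simpa using h3
      · rw [keysOf_succ, ← hz, h60, evalL, c1.reg 36 (by norm_num), h4]
        simp
      · exact (c1.reg 38 (by norm_num)).trans h5
    · simp
  · have hCe := hA.congr hC.1
    have : X.LN < 2 ^ X.w := by
      rw [hX.LN]
      refine lt_of_lt_of_le ?_ (hX.lt_pow (show L + 28 ≤ 128 * L + 128 by omega))
      exact Nat.lt_two_pow_self
    simp [hCe.r10, this]
  · have hCe := hA.congr hC.1
    refine ⟨?_, ?_, ?_⟩
    · simpa [evalL] using hC.2.2.1
    · simp [evalL, hCe.r10, hCe.r17]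
    · simp [hC.1.ch]
  · simp
    omega

end

/-! ### Communication -/

lemma natToBits_succ (b x : ℕ) : natToBits (b + 1) x = x.testBit 0 :: natToBits b (x / 2) := by
  simp [natToBits, List.range_succ_eq_map, Nat.testBit_succ, Function.comp_def]

lemma length_natToBits (b x : ℕ) : (natToBits b x).length = b := by simp [natToBits]

lemma bitsToNat_natToBits (b x : ℕ) : bitsToNat (natToBits b x) = x % 2 ^ b := by
  induction b generalizing x with
  | zero => simp [natToBits, bitsToNat, Nat.mod_one]
  | succ b ih =>
    rw [natToBits_succ, bitsToNat, ih, pow_succ, mul_comm (2 ^ b) 2, Nat.mod_mul, Nat.testBit_zero]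
    congr 1
    rcases Nat.mod_two_eq_zero_or_one x with h | h <;> simp [h]

lemma natToBits_mod (b x w : ℕ) (h : b ≤ w) : natToBits b (x % 2 ^ w) = natToBits b x := by
  refine List.map_congr_left fun i hi => ?_
  rw [List.mem_range] at hi
  rw [Nat.testBit_mod_two_pow]
  simp [show i < w by omega]

lemma length_flatMap_of_forall {α β : Type*} {f : α → List β} {ℓ : ℕ}
    (hf : ∀ a, (f a).length = ℓ) (l : List α) : (l.flatMap f).length = l.length * ℓ := by
  induction l with
  | nil => simp
  | cons a l ih => rw [List.flatMap_cons, List.length_append, hf, ih, List.length_cons]; ring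

lemma take_drop_flatMap {α β : Type*} {f : α → List β} {ℓ : ℕ} (hf : ∀ a, (f a).length = ℓ)
    (l : List α) (rest : List β) (j : ℕ) (hj : j < l.length) :
    ((l.flatMap f ++ rest).drop (j * ℓ)).take ℓ = f l[j] := by
  induction l generalizing j with
  | nil => simp at hj
  | cons a l ih =>
    rw [List.flatMap_cons, List.append_assoc]
    cases j with
    | zero => simp [← hf a]
    | succ j =>
      rw [add_mul, one_mul, add_comm, ← List.drop_drop, ← hf a, List.drop_left, hf a]
      simpa using ih j (by simpa using hj)

section

variable {ℓ ρ : ℕ}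

lemma redundancyBits_eq (z : Fin ρ → Fin (2 ^ ℓ)) :
    redundancyBits z = (List.ofFn z).flatMap fun a => natToBits ℓ a.val := by
  simp [redundancyBits, List.flatMap_assoc]

lemma length_redundancyBits (z : Fin ρ → Fin (2 ^ ℓ)) : (redundancyBits z).length = ρ * ℓ := by
  rw [redundancyBits_eq, length_flatMap_of_forall (fun a => length_natToBits ℓ _), List.length_ofFn]

lemma parseRedundancy_append (z : Fin ρ → Fin (2 ^ ℓ)) (rest : List Bool) :
    parseRedundancy ρ ℓ (redundancyBits z ++ rest) = z := by
  funext j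
  rw [parseRedundancy, redundancyBits_eq, take_drop_flatMap (fun a => length_natToBits ℓ _) _ _ _
    (by simp), bitsToNat_natToBits]
  apply Fin.ext
  simp [Fin.ofNat, Nat.mod_eq_of_lt]

end

/-- The word of `n` symbols in the cells of a row from column `o` on. -/
def wordAt (n ℓ : ℕ) (f : ℕ → ℕ) (o : ℕ) : Fin n → Fin (2 ^ ℓ) := fun i =>
  Fin.ofNat (2 ^ ℓ) (f (o + i))

/-- Encode the word in row `reg q` from column `reg o` on. -/
def encP (q o : ℕ) : Prog := .seq (addrProg q o) (.instr (.encode 9))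

/-- Decode the word in row `reg q` from column `reg o` on. -/
def decP (q o : ℕ) : Prog := .seq (addrProg q o) (.instr (.decode 9))

lemma symbolsAt_eq {X : Mach} {S : State X.w} {A : Abs} {q o : ℕ} (h : Rep X S A)
    (hℓ : X.ℓ ≤ X.w) (hq : q < 2 ^ (X.w - X.LN)) (ho : o + X.n ≤ 2 ^ X.LN) :
    S.symbolsAt X.n X.ℓ (BitVec.ofNat X.w (q * 2 ^ X.LN + o)) = wordAt X.n X.ℓ (A.mem q) o := by
  funext i
  have hi := i.isLt
  rw [State.symbolsAt, ← BitVec.ofNat_add, add_assoc, h.mem q _ hq (by omega), wordAt]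
  apply Fin.ext
  simp only [Fin.ofNat, BitVec.toNat_ofNat]
  exact Nat.mod_mod_of_dvd _ (pow_dvd_pow 2 hℓ)

section

variable {X : Mach} {A : Abs} {q o : ℕ}

lemma encP_sat (hℓ : X.ℓ ≤ X.w) (hc : A.cell X q o) (ho : A.reg o + X.n ≤ 2 ^ X.LN) :
    Sat X (encP q o) A 3 (fun B => B.reg = A.reg ∧ B.mem = A.mem ∧ B.ch =
      { A.ch with
        outMsg := A.ch.outMsg ++ redundancyBits
          (X.code.enc (wordAt X.n X.ℓ (A.mem (A.reg q)) (A.reg o)))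
        encCalls := A.ch.encCalls + 1 }) := by
  intro S h
  obtain ⟨T, hT, hs, hR, h9⟩ := addrProg_exec h hc
  refine ⟨_, ⟨A.reg, A.mem, { A.ch with
    outMsg := A.ch.outMsg ++ redundancyBits
      (X.code.enc (wordAt X.n X.ℓ (A.mem (A.reg q)) (A.reg o)))
    encCalls := A.ch.encCalls + 1 }⟩, .seq hT (.instr _ _), by simp [State.tick, Instr.exec, hs], ?_, rfl,
    rfl, rfl⟩
  simp only [Instr.exec, h9, symbolsAt_eq hR hℓ hc.2.2.2.1 ho]
  exact ⟨hR.reg, hR.mem, hR.inMsg, by simp [State.tick, hR.outMsg], hR.drawn,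
    by simp [State.tick, hR.encCalls], hR.decCalls, hR.le⟩

lemma decP_sat (hℓ : X.ℓ ≤ X.w) (hc : A.cell X q o) (ho : A.reg o + X.n ≤ 2 ^ X.LN)
    {F : ℕ → ℕ} {rest : List Bool}
    (hin : A.ch.inMsg =
      redundancyBits (X.code.enc (wordAt X.n X.ℓ F (A.reg o))) ++ rest)
    (hd : hammingDist (wordAt X.n X.ℓ F (A.reg o))
      (wordAt X.n X.ℓ (A.mem (A.reg q)) (A.reg o)) ≤ X.k)
    (hF : ∀ i < X.n, F (A.reg o + i) < 2 ^ X.ℓ) :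
    Sat X (decP q o) A 3 (fun B => B.reg = A.reg ∧
      (∀ q' r, B.mem q' r =
        if q' = A.reg q ∧ A.reg o ≤ r ∧ r < A.reg o + X.n then F r else A.mem q' r) ∧
      B.ch = { A.ch with inMsg := rest, decCalls := A.ch.decCalls + 1 }) := by
  intro S h
  obtain ⟨T, hT, hs, hR, h9⟩ := addrProg_exec h hc
  obtain ⟨-, -, -, hq, ho'⟩ := hc
  refine ⟨_, ⟨A.reg, fun q' r =>
      if q' = A.reg q ∧ A.reg o ≤ r ∧ r < A.reg o + X.n then F r else A.mem q' r,
    { A.ch with inMsg := rest, decCalls := A.ch.decCalls + 1 }⟩, .seq hT (.instr _ _), by simp [State.tick, Instr.exec, hs,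
    State.writeSymbols], ?_, rfl, fun _ _ => rfl, rfl⟩
  have hparse : parseRedundancy X.ρ X.ℓ T.inMsg = X.code.enc (wordAt X.n X.ℓ F (A.reg o)) := by
    rw [hR.inMsg, hin, parseRedundancy_append]
  have hdec : X.code.dec (wordAt X.n X.ℓ (A.mem (A.reg q)) (A.reg o))
      (X.code.enc (wordAt X.n X.ℓ F (A.reg o))) = wordAt X.n X.ℓ F (A.reg o) :=
    X.code.corrects _ _ _ (by rwa [hammingDist_self, add_zero])
  simp only [Instr.exec, h9, symbolsAt_eq hR hℓ hq ho, hparse, hdec]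
  refine ⟨hR.reg, ?_, ?_, hR.outMsg, hR.drawn, hR.encCalls, by simp [State.tick, State.writeSymbols,
    hR.decCalls], hR.le⟩
  · intro q' r hq' hr
    have ha' := addr_lt hR.le hq' hr
    simp only [State.tick, State.writeSymbols]
    by_cases hcase : q' = A.reg q ∧ A.reg o ≤ r ∧ r < A.reg o + X.n
    · obtain ⟨rfl, hor, hrn⟩ := hcase
      have hsub : (BitVec.ofNat X.w (A.reg q * 2 ^ X.LN + r) -
          BitVec.ofNat X.w (A.reg q * 2 ^ X.LN + A.reg o)).toNat = r - A.reg o := by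
        rw [← ofNat_sub_eq (by omega), BitVec.toNat_ofNat, Nat.mod_eq_of_lt (by omega)]
        omega
      rw [if_pos ⟨rfl, hor, hrn⟩, dif_pos (by rw [hsub]; omega)]
      simp only [wordAt, hsub, Fin.ofNat, Nat.add_sub_cancel' hor]
      rw [Nat.mod_eq_of_lt]
      simpa [Nat.add_sub_cancel' hor] using hF (r - A.reg o) (by omega)
    · rw [if_neg hcase, dif_neg]
      · exact hR.mem q' r hq' hr
      · intro hlt
        apply hcase
        set d := (BitVec.ofNat X.w (q' * 2 ^ X.LN + r) -
          BitVec.ofNat X.w (A.reg q * 2 ^ X.LN + A.reg o)).toNat with hd'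
        have e : BitVec.ofNat X.w (q' * 2 ^ X.LN + r) =
            BitVec.ofNat X.w (A.reg q * 2 ^ X.LN + (A.reg o + d)) := by
          rw [← add_assoc, BitVec.ofNat_add (A.reg q * 2 ^ X.LN + A.reg o), hd', BitVec.ofNat_toNat,
            BitVec.setWidth_eq, BitVec.add_comm, BitVec.sub_add_cancel]
        obtain ⟨h1, h2⟩ := addr_inj hr (by omega)
          (ofNat_inj_of_lt ha' (addr_lt hR.le hq (by omega)) e)
        exact ⟨h1, by omega, by omega⟩
  · simp only [State.tick, State.writeSymbols, hR.inMsg, hin]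
    rw [← length_redundancyBits (X.code.enc (wordAt X.n X.ℓ F (A.reg o))), List.drop_left]

lemma send_sat {a b : ℕ} (ha : a ≠ 9) (hb : b ≠ 9) (hw : A.reg b ≤ X.w) :
    Sat X (.instr (.send a b)) A 1 (fun B => B.reg = A.reg ∧ B.mem = A.mem ∧ B.ch =
      { A.ch with outMsg := A.ch.outMsg ++ natToBits (A.reg b) (A.reg a) }) := by
  intro S h
  refine ⟨_, ⟨A.reg, A.mem,
    { A.ch with outMsg := A.ch.outMsg ++ natToBits (A.reg b) (A.reg a) }⟩, .instr _ _, by simp [State.tick, Instr.exec], ?_, rfl, rfl, rfl⟩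
  have e : min (S.reg b).toNat X.w = A.reg b := by
    rw [h.reg b hb, BitVec.toNat_ofNat, Nat.mod_eq_of_lt (hw.trans_lt Nat.lt_two_pow_self),
      min_eq_left hw]
  refine ⟨h.reg, h.mem, h.inMsg, ?_, h.drawn, h.encCalls, h.decCalls, h.le⟩
  simp only [State.tick, Instr.exec, e, h.outMsg, h.reg a ha, BitVec.toNat_ofNat]
  rw [natToBits_mod _ _ _ hw]

lemma recv_sat {d b : ℕ} (hb : b ≠ 9) (hw : A.reg b ≤ X.w) :
    Sat X (.instr (.recv d b)) A 1 (fun B =>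
      B.reg = (A.set d (bitsToNat (A.ch.inMsg.take (A.reg b)))).reg ∧ B.mem = A.mem ∧ B.ch =
      { A.ch with inMsg := A.ch.inMsg.drop (A.reg b) }) := by
  intro S h
  refine ⟨_, ⟨(A.set d (bitsToNat (A.ch.inMsg.take (A.reg b)))).reg, A.mem,
    { A.ch with inMsg := A.ch.inMsg.drop (A.reg b) }⟩, .instr _ _, by simp [State.tick, Instr.exec, State.setReg], ?_, rfl, rfl,
    rfl⟩
  have e : min (S.reg b).toNat X.w = A.reg b := by
    rw [h.reg b hb, BitVec.toNat_ofNat, Nat.mod_eq_of_lt (hw.trans_lt Nat.lt_two_pow_self),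
      min_eq_left hw]
  refine ⟨?_, h.mem, ?_, h.outMsg, h.drawn, h.encCalls, h.decCalls, h.le⟩
  · simp only [State.tick, Instr.exec, e, h.inMsg]
    exact (h.setReg d _).reg
  · simp only [State.tick, Instr.exec, e, h.inMsg]

lemma rand_sat {d : ℕ} :
    Sat X (.instr (.rand d)) A 1 (fun B => B.reg = (A.set d (X.tape A.ch.drawn)).reg ∧
      B.mem = A.mem ∧ B.ch = { A.ch with drawn := A.ch.drawn + 1 }) := by
  intro S h
  refine ⟨_, ⟨(A.set d (X.tape A.ch.drawn)).reg, A.mem,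
    { A.ch with drawn := A.ch.drawn + 1 }⟩, .instr _ _, by simp [State.tick, Instr.exec, State.setReg], ?_, rfl, rfl,
    rfl⟩
  have e : BitVec.ofFin (X.tape S.drawn) = BitVec.ofNat X.w (X.tape A.ch.drawn) := by
    rw [h.drawn]
    apply BitVec.eq_of_toNat_eq
    simp
  refine ⟨?_, h.mem, h.inMsg, h.outMsg, ?_, h.encCalls, h.decCalls, h.le⟩
  · simp only [State.tick, Instr.exec, e]
    exact (h.setReg d _).reg
  · simp only [State.tick, Instr.exec, h.drawn]

end

section

variable {X : Mach} {L m s len : ℕ} {A : Abs}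

/-- Call the code for every word of the table in row `5`, by means of the program `p`. -/
def tabP (K : ℕ) (p : Prog) : Prog :=
  .seq (block [.const 36 0, .const 37 K])
    (forP 40 37 (.seq p (block [.op .add 36 36 1])))

lemma tab_col (hX : Size X L m) {j : ℕ} (hj : j < X.K) :
    j * X.n + X.n < 2 ^ X.LN := by
  refine hX.col ?_
  have h1 : (j + 1) * X.n ≤ X.K * X.n := Nat.mul_le_mul_right _ hj
  have h2 : X.K * X.n ≤ 2 ^ 27 * 2 ^ L := Nat.mul_le_mul hX.K.le hX.n_le
  have := Nat.two_pow_pos L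
  rw [add_mul] at h1
  omega

/-- The message that consists of the redundancies of the words of the table `F`, from word `j` on. -/
def tabMsg (X : Mach) (F : ℕ → ℕ) (j : ℕ) : List Bool :=
  ((List.range X.K).drop j).flatMap fun i =>
    redundancyBits (X.code.enc (wordAt X.n X.ℓ F (i * X.n)))

lemma tabMsg_eq (F : ℕ → ℕ) {j : ℕ} (hj : j < X.K) : tabMsg X F j =
    redundancyBits (X.code.enc (wordAt X.n X.ℓ F (j * X.n))) ++ tabMsg X F (j + 1) := by
  rw [tabMsg, List.drop_eq_getElem_cons (by simpa using hj), List.flatMap_cons, List.getElem_range]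
  rfl

lemma tabMsg_last (F : ℕ → ℕ) : tabMsg X F X.K = [] := by
  rw [tabMsg, List.drop_of_length_le (by simp), List.flatMap_nil]

lemma length_tabMsg (F : ℕ → ℕ) : (tabMsg X F 0).length = X.K * (X.ρ * X.ℓ) := by
  rw [tabMsg, length_flatMap_of_forall (fun _ => length_redundancyBits _)]
  simp

lemma encTab_sat (hX : Size X L m) (hA : Env X L m s len A) (hℓ : X.ℓ ≤ X.w) :
    Sat X (tabP X.K (encP 16 36)) A (X.K * 15 + 15) (fun B =>
      (∀ r < 30, B.reg r = A.reg r) ∧ B.mem = A.mem ∧ B.ch = { A.ch with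
        outMsg := A.ch.outMsg ++ tabMsg X (A.mem 5) 0
        encCalls := A.ch.encCalls + X.K }) := by
  have hcw : X.K < 2 ^ X.w := hX.le_w (by
    have := Nat.two_pow_pos L
    rw [hX.K]
    omega)
  refine ((Sat.blk (Q := fun B => Frame 30 A B ∧ B.mem = A.mem ∧ B.reg 36 = 0 ∧
    B.reg 37 = X.K) (by simp) ⟨Frame.evalL (by simp), by simp [evalL]⟩).seq
    fun B hB => Sat.loop (cnt := X.K) (fun j B => (∀ r < 30, B.reg r = A.reg r) ∧
      B.mem = A.mem ∧ B.reg 36 = j * X.n ∧ B.reg 37 = X.K ∧ ∃ out,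
      out ++ tabMsg X (A.mem 5) j = A.ch.outMsg ++ tabMsg X (A.mem 5) 0 ∧ B.ch = { A.ch with
        outMsg := out
        encCalls := A.ch.encCalls + j })
    (fun _ => 7) (by norm_num) (by norm_num) (by norm_num) hcw ?_ ?_ ?_ ?_).mono ?_ ?_
  · rintro j B B' ⟨h1, h2, h3, h4, h5⟩ hr hm hc
    exact ⟨fun r hr' => (hr r (by omega) (by omega)).trans (h1 r hr'), hm.trans h2,
      (hr 36 (by norm_num) (by norm_num)).trans h3, (hr 37 (by norm_num) (by norm_num)).trans h4,
      by rwa [hc]⟩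
  · rintro j B ⟨h1, -, -, h4, -⟩
    exact ⟨h4, (h1 12 (by norm_num)).trans hA.r12⟩
  · obtain ⟨h1, h2, h3, h4⟩ := hB
    exact ⟨h1.reg, h2, by simp [h3], h4, A.ch.outMsg, rfl, by simp [h1.ch]⟩
  · rintro j hj B ⟨h1, h2, h3, h4, out, h5, h6⟩ h40
    have hcol := tab_col hX hj
    have b16 := (h1 16 (by norm_num)).trans hA.r16
    refine ((encP_sat hℓ ?_ ?_).seq (c' := 4) fun C hC => Sat.blk (by simp) ?_).mono (by norm_num)
      fun _ h => h
    · simp [h1, hA.r10, hA.r16, h3, hX.row' (show 5 < 16 by norm_num)]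
      omega
    · rw [h3]
      exact hcol.le
    · obtain ⟨c1, c2, c3⟩ := hC
      refine ⟨⟨?_, ?_, ?_, ?_, out ++ redundancyBits (X.code.enc (wordAt X.n X.ℓ (A.mem 5) (j * X.n))),
        ?_, ?_⟩, ?_⟩
      · intro r hr
        rw [← h1 r hr, ← c1]
        exact evalL_reg _ (b := 30) (by simp) hr
      · simp [evalL, c2, h2]
      · simp [evalL, c1, h3, h1, hA.r1]
        ring
      · simp [evalL, c1, h4]
      · rw [List.append_assoc, ← tabMsg_eq _ hj, h5]
      · simp [c3, h2, h3, h6, b16]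
        omega
      · simp [evalL, c1, h40]
  · simp
    omega
  · rintro B ⟨h1, h2, -, -, out, h5, h6⟩
    refine ⟨h1, h2, ?_⟩
    rw [tabMsg_last, List.append_nil] at h5
    rw [h6, h5]

lemma decTab_sat (hX : Size X L m) (hA : Env X L m s len A) (hℓ : X.ℓ ≤ X.w) {F : ℕ → ℕ}
    {rest : List Bool} (hin : A.ch.inMsg = tabMsg X F 0 ++ rest)
    (hd : ∀ j < X.K, hammingDist (wordAt X.n X.ℓ F (j * X.n))
      (wordAt X.n X.ℓ (A.mem 5) (j * X.n)) ≤ X.k)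
    (hF : ∀ i < X.K * X.n, F i < 2 ^ X.ℓ) :
    Sat X (tabP X.K (decP 16 36)) A (X.K * 15 + 15) (fun B =>
      (∀ r < 30, B.reg r = A.reg r) ∧ (∀ i < X.K * X.n, B.mem 5 i = F i) ∧
        B.ch = { A.ch with
        inMsg := rest
        decCalls := A.ch.decCalls + X.K }) := by
  have hcw : X.K < 2 ^ X.w := hX.le_w (by
    have := Nat.two_pow_pos L
    rw [hX.K]
    omega)
  refine ((Sat.blk (Q := fun B => Frame 30 A B ∧ B.mem = A.mem ∧ B.reg 36 = 0 ∧
    B.reg 37 = X.K) (by simp) ⟨Frame.evalL (by simp), by simp [evalL]⟩).seq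
    fun B hB => Sat.loop (cnt := X.K) (fun j B => (∀ r < 30, B.reg r = A.reg r) ∧
      (∀ i, B.mem 5 i = if i < j * X.n then F i else A.mem 5 i) ∧
      B.reg 36 = j * X.n ∧ B.reg 37 = X.K ∧ B.ch = { A.ch with
        inMsg := tabMsg X F j ++ rest
        decCalls := A.ch.decCalls + j })
    (fun _ => 7) (by norm_num) (by norm_num) (by norm_num) hcw ?_ ?_ ?_ ?_).mono ?_ ?_
  · rintro j B B' ⟨h1, h2, h3, h4, h5⟩ hr hm hc
    exact ⟨fun r hr' => (hr r (by omega) (by omega)).trans (h1 r hr'), by rwa [hm],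
      (hr 36 (by norm_num) (by norm_num)).trans h3, (hr 37 (by norm_num) (by norm_num)).trans h4,
      by rwa [hc]⟩
  · rintro j B ⟨h1, -, -, h4, -⟩
    exact ⟨h4, (h1 12 (by norm_num)).trans hA.r12⟩
  · obtain ⟨h1, h2, h3, h4⟩ := hB
    exact ⟨h1.reg, by simp [h2], by simp [h3], h4, by simp [h1.ch, ← hin]⟩
  · rintro j hj B ⟨h1, h2, h3, h4, h6⟩ h40
    have hcol := tab_col hX hj
    have b16 := (h1 16 (by norm_num)).trans hA.r16
    have hle : (j + 1) * X.n ≤ X.K * X.n := Nat.mul_le_mul_right _ hj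
    rw [add_mul, one_mul] at hle
    refine ((decP_sat (F := F) (rest := tabMsg X F (j + 1) ++ rest) hℓ ?_ ?_ ?_ ?_ ?_).seq
      (c' := 4) fun C hC => Sat.blk (by simp) ?_).mono (by norm_num)
      fun _ h => h
    · simp [h1, hA.r10, hA.r16, h3, hX.row' (show 5 < 16 by norm_num)]
      omega
    · rw [h3]
      exact hcol.le
    · simp [h6, tabMsg_eq F hj, h3]
    · rw [h3, b16]
      convert hd j hj using 2
      funext i
      simp [wordAt, h2]
    · intro i hi
      rw [h3]
      exact hF _ (by omega)
    · obtain ⟨c1, c2, c3⟩ := hC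
      refine ⟨⟨?_, ?_, ?_, ?_, ?_⟩, ?_⟩
      · intro r hr
        rw [← h1 r hr, ← c1]
        exact evalL_reg _ (b := 30) (by simp) hr
      · intro i
        simp only [evalL, Cmd.eval, Abs.set_mem, c2, b16, h3, h2, add_mul, one_mul]
        by_cases hi : j * X.n ≤ i ∧ i < j * X.n + X.n
        · rw [if_pos ⟨trivial, hi⟩, if_pos (by omega)]
        · rw [if_neg fun h => hi h.2]
          split_ifs <;> first | rfl | omega
      · simp [evalL, c1, h3, h1, hA.r1]
        ring
      · simp [evalL, c1, h4]
      · simp [c3, h6]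
        omega
      · simp [evalL, c1, h40]
  · simp
    omega
  · rintro B ⟨h1, h2, -, -, h6⟩
    refine ⟨h1, fun i hi => by rw [h2 i, if_pos hi], ?_⟩
    rw [h6, tabMsg_last, List.nil_append]

end

/-! ### Independence of the hash function -/

lemma mod_pow_eq_of_digits {B : ℕ} (a b n : ℕ) (h : ∀ j < n, a / B ^ j % B = b / B ^ j % B) :
    a % B ^ n = b % B ^ n := by
  induction n with
  | zero => simp [Nat.mod_one]
  | succ n ih =>
    rw [Nat.mod_pow_succ, Nat.mod_pow_succ, ih fun j hj => h j (by omega), h n (by omega)]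

/-- The difference of two places is divisible by few powers of two, so that every multiple of
`2 ^ (7 * L)` can be attained at one of `8` places by a polynomial that vanishes at the others. -/
lemma exists_mul_prod_eq {L r : ℕ} (hr : 7 * L ≤ r) (S : Finset ℕ) (hS : S.card ≤ 7) {x : ℕ}
    (hx : x < 2 ^ L) (hSL : ∀ y ∈ S, y < 2 ^ L) (hxS : x ∉ S) :
    ∃ t : ZMod (2 ^ (8 * L)), t * ∏ y ∈ S, ((x : ZMod (2 ^ (8 * L))) - y) = 2 ^ r := by
  set D : ℤ := ∏ y ∈ S, ((x : ℤ) - y) with hD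
  have hD0 : D ≠ 0 := by
    refine Finset.prod_ne_zero_iff.2 fun y hy h => hxS ?_
    have : x = y := by omega
    rwa [this]
  have hDle : D.natAbs ≤ 2 ^ (7 * L) := by
    calc D.natAbs = ∏ y ∈ S, ((x : ℤ) - y).natAbs := map_prod Int.natAbsHom _ _
      _ ≤ ∏ _y ∈ S, 2 ^ L := Finset.prod_le_prod' fun y hy => by
          have := hSL y hy
          omega
      _ = 2 ^ (L * S.card) := by rw [Finset.prod_const, pow_mul]
      _ ≤ 2 ^ (7 * L) := Nat.pow_le_pow_right (by norm_num) (by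
          rw [mul_comm]
          exact Nat.mul_le_mul_right _ hS)
  have hg : (Int.gcd D (2 ^ (8 * L) : ℕ)) ∣ 2 ^ r := by
    have h1 : Int.gcd D (2 ^ (8 * L) : ℕ) ∣ 2 ^ (8 * L) := by
      exact_mod_cast Int.gcd_dvd_right D ((2 ^ (8 * L) : ℕ) : ℤ)
    obtain ⟨i, -, hi⟩ := (Nat.dvd_prime_pow Nat.prime_two).1 h1
    rw [hi]
    refine pow_dvd_pow 2 ?_
    have h2 : Int.gcd D (2 ^ (8 * L) : ℕ) ≤ D.natAbs :=
      Nat.le_of_dvd (Int.natAbs_pos.2 hD0) (by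
        have := Int.gcd_dvd_left D ((2 ^ (8 * L) : ℕ) : ℤ)
        exact Int.natCast_dvd.1 this)
    rw [hi] at h2
    have := (Nat.pow_le_pow_iff_right (show 1 < 2 by norm_num)).1 (h2.trans hDle)
    omega
  obtain ⟨q, hq⟩ := hg
  have hb := Int.gcd_eq_gcd_ab D ((2 ^ (8 * L) : ℕ) : ℤ)
  refine ⟨(Int.gcdA D ((2 ^ (8 * L) : ℕ) : ℤ) : ZMod (2 ^ (8 * L))) * q, ?_⟩
  have e : ∏ y ∈ S, ((x : ZMod (2 ^ (8 * L))) - y) = (D : ZMod (2 ^ (8 * L))) := by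
    rw [hD]
    push_cast
    rfl
  have h3 := congrArg (Int.cast : ℤ → ZMod (2 ^ (8 * L))) hb
  rw [Int.cast_add, Int.cast_mul, Int.cast_mul, Int.cast_natCast, Int.cast_natCast,
    ZMod.natCast_self, zero_mul, add_zero] at h3
  have h4 := congrArg (Nat.cast : ℕ → ZMod (2 ^ (8 * L))) hq
  rw [Nat.cast_mul, h3] at h4
  rw [e]
  rw [Nat.cast_pow, Nat.cast_ofNat] at h4
  rw [h4]
  ring

/-- Translations of the coefficient vector realize all shifts of the hash values of `8` places. -/
lemma exists_shift {L r : ℕ} (hr : 7 * L ≤ r) (T : Finset ℕ) (hT : T.card = 8)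
    (hTL : ∀ x ∈ T, x < 2 ^ L) (v : ℕ → ℕ) :
    ∃ g : Fin 8 → ZMod (2 ^ (8 * L)), ∀ x ∈ T, ∑ j, g j * (x : ZMod (2 ^ (8 * L))) ^ (j : ℕ) =
      v x * 2 ^ r := by
  choose! t ht using fun (x : ℕ) (hx : x ∈ T) => exists_mul_prod_eq hr (T.erase x)
    (by rw [Finset.card_erase_of_mem hx, hT]) (hTL x hx)
    (fun y hy => hTL y (Finset.mem_of_mem_erase hy)) (Finset.notMem_erase x T)
  let Q : Polynomial (ZMod (2 ^ (8 * L))) := ∑ x ∈ T, Polynomial.C (v x * t x) *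
    ∏ y ∈ T.erase x, (Polynomial.X - Polynomial.C (y : ZMod (2 ^ (8 * L))))
  have hdeg : Q.natDegree < 8 := by
    refine Nat.lt_succ_of_le (Polynomial.natDegree_sum_le_of_forall_le _ _ fun x hx => ?_)
    refine (Polynomial.natDegree_C_mul_le _ _).trans ((Polynomial.natDegree_prod_le _ _).trans ?_)
    refine (Finset.sum_le_card_nsmul _ _ 1 fun y _ => Polynomial.natDegree_X_sub_C_le _).trans ?_
    simp [Finset.card_erase_of_mem hx, hT]
  refine ⟨fun j => Q.coeff j, fun x hx => ?_⟩
  rw [Fin.sum_univ_eq_sum_range (fun j => Q.coeff j * (x : ZMod (2 ^ (8 * L))) ^ j) 8,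
    ← Polynomial.eval_eq_sum_range' hdeg, Polynomial.eval_finsetSum,
    Finset.sum_eq_single_of_mem x hx]
  · rw [Polynomial.eval_mul, Polynomial.eval_C, Polynomial.eval_prod, mul_assoc, ← ht x hx]
    simp
  · intro y hy hyx
    rw [Polynomial.eval_mul, Polynomial.eval_prod,
      Finset.prod_eq_zero (Finset.mem_erase.2 ⟨hyx.symm, hx⟩) (by simp), mul_zero]

/-- The number of seeds whose hash function is constant on `8` given places. -/
lemma card_const_le {L m w : ℕ} (hm : m ≤ L) (hw : 64 * L ≤ w) (T : Finset ℕ) (hT : T.card = 8)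
    (hTL : ∀ x ∈ T, x < 2 ^ L) :
    (Finset.univ.filter fun s : Fin (2 ^ w) =>
      ∀ x ∈ T, ∀ y ∈ T, hsh L m s x = hsh L m s y).card * (2 ^ m) ^ 7 ≤ 2 ^ w := by
  have : NeZero (2 ^ (8 * L)) := ⟨(Nat.two_pow_pos _).ne'⟩
  set B := 2 ^ (8 * L) with hB
  set r := 8 * L - m with hr
  have hBr : B = 2 ^ r * 2 ^ m := by rw [hB, ← pow_add]; congr 1; omega
  obtain ⟨x₀, hx₀⟩ : T.Nonempty := Finset.card_pos.1 (by omega)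
  choose g hg using exists_shift (L := L) (r := r) (by omega) T hT hTL
  let V := {x // x ∈ T.erase x₀} → Fin (2 ^ m)
  -- extend a vector of shifts by the shift `0` of the place `x₀`
  let ext : V → ℕ → ℕ := fun v x => if h : x ∈ T.erase x₀ then v ⟨x, h⟩ else 0
  have hext : ∀ v x, ext v x < 2 ^ m := fun v x => by
    simp only [ext]
    split_ifs
    · exact (v _).isLt
    · exact Nat.two_pow_pos _
  have hW : B ^ 8 * 2 ^ (w - 64 * L) = 2 ^ w := by
    rw [hB, ← pow_mul, ← pow_add]
    congr 1
    omega
  let co : Fin (2 ^ w) → (Fin 8 → ZMod B) := fun s j => ((s : ℕ) / 2 ^ (8 * L * j) : ℕ)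
  have hhash : ∀ (s : Fin (2 ^ w)) (x : ℕ),
      hsh L m s x = (∑ j, co s j * (x : ZMod B) ^ (j : ℕ)).val / 2 ^ r := by
    intro s x
    have : (∑ j, co s j * (x : ZMod B) ^ (j : ℕ)) = ((polyVal L s x : ℕ) : ZMod B) := by
      rw [polyVal, ← Fin.sum_univ_eq_sum_range (fun j => (s : ℕ) / 2 ^ (8 * L * j) * x ^ j)]
      push_cast
      rfl
    rw [this, ZMod.val_natCast, hsh]
  have hdiv : ∀ z, z % B / 2 ^ r = z / 2 ^ r % 2 ^ m := fun z => by
    rw [hBr, Nat.mod_mul_right_div_self]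
  have hshift : ∀ (y : ZMod B) (t : ℕ), (y + t * 2 ^ r).val / 2 ^ r = (y.val / 2 ^ r + t) % 2 ^ m := by
    intro y t
    have : y + t * 2 ^ r = ((y.val + t * 2 ^ r : ℕ) : ZMod B) := by
      push_cast
      rw [ZMod.natCast_zmod_val]
    rw [this, ZMod.val_natCast, hdiv, Nat.add_mul_div_right _ _ (Nat.two_pow_pos r)]
  let G := {s : Fin (2 ^ w) // ∀ x ∈ T, ∀ y ∈ T, hsh L m s x = hsh L m s y}
  let Φ : G × V → Fin (2 ^ (w - 64 * L)) × (Fin 8 → ZMod B) := fun a =>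
    (⟨(a.1.1 : ℕ) / B ^ 8, by
      rw [Nat.div_lt_iff_lt_mul (by positivity), mul_comm, hW]
      exact a.1.1.isLt⟩, fun j => co a.1.1 j + g (ext a.2) j)
  have hΦ : Function.Injective Φ := by
    rintro ⟨⟨s, hs⟩, v⟩ ⟨⟨s', hs'⟩, v'⟩ h
    simp only [Φ, Prod.mk.injEq, Fin.mk.injEq] at h
    obtain ⟨h1, h2⟩ := h
    have key : ∀ x ∈ T, (hsh L m s x + ext v x) % 2 ^ m = (hsh L m s' x + ext v' x) % 2 ^ m := by
      intro x hx
      rw [hhash, hhash, ← hshift, ← hshift, ← hg _ x hx, ← hg _ x hx, ← Finset.sum_add_distrib,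
        ← Finset.sum_add_distrib]
      simp only [← add_mul]
      have := fun j => congrFun h2 j
      simp only [this]
    have h0 : ∀ v, ext v x₀ = 0 := fun v => by simp [ext]
    have hx0 := key x₀ hx₀
    rw [h0, h0, add_zero, add_zero] at hx0
    have hv : ∀ x ∈ T, ext v x = ext v' x := by
      intro x hx
      have hk := key x hx
      rw [hs x hx x₀ hx₀, hs' x hx x₀ hx₀] at hk
      have : ext v x ≡ ext v' x [MOD 2 ^ m] :=
        Nat.ModEq.add_left_cancel hx0 hk
      exact this.eq_of_lt_of_lt (hext v x) (hext v' x)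
    have hvv : v = v' := by
      funext ⟨x, hx⟩
      have := hv x (Finset.mem_of_mem_erase hx)
      simp only [ext, dif_pos hx] at this
      exact Fin.ext this
    subst hvv
    have hss : s = s' := by
      apply Fin.ext
      rw [← Nat.div_add_mod (s : ℕ) (B ^ 8), ← Nat.div_add_mod (s' : ℕ) (B ^ 8), h1]
      congr 1
      refine mod_pow_eq_of_digits _ _ _ fun j hj => ?_
      have := congrFun h2 ⟨j, hj⟩
      have := add_right_cancel this
      simp only [co] at this
      rw [ZMod.natCast_eq_natCast_iff'] at this
      rwa [pow_mul] at this
    subst hss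
    rfl
  have := Fintype.card_le_of_injective Φ hΦ
  rw [Fintype.card_prod, Fintype.card_prod, Fintype.card_fin, Fintype.card_fun, Fintype.card_fun,
    ZMod.card, Fintype.card_fin, Fintype.card_fin, mul_comm (2 ^ _), hW, Fintype.card_coe,
    Finset.card_erase_of_mem hx₀, hT, Fintype.card_subtype] at this
  exact this

/-! ### Most seeds are good -/

/-- Eighth powers are controlled by the number of sets of `8` elements. -/
lemma pow_eight_le (b : ℕ) : b ^ 8 ≤ 8 ^ 8 * (1 + b.choose 8) := by
  rcases lt_or_ge b 8 with hb | hb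
  · calc b ^ 8 ≤ 8 ^ 8 := Nat.pow_le_pow_left hb.le 8
      _ ≤ _ := Nat.le_mul_of_pos_right _ (by omega)
  · have h1 : b ^ 8 * Nat.factorial 8 ≤ 8 ^ 8 * b.descFactorial 8 := by
      have e1 : Nat.factorial 8 = ∏ i ∈ Finset.range 8, (8 - i) := by decide
      have e2 : ∀ a : ℕ, a ^ 8 = ∏ _i ∈ Finset.range 8, a := fun a => by simp
      rw [e1, Nat.descFactorial_eq_prod_range, e2 b, e2 8, ← Finset.prod_mul_distrib,
        ← Finset.prod_mul_distrib]
      refine Finset.prod_le_prod' fun i hi => ?_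
      rw [Finset.mem_range] at hi
      obtain ⟨c, rfl⟩ := Nat.exists_eq_add_of_le hb
      interval_cases i <;> omega
    rw [Nat.descFactorial_eq_factorial_mul_choose, ← mul_assoc, mul_comm (8 ^ 8), mul_assoc,
      mul_comm (b ^ 8)] at h1
    have := Nat.le_of_mul_le_mul_left h1 (Nat.factorial_pos 8)
    exact this.trans (Nat.mul_le_mul_left _ (by omega))

section

variable {L m w : ℕ} {Z : List ℕ}

/-- The positions of the keys. -/
def positions (L : ℕ) (Z : List ℕ) : Finset ℕ := (Z.map (· % 2 ^ L)).toFinset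

lemma card_positions (hZ : (Z.map (· % 2 ^ L)).Nodup) : (positions L Z).card = Z.length := by
  rw [positions, List.toFinset_card_of_nodup hZ, List.length_map]

lemma length_bucket (hZ : (Z.map (· % 2 ^ L)).Nodup) (s i : ℕ) :
    (bucket L m s Z i).length = ((positions L Z).filter fun x => hsh L m s x = i).card := by
  have : (positions L Z).filter (fun x => hsh L m s x = i) =
      ((bucket L m s Z i).map (· % 2 ^ L)).toFinset := by
    ext x
    simp only [positions, bucket, Finset.mem_filter, List.mem_toFinset, List.mem_map,
      List.mem_filter, decide_eq_true_eq]
    constructor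
    · rintro ⟨⟨z, hz, rfl⟩, h⟩
      exact ⟨z, ⟨hz, h⟩, rfl⟩
    · rintro ⟨z, ⟨hz, h⟩, rfl⟩
      exact ⟨⟨z, hz, rfl⟩, h⟩
  have hnd : ((bucket L m s Z i).map (· % 2 ^ L)).Nodup :=
    hZ.sublist (List.filter_sublist.map _)
  rw [this, List.toFinset_card_of_nodup hnd, List.length_map]

lemma sum_choose_le (hZ : (Z.map (· % 2 ^ L)).Nodup) (s : ℕ) :
    ∑ i ∈ Finset.range (2 ^ m), (bucket L m s Z i).length.choose 8 ≤
      ∑ T ∈ (positions L Z).powersetCard 8,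
        if ∀ x ∈ T, ∀ y ∈ T, hsh L m s x = hsh L m s y then 1 else 0 := by
  calc ∑ i ∈ Finset.range (2 ^ m), (bucket L m s Z i).length.choose 8
      ≤ ∑ i ∈ Finset.range (2 ^ m), ∑ T ∈ (positions L Z).powersetCard 8,
          if ∀ x ∈ T, hsh L m s x = i then 1 else 0 := by
        refine Finset.sum_le_sum fun i _ => ?_
        rw [length_bucket hZ, ← Finset.card_powersetCard, Finset.sum_boole, Nat.cast_id]
        refine Finset.card_le_card fun T hT => ?_
        rw [Finset.mem_powersetCard] at hT
        rw [Finset.mem_filter, Finset.mem_powersetCard]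
        exact ⟨⟨hT.1.trans (Finset.filter_subset _ _), hT.2⟩, fun x hx =>
          (Finset.mem_filter.1 (hT.1 hx)).2⟩
    _ ≤ _ := by
        rw [Finset.sum_comm]
        refine Finset.sum_le_sum fun T hT => ?_
        obtain ⟨x, hx⟩ : T.Nonempty := Finset.card_pos.1 (by
          rw [(Finset.mem_powersetCard.1 hT).2]
          norm_num)
        rw [Finset.sum_boole, Nat.cast_id]
        split_ifs with h
        · refine Finset.card_le_one.2 fun i hi j hj => ?_
          exact ((Finset.mem_filter.1 hi).2 x hx).symm.trans ((Finset.mem_filter.1 hj).2 x hx)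
        · rw [Nat.le_zero, Finset.card_eq_zero, Finset.filter_eq_empty_iff]
          exact fun i _ hi => h fun x hx y hy => (hi x hx).trans (hi y hy).symm

/-- The seeds for which the sender has to draw again. -/
def badSeeds (L m w : ℕ) (Z : List ℕ) : Finset (Fin (2 ^ w)) :=
  Finset.univ.filter fun s => seedBound * Z.length < load L m s Z

/-- The eighth moments of the bucket sizes are bounded on average. -/
lemma two_mul_card_badSeeds_le (hm : m ≤ L) (hw : 64 * L ≤ w) (hZ : (Z.map (· % 2 ^ L)).Nodup)
    (h1 : 2 ^ m ≤ Z.length) (h2 : Z.length ≤ 2 * 2 ^ m) :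
    2 * (badSeeds L m w Z).card ≤ 2 ^ w := by
  set n := Z.length with hn
  set E : Fin (2 ^ w) → ℕ := fun s =>
    ∑ i ∈ Finset.range (2 ^ m), (bucket L m s Z i).length.choose 8 with hE
  have hmom : (∑ s, E s) * (2 ^ m) ^ 7 ≤ n.choose 8 * 2 ^ w := by
    calc (∑ s, E s) * (2 ^ m) ^ 7
        ≤ (∑ s : Fin (2 ^ w), ∑ T ∈ (positions L Z).powersetCard 8,
          if ∀ x ∈ T, ∀ y ∈ T, hsh L m s x = hsh L m s y then 1 else 0) * (2 ^ m) ^ 7 :=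
          Nat.mul_le_mul_right _ (Finset.sum_le_sum fun s _ => sum_choose_le hZ s)
      _ = ∑ T ∈ (positions L Z).powersetCard 8, (Finset.univ.filter fun s : Fin (2 ^ w) =>
          ∀ x ∈ T, ∀ y ∈ T, hsh L m s x = hsh L m s y).card * (2 ^ m) ^ 7 := by
          rw [Finset.sum_comm, Finset.sum_mul]
          simp only [Finset.sum_boole, Nat.cast_id]
      _ ≤ ∑ T ∈ (positions L Z).powersetCard 8, 2 ^ w := by
          refine Finset.sum_le_sum fun T hT => ?_
          rw [Finset.mem_powersetCard] at hT
          refine card_const_le hm hw T hT.2 fun x hx => ?_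
          have := hT.1 hx
          rw [positions, List.mem_toFinset, List.mem_map] at this
          obtain ⟨z, -, rfl⟩ := this
          exact Nat.mod_lt _ (Nat.two_pow_pos _)
      _ = n.choose 8 * 2 ^ w := by
          rw [Finset.sum_const, Finset.card_powersetCard, card_positions hZ, smul_eq_mul]
  have hch : n.choose 8 * Nat.factorial 8 ≤ n ^ 8 := by
    rw [mul_comm, ← Nat.descFactorial_eq_factorial_mul_choose]
    exact Nat.descFactorial_le_pow n 8
  have hsum : (∑ s, E s) * Nat.factorial 8 ≤ 128 * n * 2 ^ w := by
    refine Nat.le_of_mul_le_mul_right (c := (2 ^ m) ^ 7) ?_ (by positivity)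
    calc (∑ s, E s) * Nat.factorial 8 * (2 ^ m) ^ 7
        = (∑ s, E s) * (2 ^ m) ^ 7 * Nat.factorial 8 := by ring
      _ ≤ n.choose 8 * 2 ^ w * Nat.factorial 8 := Nat.mul_le_mul_right _ hmom
      _ = n.choose 8 * Nat.factorial 8 * 2 ^ w := by ring
      _ ≤ n ^ 8 * 2 ^ w := Nat.mul_le_mul_right _ hch
      _ = n * n ^ 7 * 2 ^ w := by ring
      _ ≤ n * (2 * 2 ^ m) ^ 7 * 2 ^ w :=
          Nat.mul_le_mul_right _ (Nat.mul_le_mul_left _ (Nat.pow_le_pow_left h2 7))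
      _ = 128 * n * 2 ^ w * (2 ^ m) ^ 7 := by ring
  have hbad : ∀ s ∈ badSeeds L m w Z, 2 * n ≤ E s := by
    intro s hs
    have hs := (Finset.mem_filter.1 hs).2
    have hl : load L m s Z ≤ 8 ^ 8 * (2 ^ m + E s) := by
      calc load L m s Z ≤ ∑ i ∈ Finset.range (2 ^ m),
            8 ^ 8 * (1 + (bucket L m s Z i).length.choose 8) :=
            Finset.sum_le_sum fun i _ => pow_eight_le _
        _ = _ := by rw [← Finset.mul_sum, Finset.sum_add_distrib]; simp [E]
    have := hs.trans_le hl
    rw [seedBound] at this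
    omega
  have hmark : (badSeeds L m w Z).card * (2 * n) ≤ ∑ s, E s := by
    rw [← smul_eq_mul]
    exact (Finset.card_nsmul_le_sum _ _ _ hbad).trans
      (Finset.sum_le_sum_of_subset (Finset.subset_univ _))
  have hn0 : 0 < n := (Nat.two_pow_pos m).trans_le h1
  have h8 : Nat.factorial 8 = 40320 := rfl
  rw [h8] at hsum
  refine Nat.le_of_mul_le_mul_left (c := 128 * n) ?_ (by omega)
  calc 128 * n * (2 * (badSeeds L m w Z).card) = (badSeeds L m w Z).card * (2 * n) * 128 := by ring
    _ ≤ (∑ s, E s) * 128 := Nat.mul_le_mul_right _ hmark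
    _ ≤ (∑ s, E s) * 40320 := Nat.mul_le_mul_left _ (by norm_num)
    _ ≤ _ := hsum

end

/-! ### The number of rounds -/

/-- The first `R` random words are all in `B`. -/
def allIn {w : ℕ} (B : Finset (Fin (2 ^ w))) (R : ℕ) : Set (ℕ → Fin (2 ^ w)) :=
  Set.pi (Finset.range R) fun _ => B

lemma tapeLaw_allIn_le {w : ℕ} {B : Finset (Fin (2 ^ w))} (hB : 2 * B.card ≤ 2 ^ w) (R : ℕ) :
    tapeLaw w (allIn B R) ≤ 2⁻¹ ^ R := by
  have h1 : (PMF.uniformOfFintype (Fin (2 ^ w))).toMeasure B ≤ 2⁻¹ := by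
    rw [PMF.toMeasure_uniformOfFintype_apply _ (Set.toFinite _).measurableSet]
    simp only [Finset.coe_sort_coe, Fintype.card_coe]
    rw [Fintype.card_fin, ENNReal.div_le_iff (by simp) (by simp),
      ← ENNReal.div_eq_inv_mul, ENNReal.le_div_iff_mul_le (by simp) (by simp), mul_comm]
    exact_mod_cast hB
  rw [tapeLaw, allIn, Measure.infinitePi_pi _ fun _ _ => (Set.toFinite _).measurableSet,
    Finset.prod_const, Finset.card_range]
  exact pow_le_pow_left' h1 R

/-- If the running time is proportional to the number of rounds until the first word outside `B`,
and `B` contains at most half of all words, then the expected running time is bounded. -/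
lemma lintegral_le_of_rounds {w : ℕ} {B : Finset (Fin (2 ^ w))} (hB : 2 * B.card ≤ 2 ^ w)
    (f : (ℕ → Fin (2 ^ w)) → ℝ≥0∞) (a b : ℕ) (ha : 0 < a)
    (hf : ∀ tape : ℕ → Fin (2 ^ w), ∀ g, tape g ∉ B → (∀ r < g, tape r ∈ B) →
      f tape ≤ (a * (g + 1) + b : ℕ)) :
    ∫⁻ tape, f tape ∂tapeLaw w ≤ (2 * a + b : ℕ) := by
  have hmeas : ∀ R, MeasurableSet (allIn B R) := fun R =>
    MeasurableSet.pi (Finset.countable_toSet _) fun _ _ => (Set.toFinite _).measurableSet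
  have hle : ∀ tape, f tape ≤ a * ∑' R, (allIn B R).indicator 1 tape + b := by
    intro tape
    by_cases hex : ∃ g, tape g ∉ B
    · classical
      refine (hf tape (Nat.find hex) (Nat.find_spec hex) fun r hr => ?_).trans ?_
      · exact not_not.1 (Nat.find_min hex hr)
      · push_cast
        gcongr
        refine le_trans ?_ (ENNReal.sum_le_tsum (Finset.range (Nat.find hex + 1)))
        rw [Finset.sum_congr rfl (g := fun _ => 1)]
        · simp
        · intro R hR
          rw [Set.indicator_of_mem]
          · rfl
          · intro r hr
            simp only [Finset.coe_range, Set.mem_Iio] at hr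
            rw [Finset.mem_range] at hR
            exact not_not.1 (Nat.find_min hex (by omega : r < Nat.find hex))
    · push Not at hex
      have : ∑' R, (allIn B R).indicator (1 : (ℕ → Fin (2 ^ w)) → ℝ≥0∞) tape = ⊤ := by
        rw [tsum_congr (g := fun _ => 1)]
        · exact ENNReal.tsum_const_eq_top_of_ne_zero one_ne_zero
        · intro R
          rw [Set.indicator_of_mem]
          · rfl
          · exact fun r _ => hex r
      rw [this, ENNReal.mul_top (by exact_mod_cast ha.ne'), top_add]
      exact le_top
  calc ∫⁻ tape, f tape ∂tapeLaw w
      ≤ ∫⁻ tape, (a * ∑' R, (allIn B R).indicator 1 tape + b) ∂tapeLaw w := lintegral_mono hle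
    _ = a * ∑' R, tapeLaw w (allIn B R) + b := by
        have : IsProbabilityMeasure (tapeLaw w) := by unfold tapeLaw; infer_instance
        rw [lintegral_add_right _ measurable_const, lintegral_const_mul', lintegral_tsum]
        · simp [lintegral_indicator_one (hmeas _)]
        · exact fun R => (measurable_one.indicator (hmeas R)).aemeasurable
        · exact ENNReal.natCast_ne_top a
    _ ≤ a * ∑' R, 2⁻¹ ^ R + b := by
        gcongr with R
        exact tapeLaw_allIn_le hB R
    _ = (2 * a + b : ℕ) := by
        rw [ENNReal.tsum_geometric, ENNReal.one_sub_inv_two, inv_inv]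
        push_cast
        ring

/-! ### The rows that the sender transmits -/

lemma polyVal_mod (L s x : ℕ) :
    polyVal L (s % 2 ^ (64 * L)) x % 2 ^ (8 * L) = polyVal L s x % 2 ^ (8 * L) := by
  rw [polyVal, polyVal, Finset.sum_nat_mod,
    Finset.sum_nat_mod _ _ fun j => s / 2 ^ (8 * L * j) * x ^ j]
  congr 1
  refine Finset.sum_congr rfl fun j hj => ?_
  rw [Finset.mem_range] at hj
  have : s % 2 ^ (64 * L) / 2 ^ (8 * L * j) % 2 ^ (8 * L) =
      s / 2 ^ (8 * L * j) % 2 ^ (8 * L) := by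
    obtain ⟨d, hd⟩ : ∃ d, 64 * L = 8 * L * j + 8 * L + d := by
      have := Nat.mul_le_mul_left (8 * L) (show j + 1 ≤ 8 by omega)
      exact ⟨64 * L - (8 * L * j + 8 * L), by rw [mul_add] at this; omega⟩
    rw [hd, add_assoc, pow_add, Nat.mod_mul_right_div_self, pow_add, Nat.mod_mul_right_mod]
  rw [Nat.mul_mod, this, ← Nat.mul_mod]

lemma hsh_mod (L m s x : ℕ) : hsh L m (s % 2 ^ (64 * L)) x = hsh L m s x := by
  rw [hsh, hsh, polyVal_mod]

lemma bucket_mod (L m s : ℕ) : bucket L m (s % 2 ^ (64 * L)) = bucket L m s := by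
  funext Z i
  simp only [bucket, hsh_mod]

/-- The masks only contain bits of the position, so that two keys with the same position have the same
slot. -/
lemma slot_mod {M p L x : ℕ} (hM : M < 2 ^ L) : slot M p (x % 2 ^ L) = slot M p x := by
  rw [slot, slot]
  congr 1
  induction M using Nat.strong_induction_on with
  | _ M ih =>
    by_cases h0 : M = 0
    · rw [h0, compress_zero, compress_zero]
    · rw [compress_of_ne h0, compress_of_ne h0]
      obtain ⟨v, h1, -, h3⟩ := exists_lowest_bit h0
      have hv : v < L := by
        by_contra hv
        rw [Nat.testBit_lt_two_pow (hM.trans_le (Nat.pow_le_pow_right (by norm_num)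
          (not_lt.1 hv)))] at h1
        exact absurd h1 (by simp)
      rw [ih _ (clr_lt h0) ((clr_lt h0).trans hM)]
      simp only [and_low_ne_zero h1 h3, Nat.testBit_mod_two_pow, hv, decide_true, Bool.true_and]

section

variable (L m s : ℕ) (Z : List ℕ)

/-- The bucket sizes. -/
def cntRow (i : ℕ) : ℕ := if i < 2 ^ m then (bucket L m s Z i).length else 0

/-- The masks of the buckets. -/
def mskRow (i : ℕ) : ℕ := if i < 2 ^ m then mask (bucket L m s Z i) else 0

/-- The moduli of the buckets. -/
noncomputable def prmRow (i : ℕ) : ℕ := if i < 2 ^ m then modulus (bucket L m s Z i) else 0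

/-- The table that a player with the keys `Z` makes from given rows. -/
def table (b M p : ℕ → ℕ) : ℕ → ℕ :=
  writeAll (fun _ => 0) ((List.range (2 ^ m)).flatMap (writes L m s Z b M p))

/-- The table of the sender. -/
noncomputable def tabRow : ℕ → ℕ :=
  table L m s Z (cntRow L m s Z) (mskRow L m s Z) (prmRow L m s Z)

/-- The column of the table at which the key at position `x` is stored. -/
noncomputable def addr (x : ℕ) : ℕ := offset (prmRow L m s Z) (hsh L m s x) +
  slot (mskRow L m s Z (hsh L m s x)) (prmRow L m s Z (hsh L m s x)) x

end

lemma writeAll_of_notMem {f : ℕ → ℕ} {ws : List (ℕ × ℕ)} {c : ℕ} (h : ∀ v, (c, v) ∉ ws) :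
    writeAll f ws c = f c := by
  induction ws generalizing f with
  | nil => rfl
  | cons a ws ih =>
    have := ih (f := Function.update f a.1 a.2) fun v hv => h v (List.mem_cons_of_mem _ hv)
    rw [writeAll, List.foldl_cons, ← writeAll, this, Function.update_apply, if_neg]
    rintro rfl
    exact h a.2 List.mem_cons_self

lemma writeAll_mem {f : ℕ → ℕ} {ws : List (ℕ × ℕ)} {c v : ℕ} (h : (c, v) ∈ ws) :
    (c, writeAll f ws c) ∈ ws := by
  induction ws generalizing f v with
  | nil => simp at h
  | cons a ws ih =>
    rw [writeAll, List.foldl_cons, ← writeAll]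
    by_cases hex : ∃ v, (c, v) ∈ ws
    · obtain ⟨v', hv'⟩ := hex
      exact List.mem_cons_of_mem _ (ih hv')
    · push Not at hex
      rw [writeAll_of_notMem hex]
      rcases List.mem_cons.1 h with rfl | h'
      · simp
      · exact absurd h' (hex v)

lemma writeAll_congr {f : ℕ → ℕ} {ws ws' : List (ℕ × ℕ)} {c : ℕ}
    (h : ∀ v, (c, v) ∈ ws ↔ (c, v) ∈ ws')
    (hu : ∀ v v', (c, v) ∈ ws → (c, v') ∈ ws → v = v') :
    writeAll f ws c = writeAll f ws' c := by
  by_cases hex : ∃ v, (c, v) ∈ ws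
  · obtain ⟨v, hv⟩ := hex
    exact hu _ _ (writeAll_mem hv) ((h _).2 (writeAll_mem ((h v).1 hv)))
  · push Not at hex
    rw [writeAll_of_notMem hex, writeAll_of_notMem fun v hv => hex v ((h v).2 hv)]

lemma offset_mono (p : ℕ → ℕ) {i j : ℕ} (h : i ≤ j) : offset p i ≤ offset p j :=
  Finset.sum_le_sum_of_subset (by simpa using h)

lemma offset_succ (p : ℕ → ℕ) (i : ℕ) : offset p (i + 1) = offset p i + p i :=
  Finset.sum_range_succ _ _

lemma offset_inj {p : ℕ → ℕ} {i j a b : ℕ} (ha : a < p i) (hb : b < p j)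
    (h : offset p i + a = offset p j + b) : i = j := by
  by_contra hne
  rcases lt_or_gt_of_ne hne with hij | hij
  · have := offset_mono p (show i + 1 ≤ j from hij)
    rw [offset_succ] at this
    omega
  · have := offset_mono p (show j + 1 ≤ i from hij)
    rw [offset_succ] at this
    omega

section

variable {L m s : ℕ} {Z Z' : List ℕ}

lemma mem_bucket {z i : ℕ} : z ∈ bucket L m s Z i ↔ z ∈ Z ∧ hsh L m s (z % 2 ^ L) = i := by
  simp [bucket]

lemma inj_of_nodup_map (hZ : (Z.map (· % 2 ^ L)).Nodup) {x y : ℕ} (hx : x ∈ Z) (hy : y ∈ Z)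
    (h : x % 2 ^ L = y % 2 ^ L) : x = y :=
  List.inj_on_of_nodup_map hZ hx hy h

lemma mskRow_lt (hZ : (Z.map (· % 2 ^ L)).Nodup) (i : ℕ) : mskRow L m s Z i < 2 ^ L := by
  rw [mskRow]
  split_ifs
  · exact mask_lt fun x hx y hy h => inj_of_nodup_map hZ (mem_bucket.1 hx).1 (mem_bucket.1 hy).1 h
  · exact Nat.two_pow_pos _

lemma pop_mskRow_le {i : ℕ} (hi : i < 2 ^ m) : pop (mskRow L m s Z i) ≤ cntRow L m s Z i ^ 2 := by
  rw [mskRow, cntRow, if_pos hi, if_pos hi]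
  exact pop_mask_le _

lemma two_le_prmRow {i : ℕ} (hi : i < 2 ^ m) : 2 ≤ prmRow L m s Z i := by
  rw [prmRow, if_pos hi]
  exact (separates_modulus _).1

lemma prmRow_le (i : ℕ) : prmRow L m s Z i ≤ 2 * cntRow L m s Z i ^ 4 + 8 := by
  rw [prmRow, cntRow]
  split_ifs
  · exact modulus_le _
  · exact Nat.zero_le _

lemma addr_lt_offset (hm : m ≤ L) (x : ℕ) :
    addr L m s Z x < offset (prmRow L m s Z) (2 ^ m) := by
  have hh := hsh_lt (s := s) (x := x) hm
  have h1 := offset_mono (prmRow L m s Z) (show hsh L m s x + 1 ≤ 2 ^ m from hh)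
  rw [offset_succ] at h1
  have h2 := slot_lt (M := mskRow L m s Z (hsh L m s x)) (z := x)
    (two_le_prmRow (L := L) (s := s) (Z := Z) hh)
  rw [addr]
  omega

lemma mem_writes (hm : m ≤ L) (hZ : (Z.map (· % 2 ^ L)).Nodup) {c v : ℕ} :
    (c, v) ∈ (List.range (2 ^ m)).flatMap
      (writes L m s Z' (cntRow L m s Z) (mskRow L m s Z) (prmRow L m s Z)) ↔
    v ∈ Z' ∧ (bucket L m s Z' (hsh L m s (v % 2 ^ L))).length ≤
      2 * (bucket L m s Z (hsh L m s (v % 2 ^ L))).length ∧ c = addr L m s Z (v % 2 ^ L) := by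
  simp only [List.mem_flatMap, List.mem_range]
  constructor
  · rintro ⟨i, hi, h⟩
    rw [writes] at h
    split_ifs at h with hc
    · simp at h
    · obtain ⟨z, hz, he⟩ := List.mem_map.1 h
      obtain ⟨rfl, rfl⟩ := Prod.mk.inj he
      obtain ⟨h1, rfl⟩ := mem_bucket.1 hz
      rw [cntRow, if_pos hi] at hc
      refine ⟨h1, by omega, ?_⟩
      rw [addr, slot_mod (mskRow_lt hZ _)]
  · rintro ⟨h1, h2, rfl⟩
    have hh := hsh_lt (s := s) (x := v % 2 ^ L) hm
    refine ⟨_, hh, ?_⟩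
    rw [writes, cntRow, if_pos hh, if_neg (by omega)]
    refine List.mem_map.2 ⟨v, mem_bucket.2 ⟨h1, rfl⟩, ?_⟩
    rw [addr, slot_mod (mskRow_lt hZ _)]

lemma addr_inj_on (hm : m ≤ L) (hZ : (Z.map (· % 2 ^ L)).Nodup) {y z : ℕ} (hy : y ∈ Z) (hz : z ∈ Z)
    (h : addr L m s Z (y % 2 ^ L) = addr L m s Z (z % 2 ^ L)) : y = z := by
  have h1 := hsh_lt (s := s) (x := y % 2 ^ L) hm
  have h2 := hsh_lt (s := s) (x := z % 2 ^ L) hm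
  rw [addr, addr] at h
  have hij := offset_inj (slot_lt (two_le_prmRow h1)) (slot_lt (two_le_prmRow h2)) h
  rw [← hij, Nat.add_left_cancel_iff, slot_mod (mskRow_lt hZ _),
    slot_mod (mskRow_lt hZ _), mskRow, prmRow, if_pos h1, if_pos h1] at h
  exact (separates_modulus _).2 y (mem_bucket.2 ⟨hy, rfl⟩) z (mem_bucket.2 ⟨hz, hij.symm⟩) h

lemma tabRow_addr (hm : m ≤ L) (hZ : (Z.map (· % 2 ^ L)).Nodup) {z : ℕ} (hz : z ∈ Z) :
    tabRow L m s Z (addr L m s Z (z % 2 ^ L)) = z := by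
  have hw := writeAll_mem (f := fun _ => 0) ((mem_writes (s := s) (Z' := Z) hm hZ).2
    ⟨hz, by omega, rfl⟩)
  rw [mem_writes hm hZ] at hw
  exact (addr_inj_on hm hZ hz hw.1 hw.2.2).symm

lemma eq_addr_of_tabRow (hm : m ≤ L) (hZ : (Z.map (· % 2 ^ L)).Nodup) {c : ℕ}
    (h : tabRow L m s Z c ≠ 0) : tabRow L m s Z c ∈ Z ∧
      c = addr L m s Z (tabRow L m s Z c % 2 ^ L) := by
  by_cases hex : ∃ v, (c, v) ∈ (List.range (2 ^ m)).flatMap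
      (writes L m s Z (cntRow L m s Z) (mskRow L m s Z) (prmRow L m s Z))
  · obtain ⟨v, hv⟩ := hex
    have := (mem_writes hm hZ).1 (writeAll_mem (f := fun _ => 0) hv)
    exact ⟨this.1, this.2.2⟩
  · push Not at hex
    exact absurd (writeAll_of_notMem hex) h

lemma mem_keysOf {T : ℕ → ℕ} {N z : ℕ} : z ∈ keysOf T N ↔ (∃ c < N, T c = z) ∧ z ≠ 0 := by
  simp [keysOf]

/-- The table of the sender contains each of the sender's keys once. -/
lemma keysOf_tabRow (hm : m ≤ L) (hZ : (Z.map (· % 2 ^ L)).Nodup) (h0 : ∀ z ∈ Z, z ≠ 0) {N : ℕ}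
    (hN : offset (prmRow L m s Z) (2 ^ m) ≤ N) :
    (keysOf (tabRow L m s Z) N).Nodup ∧ ∀ z, z ∈ keysOf (tabRow L m s Z) N ↔ z ∈ Z := by
  constructor
  · rw [keysOf, List.filter_map]
    refine List.Nodup.map_on ?_ (List.nodup_range.filter _)
    intro x hx y hy h
    rw [List.mem_filter] at hx hy
    have hx := (eq_addr_of_tabRow hm hZ (by simpa using hx.2)).2
    have hy := (eq_addr_of_tabRow hm hZ (by simpa using hy.2)).2
    rw [hx, hy, h]
  · intro z
    rw [mem_keysOf]
    constructor
    · rintro ⟨⟨c, -, rfl⟩, hz⟩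
      exact (eq_addr_of_tabRow hm hZ hz).1
    · intro hz
      exact ⟨⟨_, (addr_lt_offset hm _).trans_le hN, tabRow_addr hm hZ hz⟩, h0 z hz⟩

/-! ### Differences between the players -/

/-- The positions at which the strings with the keys `Z` and `Z'` differ. -/
def diffs (L : ℕ) (Z Z' : List ℕ) : Finset ℕ :=
  (symmDiff Z.toFinset Z'.toFinset).image (· % 2 ^ L)

lemma mem_diffs {z : ℕ} (h : ¬ (z ∈ Z ↔ z ∈ Z')) : z % 2 ^ L ∈ diffs L Z Z' := by
  refine Finset.mem_image_of_mem _ ?_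
  rw [Finset.mem_symmDiff, List.mem_toFinset, List.mem_toFinset]
  tauto

lemma mem_bucket_iff {i : ℕ} (h : ∀ x ∈ diffs L Z Z', hsh L m s x ≠ i) (z : ℕ) :
    z ∈ bucket L m s Z i ↔ z ∈ bucket L m s Z' i := by
  rw [mem_bucket, mem_bucket]
  by_cases hz : z ∈ Z ↔ z ∈ Z'
  · rw [hz]
  · have := h _ (mem_diffs hz)
    tauto

lemma hammingDist_wordAt_le {n ℓ o : ℕ} {f g : ℕ → ℕ} (S : Finset ℕ)
    (h : ∀ i < n, f (o + i) ≠ g (o + i) → o + i ∈ S) :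
    hammingDist (wordAt n ℓ f o) (wordAt n ℓ g o) ≤ S.card := by
  rw [hammingDist]
  refine Finset.card_le_card_of_injOn (fun i => o + (i : ℕ)) ?_ ?_
  · intro i hi
    rw [Finset.coe_filter, Set.mem_ofPred_eq] at hi
    refine h i i.isLt fun he => hi.2 ?_
    rw [wordAt, wordAt, he]
  · intro i _ j _ hij
    exact Fin.ext (Nat.add_left_cancel hij)

lemma hammingDist_row_le {n ℓ : ℕ} {f g : ℕ → ℕ}
    (h : ∀ i < n, (∀ x ∈ diffs L Z Z', hsh L m s x ≠ i) → f i = g i) :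
    hammingDist (wordAt n ℓ f 0) (wordAt n ℓ g 0) ≤ (diffs L Z Z').card := by
  refine (hammingDist_wordAt_le ((diffs L Z Z').image (hsh L m s)) fun i hi hne => ?_).trans
    Finset.card_image_le
  rw [zero_add] at hne ⊢
  by_contra hc
  exact hne (h i hi fun x hx he => hc (Finset.mem_image.2 ⟨x, hx, he⟩))

lemma card_positions_le (hZ : (Z.map (· % 2 ^ L)).Nodup) (hZ' : (Z'.map (· % 2 ^ L)).Nodup) (i : ℕ) :
    (bucket L m s Z' i).length ≤ (bucket L m s Z i).length +
      ((diffs L Z Z').filter fun x => hsh L m s x = i).card := by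
  rw [length_bucket hZ, length_bucket hZ']
  refine le_trans (Finset.card_le_card ?_) (Finset.card_union_le _ _)
  intro x hx
  rw [Finset.mem_filter, positions, List.mem_toFinset, List.mem_map] at hx
  obtain ⟨⟨z, hz, rfl⟩, hi⟩ := hx
  rw [Finset.mem_union, Finset.mem_filter, Finset.mem_filter]
  by_cases hzz : z ∈ Z
  · exact Or.inl ⟨List.mem_toFinset.2 (List.mem_map.2 ⟨z, hzz, rfl⟩), hi⟩
  · exact Or.inr ⟨mem_diffs (by tauto), hi⟩

/-- The tables of the two players differ in at most as many places as the strings do: a bucket in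
which the receiver has too many keys is left empty, and then it accounts for as many differences of
the strings as the sender has keys in it. -/
lemma exists_table_diffs (hm : m ≤ L) (hZ : (Z.map (· % 2 ^ L)).Nodup)
    (hZ' : (Z'.map (· % 2 ^ L)).Nodup) :
    ∃ S : Finset ℕ, S.card ≤ (diffs L Z Z').card ∧ ∀ c, tabRow L m s Z c ≠
      table L m s Z' (cntRow L m s Z) (mskRow L m s Z) (prmRow L m s Z) c → c ∈ S := by
  let skip : ℕ → Prop := fun i => 2 * (bucket L m s Z i).length < (bucket L m s Z' i).length
  have : DecidablePred skip := fun _ => inferInstanceAs (Decidable (_ < _))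
  let A := (diffs L Z Z').filter fun x => ¬ skip (hsh L m s x)
  let B := (positions L Z).filter fun x => skip (hsh L m s x)
  refine ⟨(B ∪ A).image (addr L m s Z), ?_, ?_⟩
  · have hB : B.card ≤ ((diffs L Z Z').filter fun x => skip (hsh L m s x)).card := by
      have maps : ∀ S : Finset ℕ, Set.MapsTo (hsh L m s) S (Finset.range (2 ^ m)) := fun S x _ => by
        simpa using hsh_lt hm
      rw [Finset.card_eq_sum_card_fiberwise (maps B), Finset.card_eq_sum_card_fiberwise (maps _)]
      refine Finset.sum_le_sum fun i _ => ?_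
      rw [Finset.filter_filter, Finset.filter_filter]
      by_cases hs : skip i
      · have h1 : ∀ S : Finset ℕ, S.filter (fun x => skip (hsh L m s x) ∧ hsh L m s x = i) =
            S.filter fun x => hsh L m s x = i := fun S =>
          Finset.filter_congr fun x _ => ⟨fun h => h.2, fun h => ⟨h ▸ hs, h⟩⟩
        rw [h1, h1, ← length_bucket hZ]
        have := card_positions_le (m := m) (s := s) hZ hZ' i
        simp only [skip] at hs
        omega
      · have h1 : ∀ S : Finset ℕ, S.filter (fun x => skip (hsh L m s x) ∧ hsh L m s x = i) = ∅ :=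
          fun S => Finset.filter_eq_empty_iff.2 fun x _ h => hs (h.2 ▸ h.1)
        rw [h1, h1]
    have := Finset.card_filter_add_card_filter_not (s := diffs L Z Z')
      (fun x => skip (hsh L m s x))
    refine Finset.card_image_le.trans ((Finset.card_union_le _ _).trans ?_)
    simp only [A]
    omega
  · intro c hne
    by_contra hc
    refine hne (writeAll_congr (fun v => ?_) fun v v' hv hv' => ?_)
    · have key : ∀ x, x ∈ B ∨ x ∈ A → c ≠ addr L m s Z x := fun x hx he =>
        hc (he ▸ Finset.mem_image_of_mem _ (Finset.mem_union.2 hx))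
      rw [mem_writes hm hZ, mem_writes hm hZ]
      constructor
      · rintro ⟨h1, -, h3⟩
        have hs : ¬ skip (hsh L m s (v % 2 ^ L)) := fun hs => key _ (Or.inl (Finset.mem_filter.2
          ⟨List.mem_toFinset.2 (List.mem_map.2 ⟨v, h1, rfl⟩), hs⟩)) h3
        refine ⟨?_, not_lt.1 hs, h3⟩
        by_contra hv
        exact key _ (Or.inr (Finset.mem_filter.2 ⟨mem_diffs (by tauto), hs⟩)) h3
      · rintro ⟨h1, h2, h3⟩
        refine ⟨?_, by omega, h3⟩
        by_contra hv
        exact key _ (Or.inr (Finset.mem_filter.2 ⟨mem_diffs (by tauto), not_lt.2 h2⟩)) h3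
    · rw [mem_writes hm hZ] at hv hv'
      exact addr_inj_on hm hZ hv.1 hv'.1 (hv.2.2.symm.trans hv'.2.2)

end

/-! ### Sums over the buckets -/

section

variable {L m s : ℕ} {Z : List ℕ}

lemma pow_le_pow_eight (b : ℕ) {e : ℕ} (h0 : e ≠ 0) (h : e ≤ 8) : b ^ e ≤ b ^ 8 := by
  rcases Nat.eq_zero_or_pos b with rfl | hb
  · simp [h0]
  · exact Nat.pow_le_pow_right hb h

lemma sum_le_of_load {n : ℕ} (hg : load L m s Z ≤ seedBound * n) (hmn : 2 ^ m ≤ n) {f : ℕ → ℕ}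
    {a b : ℕ} (hf : ∀ x, f x ≤ a * x ^ 8 + b) :
    ∑ i ∈ Finset.range (2 ^ m), f (cntRow L m s Z i) ≤ (a * seedBound + b) * n := by
  calc ∑ i ∈ Finset.range (2 ^ m), f (cntRow L m s Z i)
      ≤ ∑ i ∈ Finset.range (2 ^ m), (a * (bucket L m s Z i).length ^ 8 + b) :=
        Finset.sum_le_sum fun i hi => by
          rw [cntRow, if_pos (Finset.mem_range.1 hi)]
          exact hf _
    _ = a * load L m s Z + 2 ^ m * b := by
        rw [Finset.sum_add_distrib, ← Finset.mul_sum, load]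
        simp
    _ ≤ a * (seedBound * n) + n * b :=
        add_le_add (Nat.mul_le_mul_left _ hg) (Nat.mul_le_mul_right _ hmn)
    _ = _ := by ring

lemma offset_prmRow_le {n : ℕ} (hg : load L m s Z ≤ seedBound * n) (hmn : 2 ^ m ≤ n) :
    offset (prmRow L m s Z) (2 ^ m) ≤ 2 ^ 27 * n := by
  refine (Finset.sum_le_sum fun i _ => prmRow_le i).trans ((sum_le_of_load (f := fun b =>
    2 * b ^ 4 + 8) (a := 2) (b := 8) hg hmn fun b => ?_).trans (Nat.mul_le_mul_right _ ?_))
  · have := pow_le_pow_eight b (show 4 ≠ 0 by norm_num) (by norm_num)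
    omega
  · norm_num [seedBound]

lemma bucketCost_le (b : ℕ) : bucketCost b + 8 ≤ 2400 * b ^ 8 + 300 := by
  have h1 := pow_le_pow_eight b (show 1 ≠ 0 by norm_num) (by norm_num)
  have h2 := pow_le_pow_eight b (show 2 ≠ 0 by norm_num) (by norm_num)
  have h3 := pow_le_pow_eight b (show 3 ≠ 0 by norm_num) (by norm_num)
  have h4 := pow_le_pow_eight b (show 4 ≠ 0 by norm_num) (by norm_num)
  have h5 := pow_le_pow_eight b (show 5 ≠ 0 by norm_num) (by norm_num)
  have h6 := pow_le_pow_eight b (show 6 ≠ 0 by norm_num) (by norm_num)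
  have h7 := pow_le_pow_eight b (show 7 ≠ 0 by norm_num) (by norm_num)
  rw [bucketCost, tryCost]
  ring_nf at *
  omega

lemma fillCost_le (b : ℕ) : fillCost b + 8 ≤ 200 * b ^ 8 + 60 := by
  have h1 := pow_le_pow_eight b (show 1 ≠ 0 by norm_num) (by norm_num)
  have h3 := pow_le_pow_eight b (show 3 ≠ 0 by norm_num) (by norm_num)
  rw [fillCost]
  ring_nf at *
  omega

end

/-! ### The programs -/

/-- Set up the registers that stay fixed. -/
def setupP : Prog :=
  block [.const 11 0, .const 12 1, .const 13 2, .const 14 3, .const 15 4, .const 16 5, .const 17 6,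
    .const 18 8, .const 10 28, .op .add 10 10 6, .op .sub 29 5 12, .op .shl 20 12 29,
    .op .mul 22 18 6, .op .sub 23 22 29, .op .shl 24 12 22, .op .sub 24 24 12, .const 25 seedBound,
    .op .mul 25 25 1]

/-- Draw a seed, distribute the keys over the buckets, and test whether the seed is good. -/
def roundP : Prog := .seq (.instr (.rand 21)) (.seq clearP (.seq insertP checkP))

/-- Put the length of the part of the seed that matters into register `31`. -/
def seedLengthP : Prog := block [.const 30 64, .op .mul 31 30 6]

/-- Send the seed and the redundancies of all rows. -/
def transmitP (K : ℕ) : Prog :=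
  .seq seedLengthP (.seq (.instr (.send 21 31)) (.seq (encP 12 11) (.seq measureP
    (.seq (encP 14 11) (.seq (encP 15 11) (.seq fillP (tabP K (encP 16 36))))))))

/-- The program of the sender for a non-empty list. -/
def sendP (K : ℕ) : Prog :=
  .seq (.seq setupP (block [.const 27 1])) (.seq (.while 27 roundP) (transmitP K))

/-- Forget the list if it has more than `2 * n` entries. -/
def trimP : Prog :=
  .seq (block [.op .add 30 1 1, .op .lt 30 30 0]) (.ite 30 (block [.const 0 0]) (block []))

/-- Recover the table of the sender, which follows the seed in the message, and put the keys in it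
to the output. -/
def restoreP (K : ℕ) : Prog :=
  .seq insertP (.seq (decP 12 11) (.seq measureP (.seq (decP 14 11) (.seq (decP 15 11)
    (.seq fillP (.seq (tabP K (decP 16 36)) (outP K)))))))

/-- The program of the receiver if the list of the sender is not empty. -/
def receiveP (K : ℕ) : Prog :=
  .seq setupP (.seq trimP (.seq seedLengthP (.seq (.instr (.recv 21 31)) (restoreP K))))

section

variable {X : Mach} {L m s len : ℕ} {A : Abs} {Z : List ℕ}

lemma setupP_sat (hX : Size X L m) (h0 : A.reg 0 = len) (h1 : A.reg 1 = X.n)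
    (h5 : A.reg 5 = m + 1) (h6 : A.reg 6 = L) (h21 : A.reg 21 = 0) :
    Sat X setupP A 55 (fun B => Env X L m 0 len B ∧ B.mem = A.mem ∧ B.ch = A.ch) := by
  have hmL := hX.m_le
  have hw : m < 2 ^ X.w := lt_of_le_of_lt hX.m_le (Nat.lt_two_pow_self.trans_le
    (hX.lt_pow (show L ≤ 128 * L + 128 by omega)))
  have hw' : 8 * L < 2 ^ X.w := Nat.lt_two_pow_self.trans_le (hX.lt_pow (by omega))
  refine (Sat.blk ?_ ⟨?_, by simp [evalL], by simp⟩).mono (by simp) fun _ h => h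
  · simp [h5, h6, hw, hw']
    exact ⟨by omega, Nat.one_le_two_pow⟩
  · constructor <;> simp [evalL, h0, h1, h5, h6, h21, hX.LN, add_comm]

/-- The keys of `Z` are in row `0`, and the rows for the results are still empty. -/
structure Clean (L m : ℕ) (Z : List ℕ) (f : ℕ → ℕ → ℕ) : Prop where
  input : Input L Z (f 0)
  rows : ∀ q, 2 < q → q < 8 → ∀ r, f q r = 0
  cols : ∀ q, q = 1 ∨ q = 2 → ∀ r, 2 ^ m ≤ r → f q r = 0

/-- `insertP_sat` for a memory that is empty apart from the input. -/
lemma insertP_sat' (hX : Size X L m) (hA : Env X L m s Z.length A) (hs : s < 2 ^ X.w)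
    (hZ : Z.length ≤ 2 ^ L) (hcl : Clean L m Z A.mem)
    (h12 : ∀ q, q = 1 ∨ q = 2 → ∀ r < 2 ^ m, A.mem q r = 0) :
    Sat X insertP A (246 * Z.length + 8) (fun B => Frame 30 A B ∧ Clean L m Z B.mem ∧
      Stored L m s Z B.mem ∧ B.mem 1 = cntRow L m s Z) := by
  refine (insertP_sat hX hA hs hZ hcl.input (h12 1 (by simp)) (h12 2 (by simp))).mono le_rfl ?_
  rintro B ⟨h1, h2, h3, h4⟩
  refine ⟨h1, ⟨?_, ?_, ?_⟩, h2, ?_⟩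
  · intro e he
    rw [h4 0 _ (by simp), h4 0 _ (by simp)]
    exact hcl.input e he
  · intro q hq hq' r
    rw [h4 q r (by omega), hcl.rows q hq hq']
  · intro q hq r hr
    rw [h4 q r (by omega), hcl.cols q hq r hr]
  · funext r
    rw [cntRow]
    split_ifs with hr
    · exact h3 r hr
    · rw [h4 1 r (by omega), hcl.cols 1 (by simp) r (by omega)]

lemma roundP_sat (hX : Size X L m) (hA : Env X L m s Z.length A) (hZ : Z.length ≤ 2 ^ L)
    (hcl : Clean L m Z A.mem) {x : ℕ} (hx : (X.tape A.ch.drawn : ℕ) = x) :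
    Sat X roundP A (1 + ((15 * 2 ^ m + 8) + ((246 * Z.length + 8) + (24 * 2 ^ m + 16))))
      (fun B => Env X L m x Z.length B ∧ Clean L m Z B.mem ∧ Stored L m x Z B.mem ∧
        B.mem 1 = cntRow L m x Z ∧ B.ch = { A.ch with drawn := A.ch.drawn + 1 } ∧
        B.reg 27 = if seedBound * X.n < load L m x Z then 1 else 0) := by
  refine rand_sat.seq fun B hB => ?_
  obtain ⟨b1, b2, b3⟩ := hB
  rw [hx] at b1
  have hB : Env X L m x Z.length B := by
    refine hA.update ?_ ?_ ?_
    · simp [b1, hA.r0]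
    · simp [b1]
    · intro r _ _ h
      simp [b1, h]
  have hxw : x < 2 ^ X.w := hx ▸ (X.tape A.ch.drawn).isLt
  refine (clearP_sat hX hB).seq fun C hC => ?_
  obtain ⟨c1, c2⟩ := hC
  have hC := hB.congr c1
  have hcl' : Clean L m Z C.mem := by
    refine ⟨?_, ?_, ?_⟩
    · intro e he
      rw [c2, c2, if_neg (by omega), if_neg (by omega), b2]
      exact hcl.input e he
    · intro q hq hq' r
      rw [c2, if_neg (by omega), b2, hcl.rows q hq hq']
    · intro q hq r hr
      rw [c2, if_neg (by omega), b2, hcl.cols q hq r hr]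
  refine (insertP_sat' hX hC hxw hZ hcl' fun q hq r hr => by rw [c2, if_pos ⟨hq, hr⟩]).seq
    fun D hD => ?_
  obtain ⟨d1, d2, d3, d4⟩ := hD
  have hD := hC.congr d1
  refine (checkP_sat hX hD hZ fun i hi => by rw [d4, cntRow, if_pos hi]).mono le_rfl ?_
  rintro E ⟨e1, e2, e3, e4⟩
  refine ⟨hD.of_reg fun r hr => e1.reg r hr, by rwa [e2], by rwa [e2], by rw [e2, d4], ?_, e4⟩
  rw [e1.ch, d1.ch, c1.ch, b3]

/-- The redundancy of the word in the first columns of a row. -/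
def redOf (X : Mach) (f : ℕ → ℕ) : List Bool := redundancyBits (X.code.enc (wordAt X.n X.ℓ f 0))

/-- The part of the message that follows the seed. -/
noncomputable def rowsMsg (X : Mach) (L m s : ℕ) (Z : List ℕ) : List Bool :=
  redOf X (cntRow L m s Z) ++ (redOf X (mskRow L m s Z) ++ (redOf X (prmRow L m s Z) ++
    (tabMsg X (tabRow L m s Z) 0)))

lemma length_rowsMsg : (rowsMsg X L m s Z).length = (3 + X.K) * (X.ρ * X.ℓ) := by
  simp only [rowsMsg, List.length_append, redOf, length_redundancyBits, length_tabMsg]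
  ring

lemma cntRow_mod : cntRow L m (s % 2 ^ (64 * L)) = cntRow L m s := by
  funext Z i
  simp only [cntRow, bucket_mod]

lemma mskRow_mod : mskRow L m (s % 2 ^ (64 * L)) = mskRow L m s := by
  funext Z i
  simp only [mskRow, bucket_mod]

lemma prmRow_mod : prmRow L m (s % 2 ^ (64 * L)) = prmRow L m s := by
  funext Z i
  simp only [prmRow, bucket_mod]

lemma tabRow_mod : tabRow L m (s % 2 ^ (64 * L)) = tabRow L m s := by
  funext Z i
  have : writes L m (s % 2 ^ (64 * L)) = writes L m s := by
    funext Z b M p i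
    simp only [writes, bucket_mod]
  simp only [tabRow, table, cntRow_mod, mskRow_mod, prmRow_mod, this]

/-- Only the part of the seed that is sent matters. -/
lemma rowsMsg_mod : rowsMsg X L m (s % 2 ^ (64 * L)) = rowsMsg X L m s := by
  funext Z
  rw [rowsMsg, rowsMsg, cntRow_mod, mskRow_mod, prmRow_mod, tabRow_mod]

lemma load_mod : load L m (s % 2 ^ (64 * L)) Z = load L m s Z := by
  simp only [load, bucket_mod]

lemma Size.n_le_row (hX : Size X L m) : X.n ≤ 2 ^ X.LN :=
  (hX.col (by have := hX.n_le; have := Nat.two_pow_pos L; omega)).le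

lemma seedLengthP_sat (h6 : A.reg 6 = L) : Sat X seedLengthP A 7 (fun B => Frame 30 A B ∧
    B.mem = A.mem ∧ B.reg 31 = 64 * L) :=
  Sat.blk (by simp) ⟨Frame.evalL (by simp), by simp [evalL], by simp [evalL, h6]⟩

lemma Size.seedLength_le (hX : Size X L m) : 64 * L ≤ X.w := by
  have := hX.w
  omega

lemma cell_of_env (hX : Size X L m) (hA : Env X L m s len A) {q : ℕ} (hq : q ≠ 9)
    (h : A.reg q < 16) : A.cell X q 11 :=
  ⟨hq, by norm_num, hA.r10, hX.row' h, by rw [hA.r11]; exact Nat.two_pow_pos _⟩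

/-- The time of `measureP` and `fillP` if the sender has the keys `Z`. -/
def bucketsCost (L m s : ℕ) (Z : List ℕ) : ℕ :=
  ∑ i ∈ Finset.range (2 ^ m), (bucketCost (cntRow L m s Z i) + 8) +
    ∑ i ∈ Finset.range (2 ^ m), (fillCost (cntRow L m s Z i) + 8)

lemma bucketsCost_le {n : ℕ} (hg : load L m s Z ≤ seedBound * n) (hmn : 2 ^ m ≤ n) :
    bucketsCost L m s Z ≤ (2600 * seedBound + 360) * n := by
  have h1 := sum_le_of_load (f := fun b => bucketCost b + 8) hg hmn bucketCost_le
  have h2 := sum_le_of_load (f := fun b => fillCost b + 8) hg hmn fillCost_le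
  refine (add_le_add h1 h2).trans (le_of_eq ?_)
  ring

lemma encRow_sat (hX : Size X L m) (hA : Env X L m s len A) (hℓ : X.ℓ ≤ X.w) {q q' : ℕ}
    (hq : q ≠ 9) (h : A.reg q = q') (hq' : q' < 16) {f : ℕ → ℕ} (hf : A.mem q' = f) :
    Sat X (encP q 11) A 3 (fun B => Env X L m s len B ∧ B.mem = A.mem ∧
      B.ch = { A.ch with
        outMsg := A.ch.outMsg ++ redOf X f
        encCalls := A.ch.encCalls + 1 }) := by
  refine (encP_sat hℓ (cell_of_env hX hA hq (h ▸ hq'))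
    (by rw [hA.r11, zero_add]; exact hX.n_le_row)).mono le_rfl ?_
  rintro B ⟨h1, h2, h3⟩
  rw [h, hA.r11, hf] at h3
  exact ⟨hA.of_reg fun r _ => by rw [h1], h2, h3⟩

lemma cntRow_le (hZ : Z.length ≤ 2 ^ L) (i : ℕ) : cntRow L m s Z i ≤ 2 ^ L := by
  rw [cntRow]
  split_ifs
  · exact (bucket_length_le Z i).trans hZ
  · exact Nat.zero_le _

lemma transmitP_sat (hX : Size X L m) (hA : Env X L m s len A) (hℓ : X.ℓ ≤ X.w)
    (hZL : Z.length ≤ 2 ^ L) (hZ : (Z.map (· % 2 ^ L)).Nodup) (hlt : ∀ z ∈ Z, z < 2 ^ X.w)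
    (hcl : Clean L m Z A.mem) (hst : Stored L m s Z A.mem) (h1 : A.mem 1 = cntRow L m s Z)
    (hg : load L m s Z ≤ seedBound * X.n) :
    Sat X (transmitP X.K) A (bucketsCost L m s Z + (X.K * 15 + 60)) (fun B =>
      B.ch.outMsg = A.ch.outMsg ++ (natToBits (64 * L) s ++ rowsMsg X L m s Z) ∧
      B.ch.encCalls = A.ch.encCalls + (3 + X.K) ∧ B.ch.decCalls = A.ch.decCalls) := by
  refine ((seedLengthP_sat hA.r6).seq fun B hB => (send_sat (by norm_num) (by norm_num)
    (by rw [hB.2.2]; exact hX.seedLength_le)).seq fun C hC => ?_).mono (c := 7 + (1 + (3 +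
      ((∑ i ∈ Finset.range (2 ^ m), (bucketCost (cntRow L m s Z i) + 8) + 8) + (3 + (3 +
      ((∑ i ∈ Finset.range (2 ^ m), (fillCost (cntRow L m s Z i) + 8) + 12) + (X.K * 15 + 15))))))))
      (by rw [bucketsCost]; omega) fun _ h => h
  obtain ⟨b1, b2, b3⟩ := hB
  obtain ⟨c1, c2, c3⟩ := hC
  have hB := hA.congr b1
  have hC := hB.of_reg fun r _ => by rw [c1]
  rw [b3, hB.r21, b1.ch] at c3
  rw [b2] at c2
  refine (encRow_sat hX hC hℓ (by norm_num) hC.r12 (by norm_num) (by rw [c2, h1])).seq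
    fun D hD => ?_
  obtain ⟨hD, d2, d3⟩ := hD
  rw [c2] at d2
  refine (measureP_sat hX hD hZL hZ.of_map hlt (by rwa [d2]) (b := cntRow L m s Z)
    fun i _ => ⟨by rw [d2, h1], cntRow_le hZL i⟩).seq fun E hE => ?_
  obtain ⟨e1, e2⟩ := hE
  have hE := hD.congr e1
  have e3 : E.mem 3 = mskRow L m s Z := by
    funext r
    rw [e2, mskRow, d2, hcl.rows 3 (by norm_num) (by norm_num)]
    by_cases hr : r < 2 ^ m <;> simp [hr, cntRow]
  have e4 : E.mem 4 = prmRow L m s Z := by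
    funext r
    rw [e2, prmRow, d2, hcl.rows 4 (by norm_num) (by norm_num)]
    by_cases hr : r < 2 ^ m <;> simp [hr, cntRow]
  have eo : ∀ q, q ≠ 3 → q ≠ 4 → E.mem q = A.mem q := fun q h3 h4 => by
    funext r
    rw [e2, if_neg (by omega), d2]
  refine (encRow_sat hX hE hℓ (by norm_num) hE.r14 (by norm_num) e3).seq fun F hF => ?_
  obtain ⟨hF, f2, f3⟩ := hF
  refine (encRow_sat hX hF hℓ (by norm_num) hF.r15 (by norm_num) (by rw [f2, e4])).seq
    fun G hG => ?_
  obtain ⟨hG, g2, g3⟩ := hG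
  rw [f2] at g2
  refine (fillP_sat hX hG hZL hlt (b := cntRow L m s Z) (M := mskRow L m s Z)
    (p := prmRow L m s Z) ⟨fun i hi => ?_, fun i hi j hj => ?_⟩
    (fun i _ => ⟨by rw [g2, eo 1 (by norm_num) (by norm_num), h1], cntRow_le hZL i⟩)
    (fun i hi => ⟨by rw [g2, e3], mskRow_lt hZ i, pop_mskRow_le hi⟩)
    (fun i hi => ⟨by rw [g2, e4], two_le_prmRow hi⟩)
    (by rw [hX.K]; exact offset_prmRow_le hg hX.pow_le)).seq fun H hH => ?_
  · rw [g2, eo 2 (by norm_num) (by norm_num), hst.size i hi]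
  · rw [g2, eo _ (by omega) (by omega), hst.keys i hi j hj]
  obtain ⟨i1, i2, i3⟩ := hH
  have i5 : H.mem 5 = tabRow L m s Z := by
    have : G.mem 5 = fun _ => 0 := by
      rw [g2, eo 5 (by norm_num) (by norm_num)]
      funext r
      exact hcl.rows 5 (by norm_num) (by norm_num) r
    rw [i3, this]
    rfl
  refine (encTab_sat hX (hG.congr i1) hℓ).mono le_rfl ?_
  rintro I ⟨-, -, j3⟩
  rw [j3, i5, i1.ch, g3, f3, e1.ch, d3, c3]
  simp only [rowsMsg, List.append_assoc, true_and, and_true]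
  omega

lemma keysOf_congr {T T' : ℕ → ℕ} {N : ℕ} (h : ∀ c < N, T c = T' c) : keysOf T N = keysOf T' N := by
  rw [keysOf, keysOf, List.map_congr_left fun c hc => h c (List.mem_range.1 hc)]

lemma decRow_sat (hX : Size X L m) (hA : Env X L m s len A) (hℓ : X.ℓ ≤ X.w) {q q' : ℕ}
    (hq : q ≠ 9) (h : A.reg q = q') (hq' : q' < 16) {f : ℕ → ℕ} {rest : List Bool}
    (hin : A.ch.inMsg = redOf X f ++ rest)
    (hd : hammingDist (wordAt X.n X.ℓ f 0) (wordAt X.n X.ℓ (A.mem q') 0) ≤ X.k)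
    (hf : ∀ i < X.n, f i < 2 ^ X.ℓ) :
    Sat X (decP q 11) A 3 (fun B => Env X L m s len B ∧ (∀ i < 2 ^ m, B.mem q' i = f i) ∧
      (∀ p ≠ q', B.mem p = A.mem p) ∧
      B.ch = { A.ch with inMsg := rest, decCalls := A.ch.decCalls + 1 }) := by
  refine (decP_sat (F := f) (rest := rest) hℓ (cell_of_env hX hA hq (h ▸ hq'))
    (by rw [hA.r11, zero_add]; exact hX.n_le_row) (by rw [hA.r11]; exact hin)
    (by rw [hA.r11, h]; exact hd) (by rw [hA.r11]; simpa using hf)).mono le_rfl ?_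
  rintro B ⟨h1, h2, h3⟩
  rw [h, hA.r11, zero_add] at h2
  refine ⟨hA.of_reg fun r _ => by rw [h1], fun i hi => ?_, fun p hp => ?_, h3⟩
  · rw [h2, if_pos ⟨rfl, Nat.zero_le _, hi.trans_le hX.pow_le⟩]
  · funext r
    rw [h2, if_neg fun hc => hp hc.1]

lemma bucket_length_eq {Z' : List ℕ} (hZ : (Z.map (· % 2 ^ L)).Nodup)
    (hZ' : (Z'.map (· % 2 ^ L)).Nodup) {i : ℕ}
    (h : ∀ z, z ∈ bucket L m s Z i ↔ z ∈ bucket L m s Z' i) :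
    (bucket L m s Z i).length = (bucket L m s Z' i).length :=
  ((List.perm_ext_iff_of_nodup (hZ.of_map.filter _) (hZ'.of_map.filter _)).2 h).length_eq

end

/-! ### The run of the receiver -/

section

variable {X : Mach} {L m s len : ℕ} {A : Abs} {Z Z' : List ℕ}

/-- All symbols that the sender passes to the code are in its alphabet. -/
lemma rows_lt (hX : Size X L m) (hZL : Z.length ≤ 2 ^ L) (hZ : (Z.map (· % 2 ^ L)).Nodup)
    (hL : 4 * L + 4 ≤ X.ℓ) (hlt : ∀ z ∈ Z, z < 2 ^ X.ℓ) (i : ℕ) :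
    cntRow L m s Z i < 2 ^ X.ℓ ∧ mskRow L m s Z i < 2 ^ X.ℓ ∧ prmRow L m s Z i < 2 ^ X.ℓ ∧
      tabRow L m s Z i < 2 ^ X.ℓ := by
  have h1 : 2 ^ L < 2 ^ X.ℓ := Nat.pow_lt_pow_right (by norm_num) (by omega)
  have hc := cntRow_le (m := m) (s := s) hZL i
  refine ⟨hc.trans_lt h1, (mskRow_lt hZ i).trans h1, (prmRow_le i).trans_lt ?_, ?_⟩
  · calc 2 * cntRow L m s Z i ^ 4 + 8 ≤ 2 * (2 ^ L) ^ 4 + 8 * (2 ^ L) ^ 4 := by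
          have := Nat.pow_le_pow_left hc 4
          have : 0 < (2 ^ L) ^ 4 := by positivity
          omega
      _ < 2 ^ (4 * L + 4) := by
          have : 0 < (2 ^ L) ^ 4 := by positivity
          rw [pow_add, mul_comm 4 L, pow_mul]
          omega
      _ ≤ 2 ^ X.ℓ := Nat.pow_le_pow_right (by norm_num) hL
  · by_cases h0 : tabRow L m s Z i = 0
    · rw [h0]
      exact Nat.two_pow_pos _
    · exact hlt _ (eq_addr_of_tabRow hX.m_le hZ h0).1

/-- The receiver recovers the table of the sender from the redundancies, one row after the other. -/
lemma restoreP_sat (hX : Size X L m) (hA : Env X L m s Z'.length A) (hs : s < 2 ^ X.w)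
    (hℓ : X.ℓ ≤ X.w) (hL : 4 * L + 4 ≤ X.ℓ) (hZL : Z.length ≤ 2 ^ L) (hZL' : Z'.length ≤ 2 ^ L)
    (hZ : (Z.map (· % 2 ^ L)).Nodup) (hZ' : (Z'.map (· % 2 ^ L)).Nodup)
    (hlt : ∀ z ∈ Z, z < 2 ^ X.ℓ) (hlt' : ∀ z ∈ Z', z < 2 ^ X.w)
    (hcl : Clean L m Z' A.mem) (h12 : ∀ q, q = 1 ∨ q = 2 → ∀ r < 2 ^ m, A.mem q r = 0)
    (hd : (diffs L Z Z').card ≤ X.k) (hg : load L m s Z ≤ seedBound * X.n) {rest : List Bool}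
    (hin : A.ch.inMsg = rowsMsg X L m s Z ++ rest) :
    Sat X (restoreP X.K) A (bucketsCost L m s Z + (246 * Z'.length + X.K * X.n * 37 + X.K * 15 + 90))
      (fun B => Input L (keysOf (tabRow L m s Z) (X.K * X.n)) (B.mem 6) ∧
        B.reg 0 = 6 * 2 ^ X.LN ∧ B.ch.encCalls = A.ch.encCalls ∧
        B.ch.decCalls = A.ch.decCalls + (3 + X.K)) := by
  have hrow := rows_lt (s := s) hX hZL hZ hL hlt
  refine ((insertP_sat' hX hA hs hZL' hcl h12).seq fun B hB => ?_).mono (c := (246 * Z'.length + 8) +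
      (3 + ((∑ i ∈ Finset.range (2 ^ m), (bucketCost (cntRow L m s Z i) + 8) + 8) + (3 + (3 +
      ((∑ i ∈ Finset.range (2 ^ m), (fillCost (cntRow L m s Z i) + 8) + 12) +
      ((X.K * 15 + 15) + (X.K * X.n * 37 + 22))))))))
      (by rw [bucketsCost]; omega) fun _ h => h
  obtain ⟨b1, b2, b3, b4⟩ := hB
  have hB := hA.congr b1
  rw [rowsMsg, List.append_assoc, List.append_assoc, List.append_assoc] at hin
  have same : ∀ {i}, (∀ x ∈ diffs L Z Z', hsh L m s x ≠ i) →
      ∀ z, z ∈ bucket L m s Z i ↔ z ∈ bucket L m s Z' i := fun h => mem_bucket_iff h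
  refine (decRow_sat hX hB hℓ (by norm_num) hB.r12 (by norm_num) (by rw [b1.ch]; exact hin) ?_
    fun i _ => (hrow i).1).seq fun C hC => ?_
  · rw [b4]
    refine (hammingDist_row_le (m := m) (s := s) fun i _ hi => ?_).trans hd
    rw [cntRow, cntRow, bucket_length_eq hZ hZ' (same hi)]
  obtain ⟨hC, c1, c2, c3⟩ := hC
  rw [b1.ch] at c3
  have cst : Stored L m s Z' C.mem := by
    refine ⟨fun i hi => ?_, fun i hi j hj => ?_⟩
    · rw [c2 2 (by norm_num), b3.size i hi]
    · rw [c2 _ (by omega), b3.keys i hi j hj]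
  refine (measureP_sat hX hC hZL' hZ'.of_map hlt' cst (b := cntRow L m s Z)
    fun i hi => ⟨c1 i hi, cntRow_le hZL i⟩).seq fun D hD => ?_
  obtain ⟨d1, d2⟩ := hD
  have hD := hC.congr d1
  have d34 : ∀ q, q = 3 ∨ q = 4 → ∀ r, D.mem q r =
      if r < 2 ^ m ∧ cntRow L m s Z r = (bucket L m s Z' r).length then
        (if q = 3 then mask (bucket L m s Z' r) else modulus (bucket L m s Z' r)) else 0 := by
    intro q hq r
    rw [d2, c2 q (by omega), b2.rows q (by omega) (by omega)]
    simp only [hq, true_and]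
  have deq : ∀ {i}, i < 2 ^ m → (∀ x ∈ diffs L Z Z', hsh L m s x ≠ i) →
      cntRow L m s Z i = (bucket L m s Z' i).length := fun hi h => by
    rw [cntRow, if_pos hi, bucket_length_eq hZ hZ' (same h)]
  have do' : ∀ q, q ≠ 1 → q ≠ 3 → q ≠ 4 → D.mem q = B.mem q := fun q h1 h3 h4 => by
    funext r
    rw [d2, if_neg (by omega), c2 q h1]
  refine (decRow_sat hX hD hℓ (by norm_num) hD.r14 (by norm_num) (by rw [d1.ch, c3]) ?_
    fun i _ => (hrow i).2.1).seq fun E hE => ?_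
  · refine (hammingDist_row_le (m := m) (s := s) fun i _ hi => ?_).trans hd
    rw [d34 3 (by simp), mskRow]
    by_cases him : i < 2 ^ m
    · rw [if_pos him, if_pos ⟨him, deq him hi⟩, if_pos rfl, mask_congr (same hi)]
    · rw [if_neg him, if_neg fun h => him h.1]
  obtain ⟨hE, e1, e2, e3⟩ := hE
  rw [d1.ch, c3] at e3
  refine (decRow_sat hX hE hℓ (by norm_num) hE.r15 (by norm_num) (by rw [e3]) ?_
    fun i _ => (hrow i).2.2.1).seq fun F hF => ?_
  · rw [e2 4 (by norm_num)]
    refine (hammingDist_row_le (m := m) (s := s) fun i _ hi => ?_).trans hd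
    rw [d34 4 (by simp), prmRow]
    by_cases him : i < 2 ^ m
    · rw [if_pos him, if_pos ⟨him, deq him hi⟩, if_neg (by norm_num), modulus_congr (same hi)]
    · rw [if_neg him, if_neg fun h => him h.1]
  obtain ⟨hF, f1, f2, f3⟩ := hF
  rw [e3] at f3
  have fo : ∀ q, q ≠ 1 → q ≠ 3 → q ≠ 4 → F.mem q = B.mem q := fun q h1 h3 h4 => by
    rw [f2 q h4, e2 q h3, do' q h1 h3 h4]
  have fm1 : ∀ i < 2 ^ m, F.mem 1 i = cntRow L m s Z i := fun i hi => by
    rw [f2 1 (by norm_num), e2 1 (by norm_num), d2, if_neg (by omega), c1 i hi]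
  refine (fillP_sat hX hF hZL' hlt' (b := cntRow L m s Z) (M := mskRow L m s Z)
    (p := prmRow L m s Z) ⟨fun i hi => ?_, fun i hi j hj => ?_⟩
    (fun i hi => ⟨fm1 i hi, cntRow_le hZL i⟩)
    (fun i hi => ⟨by rw [f2 3 (by norm_num), e1 i hi], mskRow_lt hZ i, pop_mskRow_le hi⟩)
    (fun i hi => ⟨f1 i hi, two_le_prmRow hi⟩)
    (by rw [hX.K]; exact offset_prmRow_le hg hX.pow_le)).seq fun G hG => ?_
  · rw [fo 2 (by norm_num) (by norm_num) (by norm_num), b3.size i hi]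
  · rw [fo _ (by omega) (by omega) (by omega), b3.keys i hi j hj]
  obtain ⟨g1, g2, g3⟩ := hG
  have hG := hF.congr g1
  have g5 : G.mem 5 = table L m s Z' (cntRow L m s Z) (mskRow L m s Z) (prmRow L m s Z) := by
    have : F.mem 5 = fun _ => 0 := by
      rw [fo 5 (by norm_num) (by norm_num) (by norm_num)]
      funext r
      exact b2.rows 5 (by norm_num) (by norm_num) r
    rw [g3, this]
    rfl
  obtain ⟨S, hS, hS'⟩ := exists_table_diffs (s := s) hX.m_le hZ hZ'
  refine (decTab_sat hX hG hℓ (F := tabRow L m s Z) (by rw [g1.ch, f3]) (fun j _ => ?_)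
    fun i _ => (hrow i).2.2.2).seq fun H hH => ?_
  · rw [g5]
    exact (hammingDist_wordAt_le S fun i _ hne => hS' _ hne).trans (hS.trans hd)
  obtain ⟨i1, i2, i3⟩ := hH
  have hH := hG.of_reg fun r hr => i1 r (by omega)
  refine (outP_sat hX hH fun j hj => ?_).mono le_rfl ?_
  · rw [i2 j hj]
    exact (hrow j).2.2.2.trans_le (Nat.pow_le_pow_right (by norm_num) hℓ)
  · rintro I ⟨j1, j2, j3⟩
    rw [keysOf_congr i2] at j1
    rw [j3, i3, g1.ch, f3]
    refine ⟨j1, j2, rfl, ?_⟩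
    simp only
    omega

/-- The keys that the receiver uses. A list with more than `2 * n` entries is replaced by the empty
list, which is as close to the list of the sender. -/
def trim (n : ℕ) (Z : List ℕ) : List ℕ := if 2 * n < Z.length then [] else Z

lemma length_trim_le (n : ℕ) : (trim n Z).length ≤ 2 * n := by
  rw [trim]
  split_ifs with h
  · simp
  · omega

lemma card_diffs_trim_le {k : ℕ} (hZ : (Z.map (· % 2 ^ L)).Nodup)
    (hZ' : (Z'.map (· % 2 ^ L)).Nodup) (h : (diffs L Z Z').card ≤ k) :
    (diffs L Z (trim Z.length Z')).card ≤ k := by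
  rw [trim]
  split_ifs with hc
  · have h1 : (diffs L Z []).card ≤ Z.length := by
      refine Finset.card_image_le.trans ?_
      have : symmDiff Z.toFinset [].toFinset = Z.toFinset := symmDiff_bot _
      rw [this]
      exact List.toFinset_card_le Z
    have h2 : (positions L Z').card ≤ (positions L Z ∪ diffs L Z Z').card := by
      refine Finset.card_le_card fun x hx => ?_
      rw [positions, List.mem_toFinset, List.mem_map] at hx
      obtain ⟨z, hz, rfl⟩ := hx
      rw [Finset.mem_union]
      by_cases hzz : z ∈ Z
      · exact Or.inl (List.mem_toFinset.2 (List.mem_map.2 ⟨z, hzz, rfl⟩))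
      · exact Or.inr (mem_diffs (by tauto))
    have h3 := h2.trans (Finset.card_union_le _ _)
    rw [card_positions hZ, card_positions hZ'] at h3
    omega
  · exact h

lemma trimP_sat (hX : Size X L m) (hA : Env X L m s Z.length A) (hZ : Z.length ≤ 2 ^ L) :
    Sat X trimP A 12 (fun B => Env X L m s (trim X.n Z).length B ∧ B.mem = A.mem ∧
      B.ch = A.ch) := by
  have hn := hX.n_le
  refine ((Sat.blk (Q := fun B => Frame 30 A B ∧ B.mem = A.mem ∧ B.reg 30 =
    if 2 * X.n < Z.length then 1 else 0) ?_ ⟨Frame.evalL (by simp), by simp [evalL], ?_⟩).seq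
    fun B hB => Sat.ite (c := 4) (by norm_num) ?_ ?_ ?_).mono (by simp) fun _ h => h
  · simp [hA.r0, hA.r1]
    exact ⟨hX.le_w (by omega), hX.le_w (by omega)⟩
  · simp [evalL, hA.r0, hA.r1, two_mul]
  · rw [hB.2.2]
    have := hX.le_w (show 1 ≤ 2 ^ 28 * 2 ^ L by have := Nat.two_pow_pos L; omega)
    split_ifs <;> omega
  · intro h30
    obtain ⟨b1, b2, b3⟩ := hB
    have hc : 2 * X.n < Z.length := by
      by_contra hc
      rw [b3, if_neg hc] at h30
      exact h30 rfl
    refine Sat.blk (by simp) ⟨?_, by simpa [evalL] using b2, by simp [b1.ch]⟩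
    rw [trim, if_pos hc]
    have hB := hA.congr b1
    exact hB.update (by simp [evalL]) (by simp [evalL, hB.r21]) fun r _ h _ => by simp [evalL, h]
  · intro h30
    obtain ⟨b1, b2, b3⟩ := hB
    have hc : ¬ 2 * X.n < Z.length := by
      intro hc
      rw [b3, if_pos hc] at h30
      exact one_ne_zero h30
    refine (Sat.blk (l := []) trivial ⟨?_, b2, b1.ch⟩).mono (by simp) fun _ h => h
    rw [trim, if_neg hc]
    exact hA.congr b1

lemma take_natToBits_append {b x : ℕ} {l : List Bool} :
    (natToBits b x ++ l).take b = natToBits b x ∧ (natToBits b x ++ l).drop b = l := by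
  have := length_natToBits b x
  constructor
  · rw [List.take_append_of_le_length this.ge, List.take_of_length_le this.le]
  · rw [List.drop_append_of_le_length this.ge, List.drop_of_length_le this.le, List.nil_append]

lemma Clean.trim {n : ℕ} {f : ℕ → ℕ → ℕ} (h : Clean L m Z f) : Clean L m (trim n Z) f := by
  refine ⟨?_, h.rows, h.cols⟩
  rw [SetRec.trim]
  split_ifs
  · intro e he
    simp at he
  · exact h.input

lemma receiveP_sat (hX : Size X L m) (h0 : A.reg 0 = Z'.length) (h1 : A.reg 1 = X.n)
    (h5 : A.reg 5 = m + 1) (h6 : A.reg 6 = L) (h21 : A.reg 21 = 0)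
    (hℓ : X.ℓ ≤ X.w) (hL : 4 * L + 4 ≤ X.ℓ) (hn : Z.length = X.n) (hZL' : Z'.length ≤ 2 ^ L)
    (hZ : (Z.map (· % 2 ^ L)).Nodup) (hZ' : (Z'.map (· % 2 ^ L)).Nodup)
    (hlt : ∀ z ∈ Z, z < 2 ^ X.ℓ) (hlt' : ∀ z ∈ Z', z < 2 ^ X.w)
    (hcl : Clean L m Z' A.mem) (h12 : ∀ q, q = 1 ∨ q = 2 → ∀ r < 2 ^ m, A.mem q r = 0)
    (hd : (diffs L Z Z').card ≤ X.k) (hg : load L m s Z ≤ seedBound * X.n)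
    (hin : A.ch.inMsg = natToBits (64 * L) s ++ rowsMsg X L m s Z) :
    Sat X (receiveP X.K) A ((2600 * seedBound + 900 + X.K * 37) * X.n + (X.K * 15 + 200))
      (fun B => Input L (keysOf (tabRow L m s Z) (X.K * X.n)) (B.mem 6) ∧
        B.reg 0 = 6 * 2 ^ X.LN ∧ B.ch.encCalls = A.ch.encCalls ∧
        B.ch.decCalls = A.ch.decCalls + (3 + X.K)) := by
  have hbc := bucketsCost_le hg hX.pow_le
  have htl := length_trim_le (Z := Z') X.n
  refine ((setupP_sat hX h0 h1 h5 h6 h21).seq fun B hB => (trimP_sat hX hB.1 hZL').seq fun C hC =>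
    (seedLengthP_sat hC.1.r6).seq fun D hD => (recv_sat (by norm_num)
    (by rw [hD.2.2]; exact hX.seedLength_le)).seq fun E hE => ?_).mono (c := 55 + (12 + (7 + (1 +
      (bucketsCost L m (s % 2 ^ (64 * L)) Z + (246 * (trim X.n Z').length + X.K * X.n * 37 +
        X.K * 15 + 90))))))
      ?_ fun _ h => h
  · obtain ⟨-, b2, b3⟩ := hB
    obtain ⟨hC, c2, c3⟩ := hC
    obtain ⟨d1, d2, d3⟩ := hD
    obtain ⟨e1, e2, e3⟩ := hE
    have hD := hC.congr d1
    have hmem : E.mem = A.mem := by rw [e2, d2, c2, b2]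
    have hch : D.ch = A.ch := by rw [d1.ch, c3, b3]
    rw [d3, hch, hin, take_natToBits_append.1, bitsToNat_natToBits] at e1
    rw [d3, hch, hin, take_natToBits_append.2] at e3
    set s' := s % 2 ^ (64 * L) with hs'
    have hE : Env X L m s' (trim X.n Z').length E := by
      refine hD.update ?_ ?_ fun r _ _ h => ?_
      · simp [e1, hD.r0]
      · simp [e1]
      · simp [e1, h]
    have hsw : s' < 2 ^ X.w :=
      (Nat.mod_lt _ (Nat.two_pow_pos _)).trans_le (hX.lt_pow (by omega))
    have hsub : (trim X.n Z').Sublist Z' := by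
      rw [trim]
      split_ifs
      · exact List.nil_sublist _
      · exact List.Sublist.refl _
    have key := restoreP_sat (Z := Z) (rest := []) hX hE hsw hℓ hL (hn ▸ hX.n_le)
      (hsub.length_le.trans hZL') hZ (hZ'.sublist (hsub.map _)) hlt
      (fun z hz => hlt' z (hsub.subset hz)) (hmem ▸ hcl.trim) (hmem ▸ h12)
      (hn ▸ card_diffs_trim_le hZ hZ' hd) (by rw [hs', load_mod]; exact hg)
      (by rw [e3, hs', rowsMsg_mod, List.append_nil])
    refine key.mono le_rfl ?_
    rintro F ⟨f1, f2, f3, f4⟩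
    refine ⟨?_, f2, by rw [f3, e3], by rw [f4, e3]⟩
    have : tabRow L m s' Z = tabRow L m s Z := congrFun tabRow_mod Z
    rwa [this] at f1
  · have : bucketsCost L m (s % 2 ^ (64 * L)) Z = bucketsCost L m s Z := by
      simp only [bucketsCost, cntRow, bucket_mod]
    rw [this, add_mul, add_mul]
    rw [add_mul] at hbc
    have : X.K * 37 * X.n = X.K * X.n * 37 := by ring
    omega

end

/-! ### Strings and lists of keys -/

section

variable {u σ : ℕ} {L : ℕ}

/-- A pair of a position and a character, packed into one number. -/
def key (L : ℕ) (x : Fin u × Fin σ) : ℕ := x.2 * 2 ^ L + x.1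

lemma key_mod (hu : u ≤ 2 ^ L) (x : Fin u × Fin σ) : key L x % 2 ^ L = x.1 := by
  rw [key, mul_comm, Nat.mul_add_mod, Nat.mod_eq_of_lt (x.1.isLt.trans_le hu)]

lemma key_div (hu : u ≤ 2 ^ L) (x : Fin u × Fin σ) : key L x / 2 ^ L = x.2 := by
  rw [key, mul_comm, Nat.mul_add_div (Nat.two_pow_pos L),
    Nat.div_eq_of_lt (x.1.isLt.trans_le hu), add_zero]

lemma key_injective (hu : u ≤ 2 ^ L) : Function.Injective (key (u := u) (σ := σ) L) := by
  intro x y h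
  refine Prod.ext (Fin.ext ?_) (Fin.ext ?_)
  · rw [← key_mod hu, h, key_mod hu]
  · rw [← key_div hu, h, key_div hu]

variable {s t : Fin u → Fin σ} {Ls Lt : List (Fin u × Fin σ)}

lemma Lists.nodup_fst (h : Lists Ls s) : (Ls.map Prod.fst).Nodup := by
  refine List.Nodup.map_on ?_ h.1
  rintro ⟨p, c⟩ hx ⟨p', c'⟩ hy rfl
  rw [← ((h.2 _ _).1 hx).1, ← ((h.2 _ _).1 hy).1]

lemma Lists.length_eq (h : Lists Ls s) : Ls.length = nonzeros s := by
  rw [nonzeros, ← List.length_map (f := Prod.fst), ← List.toFinset_card_of_nodup h.nodup_fst]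
  congr 1
  ext p
  rw [List.mem_toFinset, List.mem_map, Finset.mem_filter]
  constructor
  · rintro ⟨⟨p, c⟩, hx, rfl⟩
    obtain ⟨h1, h2⟩ := (h.2 p c).1 hx
    exact ⟨Finset.mem_univ _, by rw [h1]; exact h2⟩
  · rintro ⟨-, hp⟩
    exact ⟨(p, s p), (h.2 _ _).2 ⟨rfl, hp⟩, rfl⟩

lemma Lists.length_le (h : Lists Ls s) : Ls.length ≤ u := by
  have := h.nodup_fst.length_le_card
  rwa [List.length_map, Fintype.card_fin] at this

lemma Lists.nodup_mod (h : Lists Ls s) (hu : u ≤ 2 ^ L) :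
    ((Ls.map (key L)).map (· % 2 ^ L)).Nodup := by
  have : (Ls.map (key L)).map (· % 2 ^ L) = (Ls.map Prod.fst).map Fin.val := by
    rw [List.map_map, List.map_map]
    exact List.map_congr_left fun x _ => key_mod hu x
  rw [this]
  exact h.nodup_fst.map Fin.val_injective

lemma Lists.key_ne_zero (h : Lists Ls s) {z : ℕ} (hz : z ∈ Ls.map (key L)) : z ≠ 0 := by
  obtain ⟨⟨p, c⟩, hx, rfl⟩ := List.mem_map.1 hz
  have hc := ((h.2 p c).1 hx).2
  have := Nat.mul_pos (Nat.pos_of_ne_zero hc) (Nat.two_pow_pos L)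
  rw [key]
  exact (Nat.add_pos_left this _).ne'

lemma key_lt {b : ℕ} (hu : u ≤ 2 ^ L) (hσ : σ ≤ 2 ^ b) (x : Fin u × Fin σ) :
    key L x < 2 ^ (b + L) := by
  have h1 := x.1.isLt
  have h2 := Nat.mul_le_mul_right (2 ^ L) (show (x.2 : ℕ) + 1 ≤ 2 ^ b from x.2.isLt.trans_le hσ)
  rw [pow_add, key]
  rw [add_mul] at h2
  omega

lemma card_diffs_le (hu : u ≤ 2 ^ L) (hs : Lists Ls s) (ht : Lists Lt t) :
    (diffs L (Ls.map (key L)) (Lt.map (key L))).card ≤ hammingDist s t := by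
  rw [hammingDist, ← Finset.card_map Fin.valEmbedding]
  refine Finset.card_le_card fun y hy => ?_
  obtain ⟨z, hz, rfl⟩ := Finset.mem_image.1 hy
  rw [Finset.mem_symmDiff, List.mem_toFinset, List.mem_toFinset] at hz
  -- a pair that only one of the strings contains belongs to a position at which they differ
  have key' : ∀ {s t : Fin u → Fin σ} {Ls Lt : List (Fin u × Fin σ)}, Lists Ls s → Lists Lt t →
      z ∈ Ls.map (key L) → z ∉ Lt.map (key L) → ∃ p, s p ≠ t p ∧ z % 2 ^ L = p := by
    intro s t Ls Lt hs ht h1 h2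
    obtain ⟨⟨p, c⟩, hx, rfl⟩ := List.mem_map.1 h1
    obtain ⟨h3, h4⟩ := (hs.2 p c).1 hx
    refine ⟨p, fun he => h2 (List.mem_map.2 ⟨(p, c), (ht.2 p c).2 ⟨?_, h4⟩, rfl⟩), key_mod hu _⟩
    rw [← he, h3]
  rw [Finset.mem_map]
  rcases hz with ⟨h1, h2⟩ | ⟨h1, h2⟩
  · obtain ⟨p, hp, he⟩ := key' hs ht h1 h2
    exact ⟨p, Finset.mem_filter.2 ⟨Finset.mem_univ _, hp⟩, he.symm⟩
  · obtain ⟨p, hp, he⟩ := key' ht hs h1 h2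
    exact ⟨p, Finset.mem_filter.2 ⟨Finset.mem_univ _, hp.symm⟩, he.symm⟩

lemma exists_lists (hu : u ≤ 2 ^ L) (hs : Lists Ls s) {l : List ℕ} (hl : l.Nodup)
    (h : ∀ z, z ∈ l ↔ z ∈ Ls.map (key L)) : ∃ L', Lists L' s ∧ l = L'.map (key L) := by
  obtain ⟨L', rfl⟩ : l ∈ Set.range (List.map (key (u := u) (σ := σ) L)) := by
    rw [Set.range_list_map]
    intro z hz
    obtain ⟨x, -, hx⟩ := List.mem_map.1 ((h z).1 hz)
    exact ⟨x, hx⟩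
  refine ⟨L', ⟨hl.of_map, fun p c => ?_⟩, rfl⟩
  have := h (key L (p, c))
  rw [List.mem_map_of_injective (key_injective hu), List.mem_map_of_injective (key_injective hu)]
    at this
  rw [this, hs.2]

/-! ### Initial and final configurations -/

/-- The initial configuration of a player with the list `Ls`. -/
def startAbs (X : Mach) (L : ℕ) (Ls : List (Fin u × Fin σ)) (msg : List Bool) : Abs where
  reg := fun r => match r with
    | 0 => Ls.length
    | 1 => X.n
    | 2 => X.k
    | 3 => u
    | 4 => σ
    | 5 => lg X.n
    | 6 => lg u
    | 7 => lg σ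
    | _ => 0
  mem := fun q r => if q = 0 ∧ r / 2 < Ls.length then
      (if r % 2 = 0 then (Ls.map (key L)).getD (r / 2) 0 % 2 ^ L
        else (Ls.map (key L)).getD (r / 2) 0 / 2 ^ L) else 0
  ch := ⟨msg, [], 0, 0, 0⟩

lemma start_rep {X : Mach} (hu : u ≤ 2 ^ L) (hLN : X.LN ≤ X.w) (Ls : List (Fin u × Fin σ))
    (hl : 2 * Ls.length ≤ 2 ^ X.LN) (msg : List Bool) :
    Rep X (start X.w X.n X.k Ls msg) (startAbs X L Ls msg) := by
  refine ⟨fun r _ => rfl, fun q r hq hr => ?_, rfl, rfl, rfl, rfl, rfl, hLN⟩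
  have ha := addr_lt hLN hq hr
  simp only [start, loadList, startAbs, BitVec.toNat_ofNat, Nat.mod_eq_of_lt ha]
  by_cases hq0 : q = 0
  · subst hq0
    simp only [zero_mul, zero_add, true_and]
    split_ifs with h1 h2
    · rw [List.getD_eq_getElem _ _ (by simpa using h1), List.getElem_map, key_mod hu]
    · rw [List.getD_eq_getElem _ _ (by simpa using h1), List.getElem_map, key_div hu]
    · rfl
  · have : 1 * 2 ^ X.LN ≤ q * 2 ^ X.LN := Nat.mul_le_mul_right _ (by omega)
    rw [dif_neg (by omega), if_neg fun h => hq0 h.1]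
    rfl

lemma startAbs_input (X : Mach) (Ls : List (Fin u × Fin σ)) (msg : List Bool) :
    Input L (Ls.map (key L)) ((startAbs X L Ls msg).mem 0) := by
  intro e he
  rw [List.length_map] at he
  simp only [startAbs, true_and]
  rw [if_pos (by omega), if_pos (by omega), if_pos (by omega), if_neg (by omega),
    show (2 * e) / 2 = e by omega, show (2 * e + 1) / 2 = e by omega]
  exact ⟨rfl, rfl⟩

lemma startAbs_mem (X : Mach) (Ls : List (Fin u × Fin σ)) (msg : List Bool) {q : ℕ} (hq : q ≠ 0)
    (r : ℕ) : (startAbs X L Ls msg).mem q r = 0 := by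
  rw [startAbs]
  exact if_neg fun h => hq h.1

lemma startAbs_clean (X : Mach) (Ls : List (Fin u × Fin σ)) (msg : List Bool) (m : ℕ) :
    Clean L m (Ls.map (key L)) (startAbs X L Ls msg).mem :=
  ⟨startAbs_input X Ls msg, fun q _ _ r => startAbs_mem X Ls msg (by omega) r,
    fun q _ r _ => startAbs_mem X Ls msg (by omega) r⟩

lemma storedAt_of_input {X : Mach} {S : State X.w} {A : Abs} (hR : Rep X S A) (hu : u ≤ 2 ^ L)
    {L' : List (Fin u × Fin σ)} (hin : Input L (L'.map (key L)) (A.mem 6))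
    (h0 : A.reg 0 = 6 * 2 ^ X.LN) (h6 : 6 < 2 ^ (X.w - X.LN)) (hl : 2 * L'.length ≤ 2 ^ X.LN) :
    StoredAt S.mem (S.reg 0) L' := by
  intro i hi
  obtain ⟨h1, h2⟩ := hin i (by simpa using hi)
  rw [List.getD_eq_getElem _ _ (by simpa using hi), List.getElem_map] at h1 h2
  rw [key_mod hu] at h1
  rw [key_div hu] at h2
  rw [hR.reg 0 (by norm_num), h0, ← BitVec.ofNat_add, ← BitVec.ofNat_add,
    hR.mem 6 _ h6 (by omega), hR.mem 6 _ h6 (by omega), h1, h2]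
  exact ⟨rfl, rfl⟩

end

lemma le_two_pow_lg (x : ℕ) : x ≤ 2 ^ lg x :=
  (le_max_left x 2).trans (Nat.le_pow_clog (by norm_num) _)

lemma one_le_lg (x : ℕ) : 1 ≤ lg x :=
  Nat.clog_pos (by norm_num) (le_max_right x 2)

lemma lg_mono {x y : ℕ} (h : x ≤ y) : lg x ≤ lg y :=
  Nat.clog_mono_right 2 (max_le_max_right 2 h)

lemma two_pow_lg_pred_le {x : ℕ} (h : 1 ≤ x) : 2 ^ (lg x - 1) ≤ x := by
  rcases Nat.lt_or_ge x 2 with h2 | h2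
  · obtain rfl : x = 1 := by omega
    rw [lg, max_eq_right (by norm_num), Nat.clog_eq_one (by norm_num) (by norm_num)]
    norm_num
  · rw [lg, max_eq_left h2]
    exact (Nat.pow_pred_clog_lt_self (by norm_num) (by omega)).le

/-! ### The run of the sender -/

section

variable {X : Mach} {L m s : ℕ} {A : Abs} {Z : List ℕ}

/-- A bound for the time of a round of the sender. -/
def roundCost (m len : ℕ) : ℕ :=
  1 + ((15 * 2 ^ m + 8) + ((246 * len + 8) + (24 * 2 ^ m + 16)))

lemma mem_badSeeds {x : Fin (2 ^ X.w)} :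
    x ∈ badSeeds L m X.w Z ↔ seedBound * Z.length < load L m x Z := by
  simp [badSeeds]

lemma rounds_sat (hX : Size X L m) (hA : Env X L m s Z.length A) (hn : Z.length = X.n)
    (hcl : Clean L m Z A.mem) (h27 : A.reg 27 = 1) (hdr : A.ch.drawn = 0) {g : ℕ}
    (hg : X.tape g ∉ badSeeds L m X.w Z) (hb : ∀ r < g, X.tape r ∈ badSeeds L m X.w Z) :
    Sat X (.while 27 roundP) A ((g + 1) * (roundCost m Z.length + 1) + 1) (fun B =>
      Env X L m (X.tape g) Z.length B ∧ Clean L m Z B.mem ∧ Stored L m (X.tape g) Z B.mem ∧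
        B.mem 1 = cntRow L m (X.tape g) Z ∧ B.ch = { A.ch with drawn := g + 1 }) := by
  have h1w := hX.le_w (show 1 ≤ 2 ^ 28 * 2 ^ L by have := Nat.two_pow_pos L; omega)
  refine (Sat.while (by norm_num) (fun _ => roundCost m Z.length) (fun j B => j ≤ g + 1 ∧
    ∃ s, Env X L m s Z.length B ∧ Clean L m Z B.mem ∧
      B.ch = { A.ch with drawn := g + 1 - j } ∧ B.reg 27 = (if j = 0 then 0 else 1) ∧
      (j = 0 → s = X.tape g ∧ Stored L m s Z B.mem ∧ B.mem 1 = cntRow L m s Z))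
    ?_ ?_ ?_ (g + 1) ⟨le_rfl, s, hA, hcl, ?_, by simpa using h27, by simp⟩).mono ?_ ?_
  · rintro j B ⟨-, s, -, -, -, h, -⟩
    rw [h]
    split_ifs <;> omega
  · rintro B ⟨-, s, -, -, -, h, -⟩
    exact h
  · rintro j B ⟨hj, s, h1, h2, h3, h4, -⟩
    refine ⟨by rw [h4]; simp, (roundP_sat hX h1 (hn ▸ hX.n_le) h2 rfl).mono le_rfl ?_⟩
    rintro C ⟨c1, c2, c3, c4, c5, c6⟩
    have hd : B.ch.drawn = g - j := by
      rw [h3]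
      simp only
      omega
    rw [hd] at c1 c3 c4 c6
    refine ⟨by omega, _, c1, c2, ?_, ?_, ?_⟩
    · rw [c5, h3]
      simp only [Chan.mk.injEq, true_and, and_true]
      omega
    · rw [c6, ← hn]
      by_cases hj0 : j = 0
      · subst hj0
        rw [Nat.sub_zero, if_neg (mt mem_badSeeds.2 hg), if_pos rfl]
      · rw [if_pos (mem_badSeeds.1 (hb _ (by omega))), if_neg hj0]
    · rintro rfl
      exact ⟨rfl, c3, c4⟩
  · rw [Nat.sub_self, ← hdr]
  · rw [Finset.sum_const, Finset.card_range, smul_eq_mul]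
  · rintro B ⟨-, s, h1, h2, h3, -, h5⟩
    obtain ⟨rfl, h6, h7⟩ := h5 rfl
    exact ⟨h1, h2, h6, h7, h3⟩

/-- The sender does not halt if all seeds are bad. -/
lemma not_exec_rounds (hX : Size X L m) (hA : Env X L m s Z.length A) (hn : Z.length = X.n)
    (hcl : Clean L m Z A.mem) (h27 : A.reg 27 = 1) (hb : ∀ r, X.tape r ∈ badSeeds L m X.w Z)
    {S T : State X.w} (hS : Rep X S A) : ¬ X.Exec (.while 27 roundP) S T := by
  refine not_exec_while (fun S => ∃ A s, Rep X S A ∧ Env X L m s Z.length A ∧ Clean L m Z A.mem ∧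
    A.reg 27 = 1) ?_ ⟨A, s, hS, hA, hcl, h27⟩
  rintro S ⟨A, s, h1, h2, h3, h4⟩
  have h1w := hX.le_w (show 1 ≤ 2 ^ 28 * 2 ^ L by have := Nat.two_pow_pos L; omega)
  constructor
  · rw [Ne, h1.reg_eq_zero (by norm_num) (by rwa [h4]), h4]
    norm_num
  · obtain ⟨T, B, t1, -, t3, b1, b2, -, -, -, b6⟩ :=
      roundP_sat hX h2 (hn ▸ hX.n_le) h3 rfl S.tick h1.tick
    refine ⟨T, t1, B, _, t3, b1, b2, ?_⟩
    rw [b6, ← hn, if_pos (mem_badSeeds.1 (hb _))]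

lemma beforeRounds_sat (hX : Size X L m) (h0 : A.reg 0 = Z.length) (h1 : A.reg 1 = X.n)
    (h5 : A.reg 5 = m + 1) (h6 : A.reg 6 = L) (h21 : A.reg 21 = 0) (hcl : Clean L m Z A.mem) :
    Sat X (.seq setupP (block [.const 27 1])) A 59 (fun B => Env X L m 0 Z.length B ∧
      Clean L m Z B.mem ∧ B.reg 27 = 1 ∧ B.ch = A.ch) := by
  refine ((setupP_sat hX h0 h1 h5 h6 h21).seq (c' := 4) fun B hB => Sat.blk (by simp) ?_).mono
    (by norm_num) fun _ h => h
  obtain ⟨b1, b2, b3⟩ := hB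
  refine ⟨b1.of_reg fun r hr => ?_, by simpa [evalL, b2] using hcl, by simp [evalL], by simp [b3]⟩
  simp [evalL, hr.ne]

lemma sendP_sat (hX : Size X L m) (h0 : A.reg 0 = Z.length) (h1 : A.reg 1 = X.n)
    (h5 : A.reg 5 = m + 1) (h6 : A.reg 6 = L) (h21 : A.reg 21 = 0) (hcl : Clean L m Z A.mem)
    (hch : A.ch = ⟨[], [], 0, 0, 0⟩) (hℓ : X.ℓ ≤ X.w) (hn : Z.length = X.n)
    (hZ : (Z.map (· % 2 ^ L)).Nodup) (hlt : ∀ z ∈ Z, z < 2 ^ X.w) {g : ℕ}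
    (hg : X.tape g ∉ badSeeds L m X.w Z) (hb : ∀ r < g, X.tape r ∈ badSeeds L m X.w Z) :
    Sat X (sendP X.K) A (320 * X.n * (g + 1) +
        ((2600 * seedBound + 360) * X.n + (X.K * 15 + 120))) (fun B =>
      B.ch.outMsg = natToBits (64 * L) (X.tape g) ++ rowsMsg X L m (X.tape g) Z ∧
      B.ch.encCalls = 3 + X.K ∧ B.ch.decCalls = 0) := by
  have hload : load L m (X.tape g) Z ≤ seedBound * X.n := by
    rw [← hn]
    exact not_lt.1 (mt mem_badSeeds.2 hg)
  have hbc := bucketsCost_le hload hX.pow_le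
  refine ((beforeRounds_sat hX h0 h1 h5 h6 h21 hcl).seq fun B hB =>
    (rounds_sat hX hB.1 hn hB.2.1 hB.2.2.1 (by rw [hB.2.2.2, hch]) hg hb).seq fun C hC =>
    (transmitP_sat hX hC.1 hℓ (hn ▸ hX.n_le) hZ hlt hC.2.1 hC.2.2.1 hC.2.2.2.1 hload).mono le_rfl
      (Q' := fun D => D.ch.outMsg = natToBits (64 * L) (X.tape g) ++
        rowsMsg X L m (X.tape g) Z ∧ D.ch.encCalls = 3 + X.K ∧ D.ch.decCalls = 0) ?_).mono
    ?_ fun _ h => h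
  · rintro D ⟨d1, d2, d3⟩
    obtain ⟨-, -, -, b4⟩ := hB
    obtain ⟨-, -, -, -, c5⟩ := hC
    rw [d1, d2, d3, c5, b4, hch]
    simp
  · have h1 : roundCost m Z.length + 1 ≤ 320 * X.n := by
      have := hX.pow_le
      have := hX.one_le
      rw [roundCost]
      omega
    have h2 := Nat.mul_le_mul_left (g + 1) h1
    rw [mul_comm (g + 1) (320 * X.n)] at h2
    omega

end

/-! ### The two players -/

/-- The program of the sender. There is nothing to send if `n = 0`. -/
def senderP (K : ℕ) : Prog := .ite 1 (sendP K) (block [])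

/-- The program of the receiver. -/
def receiverP (K : ℕ) : Prog := .ite 1 (receiveP K) (block [])

lemma isDeterministic_block (l : List Cmd) : (block l).IsDeterministic := by
  induction l with
  | nil => trivial
  | cons c l ih => cases c <;> simp [block, Cmd.prog, addrProg, Prog.IsDeterministic, ih]

lemma isDeterministic_receiverP (K : ℕ) : (receiverP K).IsDeterministic := by
  simp [receiverP, receiveP, setupP, trimP, seedLengthP, restoreP, insertP, hashP, decP, addrProg,
    measureP, maskP, modulusP, slotP, fillP, tabP, outP, forP, Prog.IsDeterministic,
    isDeterministic_block]

section

variable {X : Mach} {u σ : ℕ} {s t : Fin u → Fin σ} {Ls Lt : List (Fin u × Fin σ)}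

/-- The parameters of the machine are the ones that the protocol needs. -/
structure Params (X : Mach) (u σ : ℕ) : Prop where
  LN : X.LN = lg u + 28
  K : X.K = 2 ^ 27
  ℓ : X.ℓ = 128 * (lg σ + lg u)
  le : X.ℓ ≤ X.w

lemma Params.size (hX : Params X u σ) (h1 : 1 ≤ X.n) (hu : X.n ≤ u) :
    Size X (lg u) (lg X.n - 1) where
  one_le := h1
  n_le := hu.trans (le_two_pow_lg u)
  m_le := (Nat.sub_le _ _).trans (lg_mono hu)
  pow_le := two_pow_lg_pred_le h1
  le_pow := by
    rw [← pow_succ', Nat.sub_add_cancel (one_le_lg _)]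
    exact le_two_pow_lg _
  LN := hX.LN
  K := hX.K
  w := by
    have h2 := hX.le
    have h3 := one_le_lg σ
    rw [hX.ℓ] at h2
    omega

lemma Params.key_lt (hX : Params X u σ) (Ls : List (Fin u × Fin σ)) :
    ∀ z ∈ Ls.map (key (lg u)), z < 2 ^ X.ℓ := by
  intro z hz
  obtain ⟨x, -, rfl⟩ := List.mem_map.1 hz
  refine (SetRec.key_lt (le_two_pow_lg u) (le_two_pow_lg σ) x).trans_le
    (Nat.pow_le_pow_right (by norm_num) ?_)
  rw [hX.ℓ]
  omega

lemma Params.start_rep (hX : Params X u σ) (hs : Lists Ls s) (msg : List Bool) :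
    Rep X (start X.w X.n X.k Ls msg) (startAbs X (lg u) Ls msg) := by
  refine SetRec.start_rep (le_two_pow_lg u) ?_ Ls ?_ msg
  · have h2 := hX.le
    have h3 := one_le_lg σ
    rw [hX.ℓ] at h2
    rw [hX.LN]
    omega
  · have h1 := hs.length_le.trans (le_two_pow_lg u)
    rw [hX.LN, pow_add]
    omega

lemma Params.reg_one_lt (hX : Params X u σ) (hu : X.n ≤ u) : X.n < 2 ^ X.w := by
  refine (hu.trans (le_two_pow_lg u)).trans_lt (Nat.pow_lt_pow_right (by norm_num) ?_)
  have h2 := hX.le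
  have h3 := one_le_lg σ
  rw [hX.ℓ] at h2
  omega

lemma sender_run (hX : Params X u σ) (h1 : 1 ≤ X.n) (hn : nonzeros s = X.n) (hs : Lists Ls s) {g : ℕ}
    (hg : X.tape g ∉ badSeeds (lg u) (lg X.n - 1) X.w (Ls.map (key (lg u))))
    (hb : ∀ r < g, X.tape r ∈ badSeeds (lg u) (lg X.n - 1) X.w (Ls.map (key (lg u)))) :
    ∃ T : State X.w, X.Exec (senderP X.K) (start X.w X.n X.k Ls []) T ∧
      T.steps ≤ 320 * X.n * (g + 1) + ((2600 * seedBound + 360) * X.n + (X.K * 15 + 121)) ∧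
      T.outMsg = natToBits (64 * lg u) (X.tape g) ++
        rowsMsg X (lg u) (lg X.n - 1) (X.tape g) (Ls.map (key (lg u))) ∧
      T.encCalls = 3 + X.K ∧ T.decCalls = 0 := by
  have hlen : Ls.length = X.n := hs.length_eq.trans hn
  have hu : X.n ≤ u := hlen ▸ hs.length_le
  have hsz := hX.size h1 hu
  have hlt : ∀ z ∈ Ls.map (key (lg u)), z < 2 ^ X.w := fun z hz =>
    (hX.key_lt Ls z hz).trans_le (Nat.pow_le_pow_right (by norm_num) hX.le)
  have key := Sat.ite (X := X) (A := startAbs X (lg u) Ls []) (a := 1) (q := block [])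
    (by norm_num) (hX.reg_one_lt hu)
    (fun _ => sendP_sat hsz (by simp [startAbs]) rfl
      (Nat.sub_add_cancel (one_le_lg X.n)).symm rfl rfl (startAbs_clean X Ls [] _) rfl hX.le
      (by simpa using hlen) (hs.nodup_mod (le_two_pow_lg u)) hlt hg hb)
    (fun h => absurd h (Nat.pos_iff_ne_zero.1 h1))
  obtain ⟨T, B, t1, t2, t3, b1, b2, b3⟩ := key _ (hX.start_rep hs [])
  refine ⟨T, t1, t2.trans ?_, t3.outMsg.trans b1, t3.encCalls.trans b2, t3.decCalls.trans b3⟩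
  simp only [start]
  omega

lemma not_exec_senderP (hX : Params X u σ) (h1 : 1 ≤ X.n) (hn : nonzeros s = X.n)
    (hs : Lists Ls s)
    (hb : ∀ r, X.tape r ∈ badSeeds (lg u) (lg X.n - 1) X.w (Ls.map (key (lg u)))) {T : State X.w} :
    ¬ X.Exec (senderP X.K) (start X.w X.n X.k Ls []) T := by
  have hlen : Ls.length = X.n := hs.length_eq.trans hn
  have hu : X.n ≤ u := hlen ▸ hs.length_le
  have hsz := hX.size h1 hu
  have hrep := hX.start_rep hs []
  intro h
  cases h with
  | iteFalse h0 _ =>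
    have h0 := (hrep.reg_eq_zero (a := 1) (by norm_num) (hX.reg_one_lt hu)).1 h0
    exact absurd h0 (Nat.pos_iff_ne_zero.1 h1)
  | iteTrue _ h =>
    cases h with
    | seq h2 h3 =>
      cases h3 with
      | seq h4 _ =>
        obtain ⟨T', B, t1, -, t3, b1, b2, b3, -⟩ := beforeRounds_sat hsz (by simp [startAbs]) rfl
          (Nat.sub_add_cancel (one_le_lg X.n)).symm rfl rfl (startAbs_clean X Ls [] _) _ hrep.tick
        cases t1.unique h2
        exact not_exec_rounds hsz b1 (by simpa using hlen) b2 b3 hb t3 h4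

lemma receiver_run (hX : Params X u σ) (h1 : 1 ≤ X.n) (hn : nonzeros s = X.n) (hs : Lists Ls s)
    (ht : Lists Lt t) (hd : hammingDist s t ≤ X.k) {a : ℕ}
    (hg : load (lg u) (lg X.n - 1) a (Ls.map (key (lg u))) ≤ seedBound * X.n) :
    ∃ T : State X.w, X.Exec (receiverP X.K) (start X.w X.n X.k Lt (natToBits (64 * lg u) a ++
        rowsMsg X (lg u) (lg X.n - 1) a (Ls.map (key (lg u))))) T ∧
      (∃ L, Lists L s ∧ StoredAt T.mem (T.reg 0) L) ∧
      T.steps ≤ (2600 * seedBound + 900 + X.K * 37) * X.n + (X.K * 15 + 201) ∧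
      T.encCalls = 0 ∧ T.decCalls = 3 + X.K := by
  have hlen : Ls.length = X.n := hs.length_eq.trans hn
  have hu : X.n ≤ u := hlen ▸ hs.length_le
  have hsz := hX.size h1 hu
  have hu2 := le_two_pow_lg u
  have hlt : ∀ z ∈ Lt.map (key (lg u)), z < 2 ^ X.w := fun z hz =>
    (hX.key_lt Lt z hz).trans_le (Nat.pow_le_pow_right (by norm_num) hX.le)
  have hZ := hs.nodup_mod hu2
  set msg := natToBits (64 * lg u) a ++
        rowsMsg X (lg u) (lg X.n - 1) a (Ls.map (key (lg u))) with hmsg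
  have key' := Sat.ite (X := X) (A := startAbs X (lg u) Lt msg) (a := 1) (q := block [])
    (by norm_num) (hX.reg_one_lt hu)
    (fun _ => receiveP_sat (Z := Ls.map (key (lg u))) (Z' := Lt.map (key (lg u))) hsz
      (by simp [startAbs]) rfl (Nat.sub_add_cancel (one_le_lg X.n)).symm rfl rfl hX.le
      (by
        have := one_le_lg σ
        rw [hX.ℓ]
        omega)
      (by simpa using hlen) (by simpa using ht.length_le.trans hu2) hZ (ht.nodup_mod hu2)
      (hX.key_lt Ls) hlt (startAbs_clean X Lt msg _)
      (fun q hq r _ => startAbs_mem X Lt msg (by omega) r)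
      ((card_diffs_le hu2 hs ht).trans hd) hg rfl)
    (fun h => absurd h (Nat.pos_iff_ne_zero.1 h1))
  obtain ⟨T, B, t1, t2, t3, b1, b2, b3, b4⟩ := key' _ (hX.start_rep ht msg)
  refine ⟨T, t1, ?_, t2.trans ?_, t3.encCalls.trans (b3.trans rfl),
    t3.decCalls.trans (b4.trans (by simp [startAbs]))⟩
  · obtain ⟨k1, k2⟩ := keysOf_tabRow (s := a) (N := X.K * X.n) hsz.m_le hZ
      (fun z hz => hs.key_ne_zero hz) (by rw [hX.K]; exact offset_prmRow_le hg hsz.pow_le)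
    obtain ⟨L', hL', he⟩ := exists_lists hu2 hs k1 k2
    rw [he] at b1
    refine ⟨L', hL', storedAt_of_input t3 hu2 b1 b2 (hsz.row' (by norm_num)) ?_⟩
    have h2 := hL'.length_le.trans hu2
    rw [hX.LN, pow_add]
    omega
  · simp only [start]
    omega

end

lemma exec_of_reg_one_eq_zero {X : Mach} {p : Prog} {S : State X.w} (h : S.reg 1 = 0) :
    ∃ T : State X.w, X.Exec (.ite 1 p (block [])) S T ∧ T.steps = S.steps + 2 ∧
      T.outMsg = S.outMsg ∧ T.encCalls = S.encCalls ∧ T.decCalls = S.decCalls :=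
  ⟨_, .iteFalse h (.instr _ _), rfl, rfl, rfl, rfl⟩

/-- The expected time of an execution if the times of the calls of the decoder are random. -/
lemma lintegral_steps_le {Ω : Type} [MeasurableSpace Ω] (P : Measure Ω) [IsProbabilityMeasure P]
    (D : ℕ → Ω → ℝ≥0∞) (td steps calls : ℕ) (hD : ∀ i, Measurable (D i))
    (h : ∀ i, ∫⁻ ω, D i ω ∂P ≤ td) :
    ∫⁻ ω, (steps + ∑ i ∈ Finset.range calls, D i ω) ∂P ≤ (steps + calls * td : ℕ) := by
  rw [lintegral_add_left measurable_const, lintegral_const, measure_univ, mul_one,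
    lintegral_finsetSum _ fun i _ => hD i]
  push_cast
  gcongr
  refine (Finset.sum_le_sum fun i _ => h i).trans ?_
  simp

end SetRec

open SetRec in
theorem mainTheorem2 :
    ∃ (c C : ℕ) (sender receiver : SetRec.Prog), 0 < c ∧ receiver.IsDeterministic ∧
      ∀ (u σ n k w ρ te td : ℕ), c * (SetRec.lg σ + SetRec.lg u) ≤ w →
      ∀ (code : SetRec.SystematicCode n k (2 ^ (c * (SetRec.lg σ + SetRec.lg u))) ρ)
        (s : Fin u → Fin σ) (Ls : List (Fin u × Fin σ)),
        SetRec.nonzeros s = n → SetRec.Lists Ls s →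
        -- expected running time of the sender
        (∫⁻ tape, SetRec.runTime code te td sender (SetRec.start w n k Ls []) tape
            ∂(SetRec.tapeLaw w) ≤ (C * (n + te + 1) : ℕ)) ∧
        -- whatever the random words are, once the sender has halted in `S`, with message `S.outMsg`
        ∀ (tape : ℕ → Fin (2 ^ w)) (S : SetRec.State w),
          SetRec.Exec code tape sender (SetRec.start w n k Ls []) S →
          -- length of the message in bits; the redundancy of the code has `ρ * ℓ` bits
          S.outMsg.length ≤
            C * (SetRec.lg u + ρ * (c * (SetRec.lg σ + SetRec.lg u))) ∧
          ∀ (t : Fin u → Fin σ) (Lt : List (Fin u × Fin σ)) (tape' : ℕ → Fin (2 ^ w)),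
            hammingDist s t ≤ k → SetRec.Lists Lt t →
            ∃ R : SetRec.State w,
              SetRec.Exec code tape' receiver (SetRec.start w n k Lt S.outMsg) R ∧
              -- the receiver ends with the string `s` in compressed form
              (∃ L, SetRec.Lists L s ∧ SetRec.StoredAt R.mem (R.reg 0) L) ∧
              -- worst-case running time of the receiver
              R.time te td ≤ C * (n + td + 1) ∧
              -- expected running time if the time `D i` of the `i`-th call of the decoder is random
              ∀ (Ω : Type) (_ : MeasurableSpace Ω) (P : Measure Ω) (D : ℕ → Ω → ℝ≥0∞),
                IsProbabilityMeasure P → (∀ i, Measurable (D i)) →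
                (∀ i, ∫⁻ ω, D i ω ∂P ≤ td) →
                ∫⁻ ω, (R.steps + ∑ i ∈ Finset.range R.decCalls, D i ω) ∂P
                  ≤ (C * (n + td + 1) : ℕ) := by
  -- the two numbers are kept abstract, so that they are not evaluated
  obtain ⟨K, hK⟩ : ∃ K : ℕ, K = 2 ^ 27 := ⟨_, rfl⟩
  obtain ⟨C, hC⟩ : ∃ C : ℕ, C = 2 ^ 40 := ⟨_, rfl⟩
  refine ⟨128, C, senderP K, receiverP K, by norm_num, isDeterministic_receiverP K, ?_⟩
  intro u σ n k w ρ te td hw code s Ls hn hs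
  let X : (ℕ → Fin (2 ^ w)) → Mach := fun tape =>
    ⟨w, n, k, 128 * (lg σ + lg u), ρ, lg u + 28, K, code, tape⟩
  have hX : ∀ tape, Params (X tape) u σ := fun tape => ⟨rfl, hK, rfl, hw⟩
  have hlen : Ls.length = n := hs.length_eq.trans hn
  have hsb : seedBound = 50331648 := by norm_num [seedBound]
  have hK' : K = 134217728 := by rw [hK]; norm_num
  have hC' : C = 1099511627776 := by rw [hC]; norm_num
  rcases Nat.eq_zero_or_pos n with h0 | h1
  · have hreg : ∀ (L : List (Fin u × Fin σ)) (msg : List Bool),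
        (start w n k L msg).reg 1 = 0 := by
      intro L msg
      rw [h0]
      rfl
    have hnil : Ls = [] := List.length_eq_zero_iff.1 (hlen.trans h0)
    have hrun := fun tape L msg =>
      exec_of_reg_one_eq_zero (X := X tape) (p := sendP K) (hreg L msg)
    refine ⟨?_, fun tape S hS => ?_⟩
    · have : IsProbabilityMeasure (tapeLaw w) := by unfold tapeLaw; infer_instance
      refine (lintegral_mono (g := fun _ => ((C * (n + te + 1) : ℕ) : ℝ≥0∞)) fun tape => ?_).trans
        (by simp)
      obtain ⟨T, t1, t2, t3, t4, t5⟩ := hrun tape Ls []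
      refine (iInf₂_le T t1).trans ?_
      rw [Nat.cast_le, State.time, t2, t4, t5]
      simp only [start]
      rw [hC']
      omega
    · obtain ⟨T, t1, t2, t3, t4, t5⟩ := hrun tape Ls []
      obtain rfl := Mach.Exec.unique (X := X tape) t1 hS
      rw [t3]
      refine ⟨by simp [start], fun t Lt tape' hd ht => ?_⟩
      obtain ⟨R, r1, r2, r3, r4, r5⟩ := exec_of_reg_one_eq_zero (X := X tape') (p := receiveP K)
        (hreg Lt (start w n k Ls []).outMsg)
      refine ⟨R, r1, ⟨[], hnil ▸ hs, fun i hi => absurd hi (by simp)⟩, ?_, ?_⟩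
      · rw [State.time, r2, r4, r5]
        simp only [start]
        rw [hC']
        omega
      · intro Ω _ P D _ hD1 hD2
        refine (lintegral_steps_le P D td _ _ hD1 hD2).trans ?_
        rw [Nat.cast_le, r2, r5]
        simp only [start]
        rw [hC']
        omega
  · have hu : n ≤ u := hlen ▸ hs.length_le
    have hsz : ∀ tape, Size (X tape) (lg u) (lg n - 1) := fun tape => (hX tape).size h1 hu
    set Z := Ls.map (key (lg u)) with hZ
    have hZn : Z.length = n := by rw [hZ, List.length_map, hlen]
    refine ⟨?_, fun tape S hS => ?_⟩
    · have hbad : 2 * (badSeeds (lg u) (lg n - 1) w Z).card ≤ 2 ^ w :=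
        two_mul_card_badSeeds_le (hsz fun _ => 0).m_le (hsz fun _ => 0).seedLength_le
          (hs.nodup_mod (le_two_pow_lg u)) ((hsz fun _ => 0).pow_le.trans hZn.ge)
          (hZn.le.trans (hsz fun _ => 0).le_pow)
      refine (lintegral_le_of_rounds hbad _ (320 * n)
        ((2600 * seedBound + 360) * n + (K * 15 + 121) + (3 + K) * te) (by omega)
        fun tape g hg hb => ?_).trans ?_
      · obtain ⟨T, t1, t2, -, t4, t5⟩ := sender_run (hX tape) h1 hn hs hg hb
        refine (iInf₂_le T t1).trans ?_
        rw [Nat.cast_le, State.time, t4, t5]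
        change T.steps ≤ 320 * n * (g + 1) + ((2600 * seedBound + 360) * n + (K * 15 + 121)) at t2
        change T.steps + (3 + K) * te + 0 * td ≤ _
        omega
      · rw [Nat.cast_le, hsb, hK', hC']
        omega
    · by_cases hex : ∃ g, tape g ∉ badSeeds (lg u) (lg n - 1) w Z
      · classical
        have hg := Nat.find_spec hex
        have hload : load (lg u) (lg n - 1) (tape (Nat.find hex)) Z ≤ seedBound * n := by
          refine (not_lt.1 (mt (mem_badSeeds (X := X tape)).2 hg)).trans ?_
          rw [hZn]
        obtain ⟨T, t1, -, t3, -, -⟩ := sender_run (hX tape) h1 hn hs hg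
          fun r hr => not_not.1 (Nat.find_min hex hr)
        obtain rfl := Mach.Exec.unique (X := X tape) t1 hS
        rw [t3]
        refine ⟨?_, fun t Lt tape' hd ht => ?_⟩
        · rw [List.length_append, length_natToBits, length_rowsMsg]
          change 64 * lg u + (3 + K) * (ρ * (128 * (lg σ + lg u))) ≤ _
          generalize ρ * (128 * (lg σ + lg u)) = y
          rw [hK', hC']
          omega
        · obtain ⟨R, r1, r2, r3, r4, r5⟩ := receiver_run (hX tape') h1 hn hs ht hd hload
          change R.steps ≤ (2600 * seedBound + 900 + K * 37) * n + (K * 15 + 201) at r3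
          change R.decCalls = 3 + K at r5
          have hfin : R.steps + (3 + K) * td ≤ C * (n + td + 1) := by
            rw [hsb, hK'] at r3
            rw [hK', hC']
            omega
          refine ⟨R, r1, r2, ?_, ?_⟩
          · rw [State.time, r4, r5]
            omega
          · intro Ω _ P D _ hD1 hD2
            refine (lintegral_steps_le P D td _ _ hD1 hD2).trans ?_
            rw [Nat.cast_le, r5]
            exact hfin
      · push Not at hex
        exact absurd hS (not_exec_senderP (hX tape) h1 hn hs hex)
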